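/- **Setting.** For $n\ge 0$ consider functions $F:\{0,1\}^n\to\mathbb{R}^{\ge 0}$ ($n$ is the arity of $F$). A nonnegative real $r$ is *polynomial-time computable* if there is a Turing machine which, given $n$ in unary, computes in time polynomial in $n$ a natural number $z_n$ (in binary) with $|z_n/2^n-r|\le 2^{-n}$. Let $\mathcal{B}$ be the set of all such functions $F$, of all arities, let $\mathcal{B}^p\subseteq\mathcal{B}$ be the set of those whose values are all polynomial-time computable, and let $\mathcal{B}_1$, $\mathcal{B}^p_1$ be the sets of unary (arity $1$) functions in $\mathcal{B}$, $\mathcal{B}^p$. Let $\mathrm{EQ},\mathrm{NEQ},\mathrm{IMP}$ be the binary $0,1$-valued functions with $\mathrm{EQ}(x,y)=1$ iff $x=y$, $\mathrm{NEQ}(x,y)=1$ iff $x\ne y$, and $\mathrm{IMP}(x,y)=0$ iff $(x,y)=(1,0)$. A function $F$ is *log-supermodular*, $F\in\mathsf{LSM}$, if $F(\boldsymbol x\vee\boldsymbol y)F(\boldsymbol x\wedge\boldsymbol y)\ge F(\boldsymbol x)F(\boldsymbol y)$ for all $\boldsymbol x,\boldsymbol y$. A *pps-formula* over a set $\mathcal{F}$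 of functions, with free variables $v_1,\dots,v_n$, is an expression $\psi=\sum_{v_{n+1},\dots,v_{n+m}}\prod_{j=1}^{s}\phi_j$ where each $\phi_j=G(v_{i_1},\dots,v_{i_a})$ is a function $G\in\mathcal{F}$ of arity $a$ applied to variables among $v_1,\dots,v_{n+m}$ (repetitions allowed); it specifies the function $F_\psi(\boldsymbol x)=\sum_{\boldsymbol y\in\{0,1\}^m}\prod_{j=1}^{s}F_{\phi_j}(\boldsymbol x,\boldsymbol y)$, where $F_{\phi_j}$ is the value of $G$ at the values of its arguments. Let $\mathcal U$ be the class of functions under consideration ($\mathcal{U}=\mathcal{B}^p$ in the efficient version, $\mathcal{U}=\mathcal{B}$ in the non-efficient one). * $\langle\mathcal{F}\rangle$ is the set of $F\in\mathcal{U}$ with $F=F_\psi$ for some pps-formula $\psi$ over $\mathcal{F}\cup\{\mathrm{EQ}\}$. * $\langle\mathcal{F}\rangle_\omega$ is the set of $F\in\mathcal{U}$ for which there is a finite $S\subseteq\mathcal{F}\cup\{\mathrm{EQ}\}$ such that for every $\epsilon>0$ there is a pps-formula $\psi$ over $S$ with $F_\psi$ of the same arity as $F$ and $\|F_\psi-F\|_\infty<\epsilon$.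 * $\langle\mathcal{F}\rangle_{\omega,p}$ is the set of $F\in\mathcal{U}$ for which there are a finite $S\subseteq\mathcal{F}\cup\{\mathrm{EQ}\}$ and a Turing machine which, given the accuracy $\epsilon=2^{-n}$ (as $n$ in unary), outputs in time polynomial in $n=\log_2\epsilon^{-1}$ a pps-formula $\psi$ over $S$ with $F_\psi$ of the same arity as $F$ and $\|F_\psi-F\|_\infty<\epsilon$. Here $\langle F,\mathcal{B}_1\rangle$ abbreviates $\langle\{F\}\cup\mathcal{B}_1\rangle$, and so on. **Theorem.** Let $F\in\mathcal{B}^p$ (with $\mathcal{U}=\mathcal{B}^p$). * If $F\notin\langle\mathrm{NEQ},\mathcal{B}^p_1\rangle$, then $\mathrm{IMP}\in\langle F,\mathcal{B}^p_1\rangle_{\omega,p}$, and hence $\langle\mathrm{IMP},\mathcal{B}^p_1\rangle_{\omega,p}\subseteq\langle F,\mathcal{B}^p_1\rangle_{\omega,p}$. * If, in addition, $F\notin\mathsf{LSM}$, then $\langle F,\mathcal{B}^p_1\rangle_{\omega,p}=\mathcal{B}^p$. The non-efficient version also holds. Let $F\in\mathcal{B}$ (with $\mathcal{U}=\mathcal{B}$).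 If $F\notin\langle\mathrm{NEQ},\mathcal{B}_1\rangle$, then $\mathrm{IMP}\in\langle F,\mathcal{B}_1\rangle_\omega$ and hence $\langle\mathrm{IMP},\mathcal{B}_1\rangle_\omega\subseteq\langle F,\mathcal{B}_1\rangle_\omega$; if, in addition, $F\notin\mathsf{LSM}$, then $\langle F,\mathcal{B}_1\rangle_\omega=\mathcal{B}$. -/

import Mathlib

open scoped NNReal

noncomputable section

namespace FunctionalClone

/-! ### Nonnegative functions on the Boolean domain -/

/-- A function `{0,1}^n → ℝ≥0` together with its arity `n`
(`false` stands for `0` and `true` for `1`). -/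
structure BFun : Type where
  arity : ℕ
  val : (Fin arity → Bool) → ℝ≥0

/-- The binary equality function. -/
def EQ : BFun := ⟨2, fun x => if x 0 = x 1 then 1 else 0⟩

/-- The binary disequality function. -/
def NEQ : BFun := ⟨2, fun x => if x 0 = x 1 then 0 else 1⟩

/-- The binary function "implies", which is `0` at `(1,0)` and `1` elsewhere. -/
def IMP : BFun := ⟨2, fun x => if x 0 = true ∧ x 1 = false then 0 else 1⟩

/-- The log-supermodular functions: `F(x ∨ y) F(x ∧ y) ≥ F(x) F(y)` for all `x`, `y`. -/
def LSM : Set BFun :=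
  {F | ∀ x y : Fin F.arity → Bool, F.val x * F.val y ≤ F.val (x ⊔ y) * F.val (x ⊓ y)}

/-! ### Polynomial-time computable reals -/

/-- A nonnegative real `r` is polynomial-time computable if a Turing machine, given `n` (in unary),
outputs within time polynomial in `n` a natural number `φ n` (in binary) for which the dyadic
rational `φ n / 2 ^ n` is within `2 ^ (-n)` of `r`. -/
def PolyTimeReal (r : ℝ≥0) : Prop :=
  ∃ φ : ℕ → ℕ,
    Nonempty (Turing.TM2ComputableInPolyTime
      Computability.unaryEncodeNat Computability.encodeNat φ) ∧
    ∀ n : ℕ, |(φ n : ℝ) / 2 ^ n - (r : ℝ)| ≤ 1 / 2 ^ n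

/-- All functions, of all arities, with values in the nonnegative reals. -/
def allFuns : Set BFun := Set.univ

/-- All functions, of all arities, with values in the polynomial-time computable nonnegative
reals. -/
def polyFuns : Set BFun := {F | ∀ x, PolyTimeReal (F.val x)}

/-- The unary functions in a class `U` of functions. -/
def unary (U : Set BFun) : Set BFun := {F | F ∈ U ∧ F.arity = 1}

/-! ### pps-formulas -/

/-- An atomic formula `G(v_1, …, v_a)` over the set `A` of functions, with variables from `V`:
a function `G ∈ A` and a scope, in which variables may be repeated. -/
structure Atom (A : Set BFun) (V : Type) : Type where
  fn : A
  scope : Fin fn.1.arity → V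

/-- The function of assignments that an atomic formula represents. -/
def Atom.eval {A : Set BFun} {V : Type} (φ : Atom A V) (z : V → Bool) : ℝ≥0 :=
  φ.fn.1.val (fun i => z (φ.scope i))

/-- A pps-formula over `A` with `n` free variables: a summation over `bound` many bound variables
of a product of atomic formulas in the free and the bound variables. -/
structure PPSFormula (A : Set BFun) (n : ℕ) : Type where
  bound : ℕ
  atoms : List (Atom A (Fin n ⊕ Fin bound))

/-- The function that a pps-formula specifies. -/
def PPSFormula.eval {A : Set BFun} {n : ℕ} (ψ : PPSFormula A n) (x : Fin n → Bool) : ℝ≥0 :=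
  ∑ y : Fin ψ.bound → Bool, (ψ.atoms.map fun φ => φ.eval (Sum.elim x y)).prod

/-! ### pps-formulas as words -/

/-- The alphabet in which pps-formulas over `A` are written. -/
inductive Sym (A : Set BFun) : Type
  /-- introduces a bound variable -/
  | sum : Sym A
  /-- a function symbol -/
  | fn (G : A) : Sym A
  /-- starts the name of a free variable -/
  | free : Sym A
  /-- starts the name of a bound variable -/
  | bound : Sym A
  /-- one unit of the index of a variable -/
  | tick : Sym A

/-- The word for a variable: its kind, followed by its index in unary. -/
def encodeVar {A : Set BFun} {n m : ℕ} : Fin n ⊕ Fin m → List (Sym A)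
  | Sum.inl i => Sym.free :: List.replicate i Sym.tick
  | Sum.inr j => Sym.bound :: List.replicate j Sym.tick

/-- The word for an atomic formula: the function symbol, followed by the scope. -/
def encodeAtom {A : Set BFun} {n m : ℕ} (φ : Atom A (Fin n ⊕ Fin m)) : List (Sym A) :=
  Sym.fn φ.fn :: (List.ofFn φ.scope).flatMap encodeVar

/-- The word for a pps-formula: one summation sign for each bound variable, followed by the atomic
formulas. -/
def encodeFormula {A : Set BFun} {n : ℕ} (ψ : PPSFormula A n) : List (Sym A) :=
  List.replicate ψ.bound Sym.sum ++ ψ.atoms.flatMap encodeAtom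

/-! ### Definability and functional clones -/

/-- `F` is represented by some pps-formula over `A`. -/
def PPSDefinable (A : Set BFun) (F : BFun) : Prop :=
  ∃ ψ : PPSFormula A F.arity, ∀ x, ψ.eval x = F.val x

/-- `F` is the limit, in the maximum norm, of functions that are pps-definable over one fixed finite
subset of `A`. -/
def PPSLimDefinable (A : Set BFun) (F : BFun) : Prop :=
  ∃ S : Finset BFun, (S : Set BFun) ⊆ A ∧
    ∀ ε : ℝ, 0 < ε → ∃ ψ : PPSFormula (S : Set BFun) F.arity,
      ∀ x, |(ψ.eval x : ℝ) - (F.val x : ℝ)| < ε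

/-- The efficient version: for one fixed finite subset `S` of `A`, a Turing machine that is given
the accuracy `ε = 2 ^ (-n)` (as `n` in unary) computes, within time polynomial in `n`, a pps-formula
over `S` whose function is closer than `ε` to `F` in the maximum norm. -/
def PPSLimEffDefinable (A : Set BFun) (F : BFun) : Prop :=
  ∃ S : Finset BFun, (S : Set BFun) ⊆ A ∧
    ∃ ψ : ℕ → PPSFormula (S : Set BFun) F.arity,
      Nonempty (Turing.TM2ComputableInPolyTime Computability.unaryEncodeNat encodeFormula ψ) ∧
      ∀ n x, |((ψ n).eval x : ℝ) - (F.val x : ℝ)| < 1 / 2 ^ n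

/-- The functional clone generated by `A`, within the universal class `U` of functions. -/
def clone (U A : Set BFun) : Set BFun := {F | F ∈ U ∧ PPSDefinable (A ∪ {EQ}) F}

/-- The pps_ω-definable functional clone generated by `A`, within `U`. -/
def cloneLim (U A : Set BFun) : Set BFun := {F | F ∈ U ∧ PPSLimDefinable (A ∪ {EQ}) F}

/-- The efficient pps_ω-definable functional clone generated by `A`, within `U`. -/
def cloneLimEff (U A : Set BFun) : Set BFun := {F | F ∈ U ∧ PPSLimEffDefinable (A ∪ {EQ}) F}

end FunctionalClone

end

open FunctionalClone

/-!
# A dichotomy for functional clones with all unary functions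

Let `V` be the set of admissible values, either all nonnegative reals or the polynomial-time
computable ones. The argument uses only that `V` contains `0` and `1` and is closed under addition
and inversion (`IsValueClass`), so both versions of the theorem are treated at once. For the
polynomial-time computable reals these closure properties are proved with explicit stack programs
for addition and long division (`PolyTimeReal.add`, `PolyTimeReal.inv`).

Clones with limits. All limits that occur are limits of formulas in which a fixed part is repeated
`k` times, that is, of functions `∑ y, g₀ (x, y) * g₁ (x, y) ^ k` (`Reg`). Such families are closed
under products and summation over variables, and if one converges exponentially fast, then
replacing `k` by a multiple of `k` makes it converge at any prescribed exponential rate; the limit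
is then called approximable (`Approx`, `approx_of_expLim`). An approximable function can be
substituted for a function symbol: an error in its values disturbs the value of a formula at most by
a factor exponential in the length of the formula, which a repetition number linear in the length
compensates (`exists_substitution`). On words, the substitution replaces each atomic formula by a
fixed template and shifts the indices of the bound variables, and a stack machine does this in
polynomial time (`computable_subst`). Hence the inclusion of clones follows once `IMP` is known to
be approximable over `F` and the unary functions, and equality with the set of all functions once
every function is.

The implication. Consider the binary functions that arise from `F` by multiplying with unary
functions and summing over all variables but two. If each of them is of rank one or a weighted
equality or disequality, then `F` is a product of unary functions, equalities and disequalities, by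
induction on the arity: either the restrictions of `F` to the two values of the first variable are
proportional and this variable splits off, or they are not, and then some binary function as above
has nonzero determinant (`exists_half_ne`), so it is a weighted equality or disequality, which links
the first variable to another one and makes it redundant (`pps_of_not_hasNonSimple`). Otherwise one
of them, `G`, has nonzero determinant and at least three positive values. Unary weights turn the
three values into `1`; the fourth can be chosen such that it becomes less than `1`, and its powers
tend to `0`. So the function `forb s t` with its single zero at `(s, t)` is approximable
(`IsBase.gate`). For `s ≠ t` this is the implication up to the order of the arguments; for `s = t`
an implication is obtained with one auxiliary variable (`IsBase.gate_not`).

All functions. If `F x * F y > F (x ⊔ y) * F (x ⊓ y)`, then pinning the variables where `x` and `y`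
agree, and identifying the others according to `x`, gives a binary function that is not
log-supermodular. It yields `forb c c` for some `c`, directly or, if it is a weighted disequality,
from the implication (`IsBase.gate_of_not_lsm`). Now the functions `forb c t` are available for both
`t`, and for each point `a` a variable `z` can be added that may take the value `c` only if `x = a`,
where it then contributes the factor `G a`, after normalization; the product over all `a`
approximates an arbitrary `G` (`IsBase.approx_of_gates`).
-/

open scoped NNReal

noncomputable section

namespace FunctionalClone

open Turing Computability

/-! ### Fragments of stack machines -/

/-- A stack program over the stacks `Γ` that can be used as a subroutine: the control part of a
`Turing.FinTM2`, without a choice of input and output stacks. -/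
structure Frag {K : Type} (Γ : K → Type) where
  Λ : Type
  σ : Type
  [finΛ : Fintype Λ]
  [finσ : Fintype σ]
  main : Λ
  init : σ
  m : Λ → TM2.Stmt Γ Λ σ

attribute [instance] Frag.finΛ Frag.finσ

section Steps

variable {K : Type} {Γ : K → Type} [DecidableEq K]

/-- `Steps m n c c'`: the program `m` goes from the configuration `c` to `c'` in exactly `n`
steps. -/
def Steps {Λ σ : Type} (m : Λ → TM2.Stmt Γ Λ σ) : ℕ → TM2.Cfg Γ Λ σ → TM2.Cfg Γ Λ σ → Prop
  | 0, c, c' => c = c'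
  | n + 1, c, c' => ∃ d, TM2.step m c = some d ∧ Steps m n d c'

theorem Steps.trans {Λ σ : Type} {m : Λ → TM2.Stmt Γ Λ σ} {a b : ℕ} {c d e : TM2.Cfg Γ Λ σ}
    (h₁ : Steps m a c d) (h₂ : Steps m b d e) : Steps m (a + b) c e := by
  induction a generalizing c with
  | zero => cases h₁; simpa using h₂
  | succ a ih =>
    obtain ⟨x, hx, h⟩ := h₁
    rw [Nat.add_right_comm]
    exact ⟨x, hx, ih h⟩

theorem steps_iff_iterate {Λ σ : Type} {m : Λ → TM2.Stmt Γ Λ σ} {n : ℕ} {c d : TM2.Cfg Γ Λ σ} :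
    Steps m n c d ↔ (flip bind (TM2.step m))^[n] (some c) = some d := by
  induction n generalizing c with
  | zero => simp [Steps]
  | succ n ih =>
    have hnone : ∀ n, (flip bind (TM2.step m))^[n] none = none := by
      intro n
      induction n with
      | zero => rfl
      | succ n ih => rw [Function.iterate_succ_apply]; exact ih
    rw [Function.iterate_succ_apply]
    change _ ↔ (flip bind (TM2.step m))^[n] (TM2.step m c) = some d
    cases h : TM2.step m c with
    | none => rw [hnone]; simp [Steps, h]
    | some e => simp [Steps, h, ih]

/-- `F.Runs S S' t`: started with the stacks `S`, the program `F` halts within `t` steps, with the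
stacks `S'` and its internal state reset. -/
def Frag.Runs (F : Frag Γ) (S S' : ∀ k, List (Γ k)) (t : ℕ) : Prop :=
  ∃ n ≤ t, Steps F.m n ⟨some F.main, F.init, S⟩ ⟨none, F.init, S'⟩

theorem Frag.Runs.mono {F : Frag Γ} {S S' : ∀ k, List (Γ k)} {t t' : ℕ} (h : F.Runs S S' t)
    (ht : t ≤ t') : F.Runs S S' t' :=
  let ⟨n, hn, h⟩ := h
  ⟨n, hn.trans ht, h⟩

theorem Frag.Runs.congr {F : Frag Γ} {S S' S'' : ∀ k, List (Γ k)} {t t' : ℕ} (h : F.Runs S S' t)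
    (hS : S' = S'') (ht : t ≤ t') : F.Runs S S'' t' :=
  hS ▸ h.mono ht

/-- Embeds a statement into a larger program: `f` embeds the labels, `ι` the states (with
retraction `r`), and `ex` replaces `halt`. -/
def relabel {Λ Λ' σ σ' : Type} (f : Λ → Λ') (ι : σ → σ') (r : σ' → σ) (ex : TM2.Stmt Γ Λ' σ') :
    TM2.Stmt Γ Λ σ → TM2.Stmt Γ Λ' σ'
  | .push k g q => .push k (fun v => g (r v)) (relabel f ι r ex q)
  | .peek k g q => .peek k (fun v o => ι (g (r v) o)) (relabel f ι r ex q)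
  | .pop k g q => .pop k (fun v o => ι (g (r v) o)) (relabel f ι r ex q)
  | .load g q => .load (fun v => ι (g (r v))) (relabel f ι r ex q)
  | .branch p q₁ q₂ => .branch (fun v => p (r v)) (relabel f ι r ex q₁) (relabel f ι r ex q₂)
  | .goto l => .goto (fun v => f (l (r v)))
  | .halt => ex

theorem stepAux_relabel {Λ Λ' σ σ' : Type} {f : Λ → Λ'} {ι : σ → σ'} {r : σ' → σ}
    (ex : TM2.Stmt Γ Λ' σ') (hr : ∀ v, r (ι v) = v) (q : TM2.Stmt Γ Λ σ) (v : σ)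
    (S : ∀ k, List (Γ k)) :
    TM2.stepAux (relabel f ι r ex q) (ι v) S =
      match TM2.stepAux q v S with
      | ⟨some l, v', S'⟩ => ⟨some (f l), ι v', S'⟩
      | ⟨none, v', S'⟩ => TM2.stepAux ex (ι v') S' := by
  induction q generalizing v S with
  | push k g q ih => simp only [relabel, TM2.stepAux, hr, ih]
  | peek k g q ih => simp only [relabel, TM2.stepAux, hr, ih]
  | pop k g q ih => simp only [relabel, TM2.stepAux, hr, ih]
  | load g q ih => simp only [relabel, TM2.stepAux, hr, ih]
  | branch p q₁ q₂ ih₁ ih₂ =>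
    simp only [relabel, TM2.stepAux, hr]
    cases p v <;> simp [ih₁, ih₂]
  | goto l => simp only [relabel, TM2.stepAux, hr]
  | halt => simp only [relabel, TM2.stepAux]

/-- A terminating run of a subroutine is a run of the program that contains it, up to the exit
statement, which is part of the last step. -/
theorem Steps.relabel {Λ Λ' σ σ' : Type} {f : Λ → Λ'} {ι : σ → σ'} {r : σ' → σ}
    {ex : TM2.Stmt Γ Λ' σ'} (hr : ∀ v, r (ι v) = v) {m : Λ → TM2.Stmt Γ Λ σ}
    {m' : Λ' → TM2.Stmt Γ Λ' σ'} (hm : ∀ l, m' (f l) = relabel f ι r ex (m l)) {n : ℕ} {l : Λ}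
    {v v' : σ} {S S' : ∀ k, List (Γ k)} (h : Steps m n ⟨some l, v, S⟩ ⟨none, v', S'⟩) :
    Steps m' n ⟨some (f l), ι v, S⟩ (TM2.stepAux ex (ι v') S') := by
  induction n generalizing l v S with
  | zero => simp [Steps] at h
  | succ n ih =>
    obtain ⟨d, hd, h⟩ := h
    refine ⟨_, rfl, ?_⟩
    simp only [TM2.step, Option.some.injEq] at hd
    rw [hm, stepAux_relabel ex hr, hd]
    obtain ⟨_ | l, w, T⟩ := d
    · cases n with
      | zero =>
        simp only [Steps, TM2.Cfg.mk.injEq, true_and] at h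
        obtain ⟨rfl, rfl⟩ := h
        rfl
      | succ n =>
        obtain ⟨d, hd, -⟩ := h
        simp [TM2.step] at hd
    · exact ih h

/-! ### Program constructs -/

/-- The program that does nothing. -/
def skip : Frag Γ := ⟨Unit, Unit, (), (), fun _ => .halt⟩

theorem skip_runs (S : ∀ k, List (Γ k)) : (skip : Frag Γ).Runs S S 1 :=
  ⟨1, le_rfl, _, rfl, rfl⟩

/-- The program that pushes `a` onto stack `k`. -/
def pushF (k : K) (a : Γ k) : Frag Γ := ⟨Unit, Unit, (), (), fun _ => .push k (fun _ => a) .halt⟩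

theorem pushF_runs (k : K) (a : Γ k) (S : ∀ k, List (Γ k)) :
    (pushF k a).Runs S (Function.update S k (a :: S k)) 1 :=
  ⟨1, le_rfl, _, rfl, rfl⟩

/-- Sequential composition. -/
def Frag.seq (F G : Frag Γ) : Frag Γ where
  Λ := F.Λ ⊕ G.Λ
  σ := F.σ ⊕ G.σ
  main := .inl F.main
  init := .inl F.init
  m
    | .inl l => relabel .inl .inl (Sum.elim id fun _ => F.init)
        (.load (fun _ => .inr G.init) (.goto fun _ => .inr G.main)) (F.m l)
    | .inr l => relabel .inr .inr (Sum.elim (fun _ => G.init) id)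
        (.load (fun _ => .inl F.init) .halt) (G.m l)

theorem Frag.Runs.seq {F G : Frag Γ} {S S' S'' : ∀ k, List (Γ k)} {t t' : ℕ} (h : F.Runs S S' t)
    (h' : G.Runs S' S'' t') : (F.seq G).Runs S S'' (t + t') := by
  obtain ⟨n, hn, h⟩ := h
  obtain ⟨n', hn', h'⟩ := h'
  refine ⟨n + n', by omega, ?_⟩
  exact (h.relabel (f := .inl) (m' := (F.seq G).m) (fun _ => rfl) fun _ => rfl).trans
    (h'.relabel (f := .inr) (m' := (F.seq G).m) (fun _ => rfl) fun _ => rfl)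

open Classical in
/-- `loop k f` pops stack `k` until it is empty, and runs `f a` for each symbol `a` it pops. -/
def loop (k : K) [Fintype (Γ k)] (f : Γ k → Frag Γ) : Frag Γ where
  Λ := Option (Σ a, (f a).Λ)
  σ := Option (Γ k) ⊕ Σ a, (f a).σ
  main := none
  init := .inl none
  m
    | none => .pop k (fun _ o => .inl o) <|
        .branch (fun v => decide (v = .inl none)) .halt <|
          .load
            (fun v => match v with
              | .inl (some a) => .inr ⟨a, (f a).init⟩
              | w => w)
            (.goto fun v => match v with
              | .inr ⟨a, _⟩ => some ⟨a, (f a).main⟩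
              | .inl _ => none)
    | some ⟨a, l⟩ => relabel (fun l => some ⟨a, l⟩) (fun v => .inr ⟨a, v⟩)
        (fun w => match w with
          | .inr ⟨b, v⟩ => if h : b = a then h ▸ v else (f a).init
          | .inl _ => (f a).init)
        (.load (fun _ => .inl none) (.goto fun _ => none)) ((f a).m l)

theorem loop_runs_nil (k : K) [Fintype (Γ k)] (f : Γ k → Frag Γ) {S : ∀ k, List (Γ k)}
    (h : S k = []) : (loop k f).Runs S S 1 := by
  refine ⟨1, le_rfl, _, rfl, ?_⟩
  have : Function.update S k [] = S := by rw [← h, Function.update_eq_self]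
  simp [Steps, loop, h, this]

theorem loop_runs_cons (k : K) [Fintype (Γ k)] (f : Γ k → Frag Γ) {S S₁ S₂ : ∀ k, List (Γ k)}
    {a : Γ k} {l : List (Γ k)} {t t' : ℕ} (h : S k = a :: l)
    (h₁ : (f a).Runs (Function.update S k l) S₁ t) (h₂ : (loop k f).Runs S₁ S₂ t') :
    (loop k f).Runs S S₂ (1 + t + t') := by
  obtain ⟨n, hn, h₁⟩ := h₁
  obtain ⟨n', hn', h₂⟩ := h₂
  refine ⟨1 + n + n', by omega, ?_⟩
  refine Steps.trans (Steps.trans (d := ⟨some (some ⟨a, (f a).main⟩), .inr ⟨a, (f a).init⟩,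
    Function.update S k l⟩) ⟨_, rfl, ?_⟩ (h₁.relabel (f := fun l => some ⟨a, l⟩)
      (ι := fun v => .inr ⟨a, v⟩) (m' := (loop k f).m) ?_ fun _ => rfl)) h₂
  · simp [Steps, loop, h]
  · intro v
    simp

/-- A loop whose body transforms the stacks uniformly: `P l S` holds when `l` remains to be
popped. -/
theorem loop_runs (k : K) [Fintype (Γ k)] (f : Γ k → Frag Γ) (T : ℕ)
    (g : List (Γ k) → (∀ k, List (Γ k))) (hg : ∀ l, g l k = l)
    (hf : ∀ a l, (f a).Runs (Function.update (g (a :: l)) k l) (g l) T) (l : List (Γ k)) :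
    (loop k f).Runs (g l) (g []) (l.length * (T + 1) + 1) := by
  induction l with
  | nil => exact (loop_runs_nil k f (hg [])).mono (by simp)
  | cons a l ih =>
    refine (loop_runs_cons k f (hg _) (hf a l) ih).mono ?_
    simp only [List.length_cons]
    ring_nf
    omega

end Steps

/-! ### Programs side by side -/

section Sum

variable {K₁ K₂ : Type} {Γ₁ : K₁ → Type} {Γ₂ : K₂ → Type}

/-- The stacks of two programs side by side. -/
def joinS (S : ∀ k, List (Γ₁ k)) (R : ∀ k, List (Γ₂ k)) : ∀ k, List (Sum.elim Γ₁ Γ₂ k)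
  | .inl k => S k
  | .inr k => R k

/-- A statement about the first group of stacks. -/
def stmtInl {Λ σ : Type} : TM2.Stmt Γ₁ Λ σ → TM2.Stmt (Sum.elim Γ₁ Γ₂) Λ σ
  | .push k g q => .push (.inl k) g (stmtInl q)
  | .peek k g q => .peek (.inl k) g (stmtInl q)
  | .pop k g q => .pop (.inl k) g (stmtInl q)
  | .load g q => .load g (stmtInl q)
  | .branch p q₁ q₂ => .branch p (stmtInl q₁) (stmtInl q₂)
  | .goto l => .goto l
  | .halt => .halt

/-- A statement about the second group of stacks. -/
def stmtInr {Λ σ : Type} : TM2.Stmt Γ₂ Λ σ → TM2.Stmt (Sum.elim Γ₁ Γ₂) Λ σ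
  | .push k g q => .push (.inr k) g (stmtInr q)
  | .peek k g q => .peek (.inr k) g (stmtInr q)
  | .pop k g q => .pop (.inr k) g (stmtInr q)
  | .load g q => .load g (stmtInr q)
  | .branch p q₁ q₂ => .branch p (stmtInr q₁) (stmtInr q₂)
  | .goto l => .goto l
  | .halt => .halt

/-- A program on the first group of stacks. -/
def Frag.inl (F : Frag Γ₁) : Frag (Sum.elim Γ₁ Γ₂) :=
  ⟨F.Λ, F.σ, F.main, F.init, fun l => stmtInl (F.m l)⟩

/-- A program on the second group of stacks. -/
def Frag.inr (F : Frag Γ₂) : Frag (Sum.elim Γ₁ Γ₂) :=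
  ⟨F.Λ, F.σ, F.main, F.init, fun l => stmtInr (F.m l)⟩

variable [DecidableEq K₁] [DecidableEq K₂]

theorem update_joinS_inl (S : ∀ k, List (Γ₁ k)) (R : ∀ k, List (Γ₂ k)) (k : K₁)
    (x : List (Γ₁ k)) :
    Function.update (joinS S R) (.inl k) x = joinS (Function.update S k x) R := by
  funext j
  rcases j with j | j
  · by_cases h : j = k
    · subst h
      exact (Function.update_self _ _ _).trans (Function.update_self j x S).symm
    · exact (Function.update_of_ne (by simpa using h) _ _).trans
        (Function.update_of_ne h _ _).symm
  · exact Function.update_of_ne (by simp) _ _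

theorem update_joinS_inr (S : ∀ k, List (Γ₁ k)) (R : ∀ k, List (Γ₂ k)) (k : K₂)
    (x : List (Γ₂ k)) :
    Function.update (joinS S R) (.inr k) x = joinS S (Function.update R k x) := by
  funext j
  rcases j with j | j
  · exact Function.update_of_ne (by simp) _ _
  · by_cases h : j = k
    · subst h
      exact (Function.update_self _ _ _).trans (Function.update_self j x R).symm
    · exact (Function.update_of_ne (by simpa using h) _ _).trans
        (Function.update_of_ne h _ _).symm

theorem stepAux_stmtInl {Λ σ : Type} (q : TM2.Stmt Γ₁ Λ σ) (v : σ) (S : ∀ k, List (Γ₁ k))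
    (R : ∀ k, List (Γ₂ k)) :
    TM2.stepAux (stmtInl q) v (joinS S R) =
      ⟨(TM2.stepAux q v S).l, (TM2.stepAux q v S).var, joinS (TM2.stepAux q v S).stk R⟩ := by
  induction q generalizing v S with
  | push k g q ih =>
    simp only [stmtInl, TM2.stepAux]; rw [← ih, ← update_joinS_inl]; rfl
  | peek k g q ih => simp only [stmtInl, TM2.stepAux]; rw [← ih]; rfl
  | pop k g q ih =>
    simp only [stmtInl, TM2.stepAux]; rw [← ih, ← update_joinS_inl]; rfl
  | load g q ih => simp only [stmtInl, TM2.stepAux]; rw [← ih]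
  | branch p q₁ q₂ ih₁ ih₂ =>
    simp only [stmtInl, TM2.stepAux]
    cases p v <;> simp [ih₁, ih₂]
  | goto l => rfl
  | halt => rfl

theorem stepAux_stmtInr {Λ σ : Type} (q : TM2.Stmt Γ₂ Λ σ) (v : σ) (S : ∀ k, List (Γ₁ k))
    (R : ∀ k, List (Γ₂ k)) :
    TM2.stepAux (stmtInr q) v (joinS S R) =
      ⟨(TM2.stepAux q v R).l, (TM2.stepAux q v R).var, joinS S (TM2.stepAux q v R).stk⟩ := by
  induction q generalizing v R with
  | push k g q ih =>
    simp only [stmtInr, TM2.stepAux]; rw [← ih, ← update_joinS_inr]; rfl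
  | peek k g q ih => simp only [stmtInr, TM2.stepAux]; rw [← ih]; rfl
  | pop k g q ih =>
    simp only [stmtInr, TM2.stepAux]; rw [← ih, ← update_joinS_inr]; rfl
  | load g q ih => simp only [stmtInr, TM2.stepAux]; rw [← ih]
  | branch p q₁ q₂ ih₁ ih₂ =>
    simp only [stmtInr, TM2.stepAux]
    cases p v <;> simp [ih₁, ih₂]
  | goto l => rfl
  | halt => rfl

theorem Frag.Runs.inl {F : Frag Γ₁} {S S' : ∀ k, List (Γ₁ k)} {t : ℕ} (h : F.Runs S S' t)
    (R : ∀ k, List (Γ₂ k)) : (F.inl (Γ₂ := Γ₂)).Runs (joinS S R) (joinS S' R) t := by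
  obtain ⟨n, hn, h⟩ := h
  refine ⟨n, hn, ?_⟩
  have key : ∀ n (l : Option F.Λ) v S v' S', Steps F.m n ⟨l, v, S⟩ ⟨none, v', S'⟩ →
      Steps (F.inl (Γ₂ := Γ₂)).m n ⟨l, v, joinS S R⟩ ⟨none, v', joinS S' R⟩ := by
    intro n
    induction n with
    | zero => rintro l v S v' S' h; cases h; rfl
    | succ n ih =>
      rintro (_ | l) v S v' S' ⟨d, hd, h⟩
      · simp [TM2.step] at hd
      · simp only [TM2.step, Option.some.injEq] at hd
        subst hd
        refine ⟨_, rfl, ?_⟩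
        simp only [Frag.inl, stepAux_stmtInl]
        exact ih _ _ _ _ _ h
  exact key _ _ _ _ _ _ h

theorem Frag.Runs.inr {F : Frag Γ₂} {R R' : ∀ k, List (Γ₂ k)} {t : ℕ} (h : F.Runs R R' t)
    (S : ∀ k, List (Γ₁ k)) : (F.inr (Γ₁ := Γ₁)).Runs (joinS S R) (joinS S R') t := by
  obtain ⟨n, hn, h⟩ := h
  refine ⟨n, hn, ?_⟩
  have key : ∀ n (l : Option F.Λ) v R v' R', Steps F.m n ⟨l, v, R⟩ ⟨none, v', R'⟩ →
      Steps (F.inr (Γ₁ := Γ₁)).m n ⟨l, v, joinS S R⟩ ⟨none, v', joinS S R'⟩ := by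
    intro n
    induction n with
    | zero => rintro l v S v' S' h; cases h; rfl
    | succ n ih =>
      rintro (_ | l) v S v' S' ⟨d, hd, h⟩
      · simp [TM2.step] at hd
      · simp only [TM2.step, Option.some.injEq] at hd
        subst hd
        refine ⟨_, rfl, ?_⟩
        simp only [Frag.inr, stepAux_stmtInr]
        exact ih _ _ _ _ _ h
  exact key _ _ _ _ _ _ h

end Sum

/-! ### Polynomial-time computability by programs -/

/-- The stacks that are empty except for stack `k`. -/
def single {K : Type} {Γ : K → Type} [DecidableEq K] (k : K) (w : List (Γ k)) :
    ∀ k, List (Γ k) :=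
  Function.update (fun _ => []) k w

/-- The program of a machine. -/
def fragOf (tm : FinTM2) : Frag tm.Γ :=
  letI := tm.ΛFin
  letI := tm.σFin
  ⟨tm.Λ, tm.σ, tm.main, tm.initialState, tm.m⟩

/-- The machine with program `F`, input stack `k₀` and output stack `k₁`. -/
def Frag.toTM {K : Type} [DecidableEq K] [Fintype K] {Γ : K → Type} (F : Frag Γ) (k₀ k₁ : K)
    [Fintype (Γ k₀)] : FinTM2 :=
  { k₀ := k₀, k₁ := k₁, Γ := Γ, Λ := F.Λ, main := F.main, σ := F.σ, initialState := F.init,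
    m := F.m }

theorem initList_eq (tm : FinTM2) (s : List (tm.Γ tm.k₀)) :
    initList tm s = ⟨some tm.main, tm.initialState, single tm.k₀ s⟩ := by
  unfold initList single
  congr 1
  funext k
  by_cases h : k = tm.k₀
  · subst h; simp
  · simp [h]

theorem haltList_eq (tm : FinTM2) (s : List (tm.Γ tm.k₁)) :
    haltList tm s = ⟨none, tm.initialState, single tm.k₁ s⟩ := by
  unfold haltList single
  congr 1
  funext k
  by_cases h : k = tm.k₁
  · subst h; simp
  · simp [h]

theorem computable_of_runs {K : Type} [DecidableEq K] [Fintype K] {Γ : K → Type} (F : Frag Γ)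
    (k₀ k₁ : K) [Fintype (Γ k₀)] {α β Γ₀ Γ₁' : Type} (e₀ : Γ k₀ ≃ Γ₀) (e₁ : Γ k₁ ≃ Γ₁')
    {ea : α → List Γ₀} {eb : β → List Γ₁'} {f : α → β} (p : Polynomial ℕ)
    (h : ∀ a, F.Runs (single k₀ ((ea a).map e₀.symm)) (single k₁ ((eb (f a)).map e₁.symm))
      (p.eval (ea a).length)) :
    Nonempty (TM2ComputableInPolyTime ea eb f) := by
  refine ⟨{ tm := F.toTM k₀ k₁, inputAlphabet := e₀, outputAlphabet := e₁, time := p,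
            outputsFun := fun a => ?_ }⟩
  have hn := (h a).choose_spec
  refine { steps := (h a).choose, evals_in_steps := ?_, steps_le_m := hn.1 }
  have := steps_iff_iterate.1 hn.2
  rw [initList_eq, Option.map_some, haltList_eq]
  exact this

theorem runs_of_computable {α β Γ₀ Γ₁' : Type} {ea : α → List Γ₀} {eb : β → List Γ₁'} {f : α → β}
    (c : TM2ComputableInPolyTime ea eb f) (a : α) :
    (fragOf c.tm).Runs (single c.tm.k₀ ((ea a).map c.inputAlphabet.symm))
      (single c.tm.k₁ ((eb (f a)).map c.outputAlphabet.symm)) (c.time.eval (ea a).length) := by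
  obtain ⟨⟨n, h⟩, hn⟩ := c.outputsFun a
  refine ⟨n, hn, steps_iff_iterate.2 ?_⟩
  rw [initList_eq, Option.map_some, haltList_eq] at h
  exact h

/-- The number of symbols that a statement pushes is at most this. -/
def pushes {K : Type} {Γ : K → Type} {Λ σ : Type} : TM2.Stmt Γ Λ σ → ℕ
  | .push _ _ q => pushes q + 1
  | .peek _ _ q => pushes q
  | .pop _ _ q => pushes q
  | .load _ q => pushes q
  | .branch _ q₁ q₂ => pushes q₁ + pushes q₂
  | .goto _ => 0
  | .halt => 0

theorem stepAux_length_le {K : Type} [DecidableEq K] {Γ : K → Type} {Λ σ : Type}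
    (q : TM2.Stmt Γ Λ σ) (v : σ) (S : ∀ k, List (Γ k)) (k : K) :
    ((TM2.stepAux q v S).stk k).length ≤ (S k).length + pushes q := by
  induction q generalizing v S with
  | push j g q ih =>
    simp only [TM2.stepAux, pushes]
    refine (ih _ _).trans ?_
    by_cases h : k = j
    · subst h; simp; omega
    · simp [h]
  | peek j g q ih => simpa only [TM2.stepAux, pushes] using ih _ _
  | pop j g q ih =>
    simp only [TM2.stepAux, pushes]
    refine (ih _ _).trans ?_
    by_cases h : k = j
    · subst h; simp
    · simp [h]
  | load g q ih => simpa only [TM2.stepAux, pushes] using ih _ _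
  | branch p q₁ q₂ ih₁ ih₂ =>
    simp only [TM2.stepAux, pushes]
    have h1 := ih₁ v S
    have h2 := ih₂ v S
    cases p v <;> simp <;> omega
  | goto l => simp [TM2.stepAux]
  | halt => simp [TM2.stepAux]

/-- A program writes at most a constant number of symbols per step. -/
theorem Frag.exists_length_le {K : Type} [DecidableEq K] {Γ : K → Type} (F : Frag Γ) :
    ∃ C : ℕ, ∀ S S' t, F.Runs S S' t → ∀ k, (S' k).length ≤ (S k).length + C * t := by
  refine ⟨∑ l, pushes (F.m l), ?_⟩
  rintro S S' t ⟨n, hn, h⟩ k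
  have key : ∀ n l v (S : ∀ k, List (Γ k)) c', Steps F.m n ⟨l, v, S⟩ c' →
      (c'.stk k).length ≤ (S k).length + (∑ l, pushes (F.m l)) * n := by
    intro n
    induction n with
    | zero => rintro l v S c' h; cases h; simp
    | succ n ih =>
      rintro (_ | l) v S c' ⟨d, hd, h⟩
      · simp [TM2.step] at hd
      · simp only [TM2.step, Option.some.injEq] at hd
        subst hd
        have h1 := ih _ _ _ _ h
        have h2 := stepAux_length_le (F.m l) v S k
        have h3 : pushes (F.m l) ≤ ∑ l, pushes (F.m l) :=
          Finset.single_le_sum (f := fun l => pushes (F.m l)) (fun _ _ => Nat.zero_le _)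
            (Finset.mem_univ l)
        rw [Nat.mul_succ]
        omega
  exact (key _ _ _ _ _ h).trans (by gcongr)

/-! ### Subroutine calls -/

section Move

variable {K : Type} {Γ : K → Type} [DecidableEq K]

/-- Moves stack `k` onto stack `k'`, reversing it and translating its symbols by `g`. -/
def moveF (k k' : K) [Fintype (Γ k)] (g : Γ k → Γ k') : Frag Γ := loop k fun a => pushF k' (g a)

theorem moveF_runs {k k' : K} [Fintype (Γ k)] (g : Γ k → Γ k') (hk : k ≠ k')
    (S : ∀ k, List (Γ k)) :
    (moveF k k' g).Runs S
      (Function.update (Function.update S k []) k' (((S k).map g).reverse ++ S k'))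
      ((S k).length * 2 + 1) := by
  suffices H : ∀ l (S : ∀ k, List (Γ k)), S k = l → (moveF k k' g).Runs S
      (Function.update (Function.update S k []) k' ((l.map g).reverse ++ S k'))
      (l.length * 2 + 1) from H _ S rfl
  intro l
  induction l with
  | nil =>
    intro S hS
    have h2 : Function.update (Function.update S k []) k' ((([] : List (Γ k)).map g).reverse ++ S k')
        = S := by
      funext j
      by_cases h : j = k'
      · subst h; simp
      · by_cases h' : j = k
        · subst h'; simp [h, hS]
        · simp [h, h']
    rw [h2]
    exact loop_runs_nil k (fun a => pushF k' (g a)) hS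
  | cons a l ih =>
    intro S hS
    have h1 := loop_runs_cons k (fun a => pushF k' (g a)) hS (pushF_runs _ _ _)
      (ih _ (by simp [hk]))
    refine h1.congr ?_ ?_
    · funext j
      by_cases h : j = k'
      · subst h; simp [Ne.symm hk]
      · by_cases h' : j = k
        · subst h'; simp [h]
        · simp [h, h']
    · simp; omega

end Move

section Call

variable {α β Γ₀ Γ₁ : Type} [Fintype Γ₁] {ea : α → List Γ₀} {eb : β → List Γ₁} {f : α → β}
  {K : Type} {Γ : K → Type} [DecidableEq K]

/-- Calls the machine `c` on the reversed contents of stack `X`, and moves the reversed output onto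
stack `Y`. -/
def callF (c : TM2ComputableInPolyTime ea eb f) (X Y : K) [Fintype (Γ X)] (g₀ : Γ X → Γ₀)
    (g₁ : Γ₁ → Γ Y) : Frag (Sum.elim c.tm.Γ Γ) :=
  letI : Fintype (Sum.elim c.tm.Γ Γ (.inl c.tm.k₁)) := Fintype.ofEquiv _ c.outputAlphabet.symm
  letI : Fintype (Sum.elim c.tm.Γ Γ (.inr X)) := inferInstanceAs (Fintype (Γ X))
  (moveF (Γ := Sum.elim c.tm.Γ Γ) (.inr X) (.inl c.tm.k₀)
    fun a => c.inputAlphabet.symm (g₀ a)).seq <|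
    ((fragOf c.tm).inl).seq <|
      moveF (Γ := Sum.elim c.tm.Γ Γ) (.inl c.tm.k₁) (.inr Y) fun b => g₁ (c.outputAlphabet b)

theorem callF_runs (c : TM2ComputableInPolyTime ea eb f) {X Y : K} [Fintype (Γ X)] (g₀ : Γ X → Γ₀)
    (g₁ : Γ₁ → Γ Y) (R : ∀ k, List (Γ k)) (a : α)
    (ha : ((R X).map g₀).reverse = ea a) :
    (callF c X Y g₀ g₁).Runs (joinS (fun _ => []) R)
      (joinS (fun _ => []) (Function.update (Function.update R X []) Y
        (((eb (f a)).map g₁).reverse ++ Function.update R X [] Y)))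
      ((ea a).length * 2 + 1 + (c.time.eval (ea a).length + ((eb (f a)).length * 2 + 1))) := by
  let _ : Fintype (Sum.elim c.tm.Γ Γ (.inl c.tm.k₁)) := Fintype.ofEquiv _ c.outputAlphabet.symm
  let _ : Fintype (Sum.elim c.tm.Γ Γ (.inr X)) := inferInstanceAs (Fintype (Γ X))
  refine Frag.Runs.seq (S' := joinS (single c.tm.k₀ ((ea a).map c.inputAlphabet.symm))
    (Function.update R X [])) ?_ (Frag.Runs.seq
      (S' := joinS (single c.tm.k₁ ((eb (f a)).map c.outputAlphabet.symm))
    (Function.update R X [])) ((runs_of_computable c a).inl _) ?_)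
  · have h := moveF_runs (Γ := Sum.elim c.tm.Γ Γ) (k := .inr X) (k' := .inl c.tm.k₀)
      (fun a => c.inputAlphabet.symm (g₀ a)) (by simp) (joinS (fun _ => []) R)
    refine h.congr ((congrArg (fun z => Function.update z (Sum.inl c.tm.k₀) _)
      (update_joinS_inr (fun _ => []) R X [])).trans
        ((update_joinS_inl _ _ _ _).trans (congrArg
          (fun w => joinS (Function.update (fun _ => []) c.tm.k₀ w) _) ?_))) ?_
    · have e : ((R X).map fun a => c.inputAlphabet.symm (g₀ a)).reverse ++ [] =
          (ea a).map c.inputAlphabet.symm := by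
        rw [← ha, List.append_nil, List.map_reverse, List.map_map]
        rfl
      exact e
    · rw [← ha]; simp [joinS]
  · have h := moveF_runs (Γ := Sum.elim c.tm.Γ Γ) (k := .inl c.tm.k₁) (k' := .inr Y)
      (fun b => g₁ (c.outputAlphabet b)) (by simp)
      (joinS (single c.tm.k₁ ((eb (f a)).map c.outputAlphabet.symm)) (Function.update R X []))
    set w := (eb (f a)).map c.outputAlphabet.symm with hw
    refine h.congr ((congrArg (fun z => Function.update z (Sum.inr Y) _)
      (update_joinS_inl (single c.tm.k₁ w) (Function.update R X []) c.tm.k₁ [])).trans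
        ((update_joinS_inr _ _ _ _).trans ?_)) ?_
    · have e : Function.update (single (Γ := c.tm.Γ) c.tm.k₁ w) c.tm.k₁ [] = fun _ => [] := by
        simp [single]
      rw [e]
      refine congrArg (fun w => joinS _ (Function.update _ Y w)) ?_
      change ((single (Γ := c.tm.Γ) c.tm.k₁ w c.tm.k₁).map
        fun b => g₁ (c.outputAlphabet b)).reverse ++ _ = _
      simp [single, hw, joinS, Function.comp_def]
    · change (single (Γ := c.tm.Γ) c.tm.k₁ w c.tm.k₁).length * 2 + 1 ≤ _
      simp [single, hw]

theorem callF_runs' (c : TM2ComputableInPolyTime ea eb f) {X Y : K} [Fintype (Γ X)] (g₀ : Γ X → Γ₀)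
    (g₁ : Γ₁ → Γ Y) {R R₁ R₂ : ∀ k, List (Γ k)} (a : α) (ha : ((R X).map g₀).reverse = ea a)
    (h₁ : Function.update R X [] = R₁)
    (h₂ : Function.update R₁ Y (((eb (f a)).map g₁).reverse ++ R₁ Y) = R₂) :
    (callF c X Y g₀ g₁).Runs (joinS (fun _ => []) R) (joinS (fun _ => []) R₂)
      ((ea a).length * 2 + 1 + (c.time.eval (ea a).length + ((eb (f a)).length * 2 + 1))) := by
  subst h₁ h₂
  exact callF_runs c g₀ g₁ R a ha

end Call

theorem output_length_le {α β Γ₀ Γ₁ : Type} {ea : α → List Γ₀} {eb : β → List Γ₁} {f : α → β}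
    (c : TM2ComputableInPolyTime ea eb f) :
    ∃ p : Polynomial ℕ, ∀ a, (eb (f a)).length ≤ p.eval (ea a).length := by
  obtain ⟨C, hC⟩ := (fragOf c.tm).exists_length_le
  refine ⟨Polynomial.X + Polynomial.C C * c.time, fun a => ?_⟩
  have h := hC _ _ _ (runs_of_computable c a) c.tm.k₁
  have h2 : (single (Γ := c.tm.Γ) c.tm.k₀ ((ea a).map c.inputAlphabet.symm) c.tm.k₁).length
      ≤ (ea a).length := by
    by_cases h : c.tm.k₁ = c.tm.k₀
    · rw [h]; simp [single]
    · simp [single, h]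
  simp only [single, Function.update_self, List.length_map] at h
  simp only [Polynomial.eval_add, Polynomial.eval_X, Polynomial.eval_mul, Polynomial.eval_C]
  simp only [single] at h2
  omega

/-! ### Binary numerals -/

/-- The number with the binary digits `l`, least significant digit first. -/
def bval : List Bool → ℕ
  | [] => 0
  | b :: l => b.toNat + 2 * bval l

/-- A numeral without superfluous zeros: its most significant digit is `1`. -/
def Canon : List Bool → Prop
  | [] => True
  | b :: l => Canon l ∧ (b = true ∨ l ≠ [])

theorem bval_append (l m : List Bool) : bval (l ++ m) = bval l + 2 ^ l.length * bval m := by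
  induction l with
  | nil => simp [bval]
  | cons b l ih => simp only [List.cons_append, bval, ih, List.length_cons, pow_succ]; ring

theorem bval_lt (l : List Bool) : bval l < 2 ^ l.length := by
  induction l with
  | nil => simp [bval]
  | cons b l ih =>
    simp only [bval, List.length_cons, pow_succ]
    have := b.toNat_le
    omega

theorem bval_replicate_false (n : ℕ) : bval (List.replicate n false) = 0 := by
  induction n with
  | zero => rfl
  | succ n ih => simp [List.replicate_succ, bval, ih]

theorem Canon.bval_pos {l : List Bool} (h : Canon l) (hl : l ≠ []) : 0 < bval l := by
  induction l with
  | nil => exact absurd rfl hl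
  | cons b l ih =>
    obtain ⟨h1, rfl | h2⟩ := h
    · simp [bval]
    · have := ih h1 h2
      simp only [bval]; omega

theorem Canon.eq_of_bval {l m : List Bool} (hl : Canon l) (hm : Canon m)
    (h : bval l = bval m) : l = m := by
  induction l generalizing m with
  | nil =>
    by_contra hne
    have := hm.bval_pos (Ne.symm hne)
    simp [bval] at h
    omega
  | cons b l ih =>
    cases m with
    | nil =>
      have := hl.bval_pos (by simp)
      rw [h] at this
      simp [bval] at this
    | cons b' m =>
      simp only [bval] at h
      have h1 : b = b' := by
        have := congrArg (· % 2) h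
        cases b <;> cases b' <;> simp at this ⊢
      subst h1
      rw [ih hl.1 hm.1 (by omega)]

theorem canon_encodeNat (n : ℕ) : Canon (encodeNat n) ∧ bval (encodeNat n) = n := by
  have key : ∀ p : PosNum, Canon (encodePosNum p) ∧ bval (encodePosNum p) = p := by
    intro p
    induction p with
    | one => simp [encodePosNum, Canon, bval]
    | bit0 p ih =>
      refine ⟨⟨ih.1, Or.inr (encodePosNum_nonempty p)⟩, ?_⟩
      simp [encodePosNum, bval, ih.2, two_mul]
    | bit1 p ih =>
      refine ⟨⟨ih.1, Or.inl rfl⟩, ?_⟩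
      simp [encodePosNum, bval, ih.2, two_mul]; ring
  have h : ((n : Num) : ℕ) = n := Num.to_of_nat n
  unfold encodeNat
  cases hn : (n : Num) with
  | zero => rw [hn] at h; simp only [encodeNum]; exact ⟨trivial, h⟩
  | pos p => rw [hn] at h; exact ⟨(key p).1, (key p).2.trans h⟩

theorem Canon.eq_encodeNat {l : List Bool} (h : Canon l) {n : ℕ} (hn : bval l = n) :
    l = encodeNat n :=
  h.eq_of_bval (canon_encodeNat n).1 (hn.trans (canon_encodeNat n).2.symm)

theorem unaryEncodeNat_eq (n : ℕ) : unaryEncodeNat n = List.replicate n true := by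
  induction n with
  | zero => rfl
  | succ n ih => rw [unaryEncodeNat, ih, List.replicate_succ]

/-! ### Programs for binary arithmetic -/

/-- The names of the stacks of bits used by the arithmetic programs. -/
inductive Stk
  | inp | a | b | c | d | e | f | g | q | out
  deriving DecidableEq

instance : Fintype Stk :=
  ⟨{.inp, .a, .b, .c, .d, .e, .f, .g, .q, .out}, fun x => by cases x <;> decide⟩

/-- All stacks of the arithmetic programs hold bits. -/
abbrev Bits : Stk → Type := fun _ => Bool

/-- The stacks with the given contents. -/
def St (inp a b c d e f g q out : List Bool) : ∀ k, List (Bits k)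
  | .inp => inp | .a => a | .b => b | .c => c | .d => d
  | .e => e | .f => f | .g => g | .q => q | .out => out

section Updates

variable (inp a b c d e f g q out x : List Bool)

@[simp] theorem St_inp : Function.update (St inp a b c d e f g q out) .inp x =
    St x a b c d e f g q out := by funext k; cases k <;> simp [St]
@[simp] theorem St_a : Function.update (St inp a b c d e f g q out) .a x =
    St inp x b c d e f g q out := by funext k; cases k <;> simp [St]
@[simp] theorem St_b : Function.update (St inp a b c d e f g q out) .b x =
    St inp a x c d e f g q out := by funext k; cases k <;> simp [St]
@[simp] theorem St_c : Function.update (St inp a b c d e f g q out) .c x =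
    St inp a b x d e f g q out := by funext k; cases k <;> simp [St]
@[simp] theorem St_d : Function.update (St inp a b c d e f g q out) .d x =
    St inp a b c x e f g q out := by funext k; cases k <;> simp [St]
@[simp] theorem St_e : Function.update (St inp a b c d e f g q out) .e x =
    St inp a b c d x f g q out := by funext k; cases k <;> simp [St]
@[simp] theorem St_f : Function.update (St inp a b c d e f g q out) .f x =
    St inp a b c d e x g q out := by funext k; cases k <;> simp [St]
@[simp] theorem St_g : Function.update (St inp a b c d e f g q out) .g x =
    St inp a b c d e f x q out := by funext k; cases k <;> simp [St]
@[simp] theorem St_q : Function.update (St inp a b c d e f g q out) .q x =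
    St inp a b c d e f g x out := by funext k; cases k <;> simp [St]
@[simp] theorem St_out : Function.update (St inp a b c d e f g q out) .out x =
    St inp a b c d e f g q x := by funext k; cases k <;> simp [St]

theorem single_inp : single (Γ := Bits) .inp x = St x [] [] [] [] [] [] [] [] [] := by
  funext k; cases k <;> simp [single, St]
theorem single_out : single (Γ := Bits) .out x = St [] [] [] [] [] [] [] [] [] x := by
  funext k; cases k <;> simp [single, St]

end Updates

/-- Moves the numeral on stack `c`, most significant digit first, to stack `out`, without leading
zeros. The state holds the digit in hand and whether a nonzero digit has been seen. -/
def normF : Frag Bits where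
  Λ := Unit
  σ := Option Bool × Bool
  main := ()
  init := (none, false)
  m _ := .pop .c (fun v o => (o, v.2)) <|
    .branch (fun v => v.1.isNone) (.load (fun _ => (none, false)) .halt) <|
      .branch (fun v => v.1.getD false || v.2)
        (.push .out (fun v => v.1.getD false) <| .load (fun v => (v.1, true)) <| .goto fun _ => ())
        (.goto fun _ => ())

theorem normF_runs (inp a b c d e f g q : List Bool) :
    normF.Runs (St inp a b c d e f g q [])
      (St inp a b [] d e f g q (encodeNat (bval c.reverse))) (c.length + 1) := by
  have key : ∀ (c o : List Bool) (x : Option Bool) (s : Bool), Canon o → (s = false → o = []) →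
      (s = true → o ≠ []) → ∃ o', Canon o' ∧ bval o' = bval (c.reverse ++ o) ∧
      Steps normF.m (c.length + 1) ⟨some (), (x, s), St inp a b c d e f g q o⟩
        ⟨none, (none, false), St inp a b [] d e f g q o'⟩ := by
    intro c
    induction c with
    | nil =>
      intro o x s ho _ _
      exact ⟨o, ho, rfl, _, rfl, by simp [normF, St, Steps]⟩
    | cons y c ih =>
      intro o x s ho h1 h2
      by_cases hy : (y || s) = true
      · obtain ⟨o', ho', hv, hs⟩ := ih (y :: o) (some y) true
          ⟨ho, by cases y <;> simp_all⟩ (by simp) (by simp)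
        refine ⟨o', ho', by simpa using hv, _, rfl, ?_⟩
        simpa [normF, St, hy] using hs
      · obtain ⟨rfl, rfl⟩ : y = false ∧ s = false := by simpa using hy
        obtain rfl := h1 rfl
        obtain ⟨o', ho', hv, hs⟩ := ih [] (some false) false trivial (by simp) (by simp)
        refine ⟨o', ho', ?_, _, rfl, ?_⟩
        · rw [hv]; simp [bval_append, bval]
        · simpa [normF, St] using hs
  obtain ⟨o', ho', hv, hs⟩ := key c [] none false trivial (by simp) (by simp)
  rw [List.append_nil] at hv
  rw [← ho'.eq_encodeNat hv]
  exact ⟨_, le_rfl, hs⟩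

/-- Adds the numerals on stacks `a` and `b`, and the bit on stack `f`. The digits of the sum end up
on stack `c`. -/
def addF : Frag Bits where
  Λ := Bool
  σ := Option Bool × Option Bool × Bool
  main := false
  init := (none, none, false)
  m
    | false => .pop .f (fun _ o => (none, none, o.getD false)) <| .goto fun _ => true
    | true => .pop .a (fun v o => (o, v.2)) <| .pop .b (fun v o => (v.1, o, v.2.2)) <|
        .branch (fun v => v.1.isNone && v.2.1.isNone)
          (.branch (fun v => v.2.2)
            (.push .c (fun _ => true) <| .load (fun _ => (none, none, false)) .halt)
            (.load (fun _ => (none, none, false)) .halt)) <|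
          .push .c (fun v => xor (xor (v.1.getD false) (v.2.1.getD false)) v.2.2) <|
            .load (fun v => (none, none, Bool.atLeastTwo (v.1.getD false) (v.2.1.getD false) v.2.2))
              <| .goto fun _ => true

theorem bval_add_digit (x y z : Bool) :
    (xor (xor x y) z).toNat + 2 * (Bool.atLeastTwo x y z).toNat = x.toNat + y.toNat + z.toNat := by
  cases x <;> cases y <;> cases z <;> rfl

theorem addF_runs (inp a b d e g q out : List Bool) (f : List Bool) (hf : f.length ≤ 1) :
    ∃ s : List Bool, bval s.reverse = bval a + bval b + bval f ∧
      s.length ≤ a.length + b.length + 1 ∧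
      addF.Runs (St inp a b [] d e f g q out) (St inp [] [] s d e [] g q out)
        (a.length + b.length + 2) := by
  have key : ∀ (k : ℕ) (a b c : List Bool) (x y : Option Bool) (z : Bool),
      a.length + b.length ≤ k →
      ∃ s, bval s = bval a + bval b + z.toNat ∧ s.length ≤ k + 1 ∧
      ∃ n ≤ k + 1, Steps addF.m n ⟨some true, (x, y, z), St inp a b c d e [] g q out⟩
        ⟨none, (none, none, false), St inp [] [] (s.reverse ++ c) d e [] g q out⟩ := by
    intro k
    induction k with
    | zero =>
      intro a b c x y z h
      obtain ⟨rfl, rfl⟩ : a = [] ∧ b = [] := by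
        constructor <;> apply List.eq_nil_of_length_eq_zero <;> omega
      cases z
      · exact ⟨[], rfl, by simp, 1, le_rfl, _, rfl, by simp [addF, St, Steps]⟩
      · exact ⟨[true], rfl, by simp, 1, le_rfl, _, rfl, by simp [addF, St, Steps]⟩
    | succ k ih =>
      intro a b c x y z h
      by_cases hab : a = [] ∧ b = []
      · obtain ⟨s, h1, h2, n, hn, h3⟩ := ih a b c x y z (by simp [hab])
        exact ⟨s, h1, by omega, n, by omega, h3⟩
      obtain ⟨s, h1, h2, n, hn, h3⟩ := ih a.tail b.tail
        (xor (xor (a.head?.getD false) (b.head?.getD false)) z :: c) none none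
        (Bool.atLeastTwo (a.head?.getD false) (b.head?.getD false) z) (by
          rcases a with _ | ⟨x, a⟩ <;> rcases b with _ | ⟨y, b⟩ <;> simp at hab h ⊢ <;> omega)
      refine ⟨xor (xor (a.head?.getD false) (b.head?.getD false)) z :: s, ?_, by simpa using h2,
        n + 1, by omega, _, rfl, ?_⟩
      · have hd := bval_add_digit (a.head?.getD false) (b.head?.getD false) z
        have hv : ∀ l : List Bool, bval l = (l.head?.getD false).toNat + 2 * bval l.tail := by
          rintro (_ | ⟨x, l⟩) <;> simp [bval]
        simp only [bval, h1]
        rw [hv a, hv b]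
        omega
      · have : (a.head?.isNone && b.head?.isNone) = false := by
          rcases a with _ | ⟨x, a⟩ <;> rcases b with _ | ⟨y, b⟩ <;> simp at hab ⊢
        simpa [addF, St, this] using h3
  obtain ⟨s, h1, h2, n, hn, h3⟩ := key _ a b [] none none (f.head?.getD false) le_rfl
  refine ⟨s.reverse, ?_, by simpa using h2, n + 1, by omega, _, rfl, ?_⟩
  · rw [List.reverse_reverse, h1]
    rcases f with _ | ⟨x, _ | ⟨y, f⟩⟩ <;> simp [bval] at hf ⊢
  · have : f.tail = [] := List.eq_nil_of_length_eq_zero (by simp; omega)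
    simpa [addF, St, this] using h3

/-- Pushes the symbols of `w`, the first one first. -/
def pushL {K : Type} {Γ : K → Type} (k : K) : List (Γ k) → Frag Γ
  | [] => skip
  | x :: w => (pushF k x).seq (pushL k w)

theorem pushL_runs {K : Type} [DecidableEq K] {Γ : K → Type} (k : K) (w : List (Γ k))
    (S : ∀ k, List (Γ k)) :
    (pushL k w).Runs S (Function.update S k (w.reverse ++ S k)) (w.length + 1) := by
  induction w generalizing S with
  | nil => exact (skip_runs S).congr (by simp) le_rfl
  | cons x w ih =>
    refine ((pushF_runs k x S).seq (ih _)).congr ?_ ?_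
    · simp
    · simp; omega

/-- Pops `n` symbols. -/
def dropF {K : Type} {Γ : K → Type} (k : K) : ℕ → Frag Γ
  | 0 => skip
  | n + 1 => Frag.seq ⟨Unit, Unit, (), (), fun _ => .pop k (fun _ _ => ()) .halt⟩ (dropF k n)

theorem dropF_runs {K : Type} [DecidableEq K] {Γ : K → Type} (k : K) (n : ℕ)
    (S : ∀ k, List (Γ k)) :
    (dropF k n).Runs S (Function.update S k ((S k).drop n)) (n + 1) := by
  induction n generalizing S with
  | zero => exact (skip_runs S).congr (by simp) le_rfl
  | succ n ih =>
    have h : Frag.Runs ⟨Unit, Unit, (), (), fun _ => .pop k (fun _ _ => ()) .halt⟩ S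
      (Function.update S k (S k).tail) 1 := ⟨1, le_rfl, _, rfl, rfl⟩
    refine (h.seq (ih _)).congr ?_ ?_
    · simp
    · omega

/-- Moves one bit from stack `a` to stack `f`. -/
def moveBitF : Frag Bits :=
  ⟨Unit, Option Bool, (), none, fun _ => .pop .a (fun _ o => o) <|
    .push .f (fun o => o.getD false) <| .load (fun _ => none) .halt⟩

theorem moveBitF_runs (inp a b c d e f g q out : List Bool) :
    moveBitF.Runs (St inp a b c d e f g q out)
      (St inp a.tail b c d e (a.head?.getD false :: f) g q out) 1 :=
  ⟨1, le_rfl, _, rfl, by simp [moveBitF, Steps, St]⟩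

theorem bval_drop (l : List Bool) (n : ℕ) : bval (l.drop n) = bval l / 2 ^ n := by
  induction n generalizing l with
  | zero => simp
  | succ n ih =>
    cases l with
    | nil => simp [bval]
    | cons b l =>
      have hb := b.toNat_le
      rw [List.drop_succ_cons, ih, pow_succ', ← Nat.div_div_eq_div_mul]
      congr 1
      simp only [bval]
      omega

theorem bval_head (l : List Bool) : bval l = (l.head?.getD false).toNat + 2 * bval l.tail := by
  rcases l with _ | ⟨x, l⟩ <;> simp [bval]

theorem moveF_St (x y : Stk) (h : x ≠ y) (S : ∀ k, List (Bits k)) :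
    (moveF (Γ := Bits) x y id).Runs S
      (Function.update (Function.update S x []) y ((S x).reverse ++ S y))
      ((S x).length * 2 + 1) := by
  simpa using moveF_runs (Γ := Bits) (k := x) (k' := y) id h S

theorem joinS_nil {K₁ K₂ : Type} {Γ₁ : K₁ → Type} {Γ₂ : K₂ → Type} :
    joinS (fun k => ([] : List (Γ₁ k))) (fun k => ([] : List (Γ₂ k))) = fun _ => [] := by
  funext k; rcases k with k | k <;> rfl

theorem single_inr {K₁ K₂ : Type} {Γ₁ : K₁ → Type} {Γ₂ : K₂ → Type} [DecidableEq K₁]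
    [DecidableEq K₂] (k : K₂) (x : List (Γ₂ k)) :
    single (Γ := Sum.elim Γ₁ Γ₂) (.inr k) x = joinS (fun _ => []) (single k x) := by
  have := update_joinS_inr (fun k => ([] : List (Γ₁ k))) (fun k => ([] : List (Γ₂ k))) k x
  rw [joinS_nil] at this
  exact this

theorem computable_of_single {K : Type} [DecidableEq K] [Fintype K] {Γ : K → Type}
    (F : Frag Γ) (k₀ k₁ : K) (e₀ : Γ k₀ ≃ Bool) (e₁ : Γ k₁ ≃ Bool) {φ : ℕ → ℕ}
    (p : Polynomial ℕ) {S S' : ℕ → ∀ k, List (Γ k)}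
    (hS : ∀ n, single k₀ ((List.replicate n true).map e₀.symm) = S n)
    (hS' : ∀ n, single k₁ ((encodeNat (φ n)).map e₁.symm) = S' n)
    (h : ∀ n, F.Runs (S n) (S' n) (p.eval n)) :
    Nonempty (TM2ComputableInPolyTime unaryEncodeNat encodeNat φ) := by
  have hin : Fintype (Γ k₀) := Fintype.ofEquiv _ e₀.symm
  refine computable_of_runs F k₀ k₁ e₀ e₁ p fun n => ?_
  rw [unaryEncodeNat_eq, hS, hS', List.length_replicate]
  exact h n

theorem computable_of_bits {K : Type} [DecidableEq K] [Fintype K] {Γ : K → Type}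
    (F : Frag (Sum.elim Γ Bits)) {φ : ℕ → ℕ} (p : Polynomial ℕ)
    (h : ∀ n, F.Runs
      (joinS (fun _ => []) (St (List.replicate n true) [] [] [] [] [] [] [] [] []))
      (joinS (fun _ => []) (St [] [] [] [] [] [] [] [] [] (encodeNat (φ n)))) (p.eval n)) :
    Nonempty (TM2ComputableInPolyTime unaryEncodeNat encodeNat φ) := by
  refine computable_of_single F (.inr .inp) (.inr .out) (Equiv.refl Bool) (Equiv.refl Bool) p
    ?_ ?_ h
  · intro n
    rw [← single_inp, ← single_inr]
    exact congrArg _ (List.map_id _)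
  · intro n
    rw [← single_out, ← single_inr]
    exact congrArg _ (List.map_id _)

/-- Rounding: polynomial-time approximations `φ` can be rescaled by a power of two. -/
theorem computable_round {φ : ℕ → ℕ} (hc : Nonempty (TM2ComputableInPolyTime
    unaryEncodeNat encodeNat φ)) (J : ℕ) :
    Nonempty (TM2ComputableInPolyTime unaryEncodeNat encodeNat
      fun n => (φ (n + (J + 1)) / 2 ^ J + 1) / 2) := by
  obtain ⟨c⟩ := hc
  obtain ⟨P, hP⟩ := output_length_le c
  let F : Frag (Sum.elim c.tm.Γ Bits) :=
    (pushL (Γ := Bits) .inp (List.replicate (J + 1) true)).inr.seq <|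
    (callF c (Γ := Bits) .inp .e id id).seq <|
    Frag.inr <| (moveF (Γ := Bits) .e .a id).seq <| (dropF (Γ := Bits) .a J).seq <|
      moveBitF.seq <| addF.seq normF
  have := c.tm.kFin
  refine computable_of_bits F (Polynomial.C (2 * J + 20) + (Polynomial.C 10 * Polynomial.X + c.time
    + Polynomial.C 10 * P).comp (Polynomial.X + Polynomial.C (J + 1))) ?_
  intro n
  set w := encodeNat (φ (n + (J + 1))) with hw
  have hlen : w.length ≤ P.eval (n + (J + 1)) := by
    simpa [unaryEncodeNat_eq] using hP (n + (J + 1))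
  have h1 := ((pushL_runs (Γ := Bits) .inp (List.replicate (J + 1) true)
    (St (List.replicate n true) [] [] [] [] [] [] [] [] [])).inr (fun k => ([] : List (c.tm.Γ k))))
  rw [St_inp] at h1
  have e2 : (List.replicate (J + 1) true).reverse ++
      St (List.replicate n true) [] [] [] [] [] [] [] [] [] .inp
      = List.replicate (n + (J + 1)) true := by
    rw [List.reverse_replicate, add_comm n]
    exact List.replicate_append_replicate
  rw [e2] at h1
  have h2 := callF_runs c (X := Stk.inp) (Y := Stk.e) (Γ := Bits) id id
    (St (List.replicate (n + (J + 1)) true) [] [] [] [] [] [] [] [] []) (n + (J + 1)) (by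
      simp [St, unaryEncodeNat_eq])
  rw [St_inp, St_e] at h2
  have h3 := moveF_St .e .a (by decide) (St [] [] [] [] [] w.reverse [] [] [] [])
  rw [St_e, St_a] at h3
  have h4 := dropF_runs (Γ := Bits) .a J (St [] w [] [] [] [] [] [] [] [])
  rw [St_a] at h4
  have h5 := moveBitF_runs [] (w.drop J) [] [] [] [] [] [] [] []
  obtain ⟨s, hs1, hs2, h6⟩ := addF_runs [] (w.drop J).tail [] [] [] [] [] []
    [((w.drop J).head?.getD false)] (by simp)
  have h7 := normF_runs [] [] [] s [] [] [] [] []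
  have e3 : bval s.reverse = (φ (n + (J + 1)) / 2 ^ J + 1) / 2 := by
    have h := bval_head (w.drop J)
    rw [bval_drop, hw, (canon_encodeNat _).2] at h
    rw [hs1]
    simp only [bval]
    have hb := ((w.drop J).head?.getD false).toNat_le
    rw [← hw] at h
    omega
  have h := h1.seq ((h2.congr (S'' := joinS (fun _ => []) (St [] [] [] [] [] w.reverse [] [] [] []))
    (by simp [St, hw]) le_rfl).seq
    (((h3.congr (S'' := St [] w [] [] [] [] [] [] [] []) (by simp [St]) le_rfl).seq
      (h4.seq (h5.seq (h6.seq h7)))).inr (fun k => ([] : List (c.tm.Γ k)))))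
  refine h.congr (by rw [e3]) ?_
  simp only [List.length_reverse, List.length_drop, List.length_tail, unaryEncodeNat_eq,
    List.length_replicate, Polynomial.eval_add, Polynomial.eval_C, Polynomial.eval_comp,
    Polynomial.eval_mul, Polynomial.eval_X, St, List.length_nil] at hs2 ⊢
  rw [← hw]
  omega

theorem loop_inp_runs (F : Frag Bits) (n T : ℕ) (S : ℕ → ∀ k, List (Bits k))
    (hS : ∀ i, S i .inp = List.replicate i true)
    (hF : ∀ i < n, F.Runs (Function.update (S (i + 1)) .inp (List.replicate i true)) (S i) T) :
    (loop (Γ := Bits) .inp fun _ => F).Runs (S n) (S 0) (n * (T + 1) + 1) := by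
  induction n with
  | zero => exact (loop_runs_nil _ _ (hS 0)).mono (by simp)
  | succ n ih =>
    refine (loop_runs_cons (Γ := Bits) .inp (fun _ => F) (by rw [hS]; rfl) (hF n n.lt_succ_self)
      (ih fun i hi => hF i (hi.trans n.lt_succ_self))).mono ?_
    ring_nf; omega

/-- The sum of two polynomial-time computable sequences of natural numbers. -/
theorem computable_add {φ₁ φ₂ : ℕ → ℕ}
    (hc₁ : Nonempty (TM2ComputableInPolyTime unaryEncodeNat encodeNat φ₁))
    (hc₂ : Nonempty (TM2ComputableInPolyTime unaryEncodeNat encodeNat φ₂)) :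
    Nonempty (TM2ComputableInPolyTime unaryEncodeNat encodeNat fun n => φ₁ n + φ₂ n) := by
  obtain ⟨c₁⟩ := hc₁
  obtain ⟨c₂⟩ := hc₂
  obtain ⟨P₁, hP₁⟩ := output_length_le c₁
  obtain ⟨P₂, hP₂⟩ := output_length_le c₂
  have hf : Fintype (Sum.elim c₂.tm.Γ Bits (.inr .f)) := inferInstanceAs (Fintype Bool)
  let F : Frag (Sum.elim c₁.tm.Γ (Sum.elim c₂.tm.Γ Bits)) :=
    (Frag.inr (Frag.inr (loop (Γ := Bits) .inp fun _ => (pushF .f true).seq (pushF .g true)))).seq <|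
    (callF c₁ (Γ := Sum.elim c₂.tm.Γ Bits) (.inr .f) (.inr .d)
      (id : Bool → Bool) (id : Bool → Bool)).seq <|
    Frag.inr <| (callF c₂ (Γ := Bits) .g .e id id).seq <| Frag.inr <|
      (moveF (Γ := Bits) .d .a id).seq <| (moveF (Γ := Bits) .e .b id).seq <| addF.seq normF
  have := c₁.tm.kFin
  have := c₂.tm.kFin
  refine computable_of_single F (.inr (.inr .inp)) (.inr (.inr .out)) (Equiv.refl Bool)
    (Equiv.refl Bool) (Polynomial.C 20 + Polynomial.C 10 * Polynomial.X + c₁.time + c₂.time +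
      Polynomial.C 10 * P₁ + Polynomial.C 10 * P₂)
    (S := fun n => joinS (fun _ => []) (joinS (fun _ => [])
      (St (List.replicate n true) [] [] [] [] [] [] [] [] [])))
    (S' := fun n => joinS (fun _ => []) (joinS (fun _ => [])
      (St [] [] [] [] [] [] [] [] [] (encodeNat (φ₁ n + φ₂ n))))) ?_ ?_ ?_
  · intro n
    rw [← single_inp, ← single_inr]
    exact (congrArg _ (List.map_id _)).trans
      (single_inr (Γ₁ := c₁.tm.Γ) (Γ₂ := Sum.elim c₂.tm.Γ Bits) (.inr .inp) _)
  · intro n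
    rw [← single_out, ← single_inr]
    exact (congrArg _ (List.map_id _)).trans
      (single_inr (Γ₁ := c₁.tm.Γ) (Γ₂ := Sum.elim c₂.tm.Γ Bits) (.inr .out) _)
  intro n
  set w₁ := encodeNat (φ₁ n) with hw₁
  set w₂ := encodeNat (φ₂ n) with hw₂
  have hlen₁ : w₁.length ≤ P₁.eval n := by simpa [unaryEncodeNat_eq] using hP₁ n
  have hlen₂ : w₂.length ≤ P₂.eval n := by simpa [unaryEncodeNat_eq] using hP₂ n
  have h1 := loop_inp_runs ((pushF .f true).seq (pushF .g true)) n 2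
    (fun i => St (List.replicate i true) [] [] [] [] [] (List.replicate (n - i) true)
      (List.replicate (n - i) true) [] []) (fun _ => rfl) (fun i hi => by
      refine ((pushF_runs (Γ := Bits) .f true _).seq (pushF_runs (Γ := Bits) .g true _)).congr ?_
        le_rfl
      rw [St_inp, St_f, St_g, show n - i = n - (i + 1) + 1 by omega, List.replicate_succ]
      rfl)
  rw [Nat.sub_self, Nat.sub_zero] at h1
  have e1 := update_joinS_inr (fun k => ([] : List (c₂.tm.Γ k)))
    (St [] [] [] [] [] [] (List.replicate n true) (List.replicate n true) [] []) .f []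
  rw [St_f] at e1
  have e2 := update_joinS_inr (fun k => ([] : List (c₂.tm.Γ k)))
    (St [] [] [] [] [] [] [] (List.replicate n true) [] []) .d w₁.reverse
  rw [St_d] at e2
  have e3 : (w₁.map id).reverse ++ [] = w₁.reverse := by simp
  have e4 : ((List.replicate n true).map id).reverse = unaryEncodeNat n := by
    simp [unaryEncodeNat_eq]
  have h2 := callF_runs' c₁ (Γ := Sum.elim c₂.tm.Γ Bits) (X := .inr .f) (Y := .inr .d)
    (id : Bool → Bool) (id : Bool → Bool) n e4 e1 ((congrArg
      (Function.update (β := fun k => List (Sum.elim c₂.tm.Γ Bits k)) _ (Sum.inr Stk.d)) e3).trans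
        e2)
  have h3 := callF_runs c₂ (X := Stk.g) (Y := Stk.e) (Γ := Bits) id id
    (St [] [] [] [] w₁.reverse [] [] (List.replicate n true) [] []) n (by
      simp [St, unaryEncodeNat_eq])
  rw [St_g, St_e] at h3
  have h4 := moveF_St .d .a (by decide) (St [] [] [] [] w₁.reverse w₂.reverse [] [] [] [])
  rw [St_d, St_a] at h4
  have h5 := moveF_St .e .b (by decide) (St [] w₁ [] [] [] w₂.reverse [] [] [] [])
  rw [St_e, St_b] at h5
  obtain ⟨s, hs1, hs2, h6⟩ := addF_runs [] w₁ w₂ [] [] [] [] [] [] (by simp)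
  have h7 := normF_runs [] [] [] s [] [] [] [] []
  have e3 : bval s.reverse = φ₁ n + φ₂ n := by
    rw [hs1, hw₁, hw₂, (canon_encodeNat _).2, (canon_encodeNat _).2]; rfl
  have h := h3.congr (S'' := joinS (fun _ => []) (St [] [] [] [] w₁.reverse w₂.reverse [] [] [] []))
    (by simp [St, hw₂]) le_rfl |>.seq (Frag.Runs.inr
    ((h4.congr (S'' := St [] w₁ [] [] [] w₂.reverse [] [] [] []) (by simp [St]) le_rfl).seq
      ((h5.congr (S'' := St [] w₁ w₂ [] [] [] [] [] [] []) (by simp [St]) le_rfl).seq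
        (h6.seq h7))) (fun k => ([] : List (c₂.tm.Γ k))))
  have h := (h1.inr (fun k => ([] : List (c₂.tm.Γ k)))).inr
    (fun k => ([] : List (c₁.tm.Γ k))) |>.congr (S'' := joinS (fun _ => []) (joinS (fun _ => [])
      (St [] [] [] [] [] [] (List.replicate n true) (List.replicate n true) [] [])))
      rfl le_rfl |>.seq <|
      h2.seq
      (h.inr (fun k => ([] : List (c₁.tm.Γ k))))
  refine h.congr (by rw [e3]) ?_
  simp only [List.length_reverse, unaryEncodeNat_eq,
    List.length_replicate, Polynomial.eval_add, Polynomial.eval_C,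
    Polynomial.eval_mul, Polynomial.eval_X, St] at hs2 ⊢
  rw [← hw₁, ← hw₂]
  omega

/-! ### Long division -/

/-- Subtracts the numeral on stack `b` from that on stack `a`. The digits of both, and those of the
difference, are left in reverse on stacks `d`, `e`, `f`, and the final borrow on stack `c`. -/
def subF : Frag Bits where
  Λ := Unit
  σ := Option Bool × Option Bool × Bool
  main := ()
  init := (none, none, false)
  m _ := .pop .a (fun v o => (o, v.2)) <| .pop .b (fun v o => (v.1, o, v.2.2)) <|
    .branch (fun v => v.1.isNone && v.2.1.isNone)
      (.push .c (fun v => v.2.2) <| .load (fun _ => (none, none, false)) .halt) <|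
      .push .d (fun v => v.2.1.getD false) <| .push .e (fun v => v.1.getD false) <|
        .push .f (fun v => xor (xor (v.1.getD false) (v.2.1.getD false)) v.2.2) <|
        .load (fun v => (none, none,
          Bool.atLeastTwo (!(v.1.getD false)) (v.2.1.getD false) v.2.2)) <| .goto fun _ => ()

theorem bval_sub_digit (x y z : Bool) :
    (xor (xor x y) z).toNat + y.toNat + z.toNat =
      x.toNat + 2 * (Bool.atLeastTwo (!x) y z).toNat := by
  cases x <;> cases y <;> cases z <;> rfl

/-- The digits of the three numerals that `subF` leaves are collected in a single list. -/
theorem subF_runs (inp c g q out : List Bool) (k : ℕ) (a b : List Bool) (ha : a.length ≤ k)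
    (hb : b.length ≤ k) :
    ∃ (L : List (Bool × Bool × Bool)) (z : Bool), L.length ≤ k ∧
      bval (L.map fun x => x.1) = bval b ∧ bval (L.map fun x => x.2.1) = bval a ∧
      bval (L.map fun x => x.2.2) + bval b = bval a + z.toNat * 2 ^ L.length ∧
      subF.Runs (St inp a b c [] [] [] g q out)
        (St inp [] [] (z :: c) (L.map fun x => x.1).reverse (L.map fun x => x.2.1).reverse
          (L.map fun x => x.2.2).reverse g q out) (k + 1) := by
  have key : ∀ (k : ℕ) (a b d e f : List Bool) (x y : Option Bool) (z : Bool),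
      a.length ≤ k → b.length ≤ k →
      ∃ (L : List (Bool × Bool × Bool)) (z' : Bool), L.length ≤ k ∧
      bval (L.map fun x => x.1) = bval b ∧ bval (L.map fun x => x.2.1) = bval a ∧
      bval (L.map fun x => x.2.2) + bval b + z.toNat = bval a + z'.toNat * 2 ^ L.length ∧
      ∃ n ≤ k + 1, Steps subF.m n ⟨some (), (x, y, z), St inp a b c d e f g q out⟩
        ⟨none, (none, none, false), St inp [] [] (z' :: c) ((L.map fun x => x.1).reverse ++ d)
          ((L.map fun x => x.2.1).reverse ++ e) ((L.map fun x => x.2.2).reverse ++ f)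
          g q out⟩ := by
    intro k
    induction k with
    | zero =>
      intro a b d e f x y z ha hb
      obtain rfl : a = [] := List.eq_nil_of_length_eq_zero (by omega)
      obtain rfl : b = [] := List.eq_nil_of_length_eq_zero (by omega)
      exact ⟨[], z, by simp, rfl, rfl, by simp [bval], 1, le_rfl, _, rfl, by simp [subF, St, Steps]⟩
    | succ k ih =>
      intro a b d e f x y z ha hb
      by_cases hab : a = [] ∧ b = []
      · obtain ⟨rfl, rfl⟩ := hab
        exact ⟨[], z, by simp, rfl, rfl, by simp [bval], 1, by omega, _, rfl, by simp [subF, St, Steps]⟩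
      set p := a.head?.getD false with hp
      set r := b.head?.getD false with hr
      obtain ⟨L, z', h1, h2, h3, h4, n, hn, h5⟩ := ih a.tail b.tail (r :: d) (p :: e)
        (xor (xor p r) z :: f) none none (Bool.atLeastTwo (!p) r z) (by simp; omega)
        (by simp; omega)
      refine ⟨(r, p, xor (xor p r) z) :: L, z', by simpa using h1, ?_, ?_, ?_, n + 1, by omega, _,
        rfl, ?_⟩
      · rw [bval_head b, ← h2]; rfl
      · rw [bval_head a, ← h3]; rfl
      · have hd := bval_sub_digit p r z
        rw [bval_head a, bval_head b]
        simp only [List.map_cons, bval, List.length_cons, pow_succ]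
        rw [← hp, ← hr]
        linarith
      · have : (a.head?.isNone && b.head?.isNone) = false := by
          rcases a with _ | ⟨x, a⟩ <;> rcases b with _ | ⟨y, b⟩ <;> simp at hab ⊢
        simpa [subF, St, this] using h5
  obtain ⟨L, z', h1, h2, h3, h4, n, hn, h5⟩ := key k a b [] [] [] none none false ha hb
  refine ⟨L, z', h1, h2, h3, by simpa using h4, n, hn, ?_⟩
  simp only [List.append_nil] at h5
  exact h5

/-- Ends a division step: according to the borrow on stack `c`, restores the minuend or keeps the
difference, and pushes the new digit of the quotient. -/
def restoreF : Frag Bits where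
  Λ := Bool
  σ := Bool × Option Bool × Option Bool × Option Bool
  main := false
  init := (false, none, none, none)
  m
    | false => .pop .c (fun _ o => (o.getD false, none, none, none)) <|
        .push .q (fun v => !v.1) <| .goto fun _ => true
    | true => .pop .d (fun v o => (v.1, o, v.2.2)) <|
        .branch (fun v => v.2.1.isNone) (.load (fun _ => (false, none, none, none)) .halt) <|
        .pop .e (fun v o => (v.1, v.2.1, o, v.2.2.2)) <|
        .pop .f (fun v o => (v.1, v.2.1, v.2.2.1, o)) <|
        .push .b (fun v => v.2.1.getD false) <|
        .push .a (fun v => (if v.1 then v.2.2.1 else v.2.2.2).getD false) <| .goto fun _ => true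

theorem restoreF_runs (inp c g q out : List Bool) (L : List (Bool × Bool × Bool)) (z : Bool) :
    restoreF.Runs (St inp [] [] (z :: c) (L.map fun x => x.1).reverse
        (L.map fun x => x.2.1).reverse (L.map fun x => x.2.2).reverse g q out)
      (St inp (L.map fun x => if z then x.2.1 else x.2.2) (L.map fun x => x.1) c [] [] [] g
        ((!z) :: q) out) (L.length + 2) := by
  have key : ∀ (M : List (Bool × Bool × Bool)) (a b : List Bool) (s),
      Steps restoreF.m (M.length + 1) ⟨some true, (z, s), St inp a b c (M.map fun x => x.1)
        (M.map fun x => x.2.1) (M.map fun x => x.2.2) g ((!z) :: q) out⟩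
        ⟨none, (false, none, none, none), St inp
          ((M.map fun x => if z then x.2.1 else x.2.2).reverse ++ a)
          ((M.map fun x => x.1).reverse ++ b) c [] [] [] g ((!z) :: q) out⟩ := by
    intro M
    induction M with
    | nil => exact fun a b s => ⟨_, rfl, by simp [restoreF, St, Steps]⟩
    | cons x M ih =>
      intro a b s
      refine ⟨_, rfl, ?_⟩
      have := ih ((if z then x.2.1 else x.2.2) :: a) (x.1 :: b)
        (some x.1, some x.2.1, some x.2.2)
      cases z <;> simpa [restoreF, St] using this
  refine ⟨L.length + 2, le_rfl, _, rfl, ?_⟩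
  have := key L.reverse [] [] (none, none, none)
  simpa [restoreF, St] using this

/-- One step of the long division of the digits on stack `g` by the numeral on stack `b`: the new
digit `x` extends the remainder on stack `a`. -/
def divStepF (x : Bool) : Frag Bits := (pushF (Γ := Bits) .a x).seq (subF.seq restoreF)

theorem divStepF_runs (x : Bool) (g q : List Bool) (k : ℕ) (a b : List Bool)
    (ha : a.length < k) (hb : b.length ≤ k) (hab : bval a < bval b) :
    ∃ (a' b' : List Bool) (y : Bool), a'.length ≤ k ∧ b'.length ≤ k ∧ bval b' = bval b ∧
      bval a' < bval b ∧ y.toNat * bval b + bval a' = 2 * bval a + x.toNat ∧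
      (divStepF x).Runs (St [] a b [] [] [] [] g q []) (St [] a' b' [] [] [] [] g (y :: q) [])
        (2 * k + 4) := by
  obtain ⟨L, z, h1, h2, h3, h4, h5⟩ := subF_runs [] [] g q [] k (x :: a) b
    (by simp; omega) hb
  have h0 := pushF_runs (Γ := Bits) .a x (St [] a b [] [] [] [] g q [])
  rw [St_a] at h0
  have h := (h0.seq (h5.seq (restoreF_runs [] [] g q [] L z)))
  have hlt := bval_lt (L.map fun x => x.2.2)
  have hx := x.toNat_le
  rw [List.length_map] at hlt
  refine ⟨_, _, !z, ?_, ?_, h2, ?_, ?_, h.mono (by omega)⟩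
  · simpa using h1
  · simpa using h1
  · cases z
    · simp [bval] at h4 ⊢; omega
    · simp [bval] at h4 h3 ⊢; omega
  · cases z
    · simp [bval] at h4 ⊢; omega
    · simp [bval] at h4 h3 ⊢; omega

theorem divLoop_runs (N : ℕ) (g : List Bool) (k : ℕ) (q a b : List Bool) (ha : a.length ≤ k)
    (hb : b.length ≤ k) (hN : k + g.length ≤ N) (hab : bval a < bval b) :
    ∃ a' b' q' : List Bool, a'.length ≤ N ∧ b'.length ≤ N ∧
      q'.length = q.length + g.length ∧ bval a' < bval b ∧
      bval q' * bval b + bval a' =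
        (bval q * bval b + bval a) * 2 ^ g.length + bval g.reverse ∧
      (loop (Γ := Bits) .g divStepF).Runs (St [] a b [] [] [] [] g q [])
        (St [] a' b' [] [] [] [] [] q' []) (g.length * (2 * N + 5) + 1) := by
  induction g generalizing k q a b with
  | nil =>
    exact ⟨a, b, q, by simp at hN; omega, by simp at hN; omega, rfl, hab, by simp [bval],
      (loop_runs_nil (Γ := Bits) .g divStepF rfl).mono (by simp)⟩
  | cons x g ih =>
    simp only [List.length_cons] at hN
    obtain ⟨a₁, b₁, y, h1, h2, h3, h4, h5, h6⟩ := divStepF_runs x g q (k + 1) a b (by omega)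
      (by omega) hab
    obtain ⟨a', b', q', g1, g2, g3, g4, g5, g6⟩ := ih (k + 1) (y :: q) a₁ b₁ h1 h2 (by omega)
      (by omega)
    refine ⟨a', b', q', g1, g2, ?_, by omega, ?_, ?_⟩
    · rw [g3]; simp; omega
    · rw [h3] at g5
      rw [g5, List.reverse_cons, bval_append]
      simp only [bval, List.length_cons, List.length_reverse, pow_succ]
      linear_combination 2 ^ g.length * h5
    · have h7 : (divStepF x).Runs (Function.update (St [] a b [] [] [] [] (x :: g) q []) .g g)
          (St [] a₁ b₁ [] [] [] [] g (y :: q) []) (2 * (k + 1) + 4) := by rw [St_g]; exact h6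
      refine (loop_runs_cons (Γ := Bits) .g divStepF rfl h7 g6).mono ?_
      simp only [List.length_cons]
      nlinarith

/-- The quotients of powers of four by a polynomial-time computable sequence of odd numbers. -/
theorem computable_div {φ : ℕ → ℕ}
    (hc : Nonempty (TM2ComputableInPolyTime unaryEncodeNat encodeNat φ)) :
    Nonempty (TM2ComputableInPolyTime unaryEncodeNat encodeNat
      fun n => 2 ^ (2 * n + 1) / (2 * φ n + 1)) := by
  obtain ⟨c⟩ := hc
  obtain ⟨P, hP⟩ := output_length_le c
  let G : Frag Bits := (pushF (Γ := Bits) .f true).seq ((pushF (Γ := Bits) .g false).seq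
    (pushF (Γ := Bits) .g false))
  let F : Frag (Sum.elim c.tm.Γ Bits) :=
    ((loop (Γ := Bits) .inp fun _ => G).seq ((pushF (Γ := Bits) .g false).seq
      (pushF (Γ := Bits) .g true))).inr.seq <|
    (callF c (Γ := Bits) .f .e id id).seq <|
    Frag.inr <| (moveF (Γ := Bits) .e .b id).seq <| (pushF (Γ := Bits) .b true).seq <|
      (loop (Γ := Bits) .g divStepF).seq <| (loop (Γ := Bits) .a fun _ => skip).seq <|
      (loop (Γ := Bits) .b fun _ => skip).seq <| (moveF (Γ := Bits) .q .c id).seq normF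
  have := c.tm.kFin
  refine computable_of_bits F (Polynomial.C 200 + Polynomial.C 200 * Polynomial.X + c.time +
    Polynomial.C 20 * P + Polynomial.C 50 * (Polynomial.X + Polynomial.C 1) *
      (Polynomial.X + P + Polynomial.C 1)) ?_
  intro n
  set w := encodeNat (φ n) with hw
  have hlen : w.length ≤ P.eval n := by simpa [unaryEncodeNat_eq] using hP n
  have h1 := loop_inp_runs G n 3
    (fun i => St (List.replicate i true) [] [] [] [] [] (List.replicate (n - i) true)
      (List.replicate (2 * (n - i)) false) [] []) (fun _ => rfl) (fun i hi => by
      refine ((pushF_runs (Γ := Bits) .f true _).seq ((pushF_runs (Γ := Bits) .g false _).seq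
        (pushF_runs (Γ := Bits) .g false _))).congr ?_ le_rfl
      rw [St_inp, St_f, St_g, St_g, show n - i = n - (i + 1) + 1 by omega, List.replicate_succ,
        Nat.mul_succ, List.replicate_succ, List.replicate_succ]
      rfl)
  rw [Nat.sub_self, Nat.sub_zero] at h1
  set g := true :: false :: List.replicate (2 * n) false with hg
  have h2 := (pushF_runs (Γ := Bits) .g false (St [] [] [] [] [] [] (List.replicate n true)
    (List.replicate (2 * n) false) [] [])).seq (pushF_runs (Γ := Bits) .g true _)
  rw [St_g, St_g] at h2
  have h3 := callF_runs' c (X := Stk.f) (Y := Stk.e) (Γ := Bits) id id n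
    (R := St [] [] [] [] [] [] (List.replicate n true) g [] []) (by simp [St, unaryEncodeNat_eq])
    (St_f ..) (St_e ..)
  have h4 := moveF_St .e .b (by decide) (St [] [] [] [] [] w.reverse [] g [] [])
  rw [St_e, St_b] at h4
  have h5 := pushF_runs (Γ := Bits) .b true (St [] [] w [] [] [] [] g [] [])
  rw [St_b] at h5
  obtain ⟨a', b', q', g1, g2, g3, g4, g5, h6⟩ := divLoop_runs (w.length + 1 + (2 * n + 2)) g
    (w.length + 1) [] [] (true :: w) (by simp) (by simp) (by simp [hg]) (by simp [bval])
  have h7 := loop_runs (Γ := Bits) .a (fun _ => skip) 1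
    (fun l => St [] l b' [] [] [] [] [] q' []) (fun _ => rfl)
    (fun x l => (skip_runs _).congr (by simp) le_rfl) a'
  have h8 := loop_runs (Γ := Bits) .b (fun _ => skip) 1
    (fun l => St [] [] l [] [] [] [] [] q' []) (fun _ => rfl)
    (fun x l => (skip_runs _).congr (by simp) le_rfl) b'
  have h9 := moveF_St .q .c (by decide) (St [] [] [] [] [] [] [] [] q' [])
  rw [St_q, St_c] at h9
  have h10 := normF_runs [] [] [] q'.reverse [] [] [] [] []
  have e3 : bval q'.reverse.reverse = 2 ^ (2 * n + 1) / (2 * φ n + 1) := by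
    have hb : bval (true :: w) = 2 * φ n + 1 := by
      simp [bval, hw, (canon_encodeNat _).2]; ring
    have hgv : bval g.reverse = 2 ^ (2 * n + 1) := by
      rw [hg]
      simp only [List.reverse_cons, List.reverse_replicate, List.append_assoc, bval_append,
        bval_replicate_false]
      simp [bval, pow_succ]
    rw [hb, hgv] at g5
    rw [hb] at g4
    simp only [bval] at g5
    rw [List.reverse_reverse]
    refine ((Nat.div_mod_unique (a := 2 ^ (2 * n + 1)) (Nat.succ_pos _)).2 ⟨?_, g4⟩).1.symm
    linarith
  have h := ((h1.seq h2).inr (fun k => ([] : List (c.tm.Γ k)))).seq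
    ((h3.congr (S'' := joinS (fun _ => []) (St [] [] [] [] [] w.reverse [] g [] []))
    (by simp [St, hw]) le_rfl).seq
    (((h4.congr (S'' := St [] [] w [] [] [] [] g [] []) (by simp [St]) le_rfl).seq
      (h5.seq (h6.seq (h7.seq (h8.seq ((h9.congr
        (S'' := St [] [] [] q'.reverse [] [] [] [] [] []) (by simp [St]) le_rfl).seq
          h10)))))).inr (fun k => ([] : List (c.tm.Γ k)))))
  refine h.congr (by rw [e3]) ?_
  have hgl : g.length = 2 * n + 2 := by simp [hg]
  simp only [List.length_reverse, unaryEncodeNat_eq, g3, hgl, List.length_nil,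
    List.length_replicate, Polynomial.eval_add, Polynomial.eval_C,
    Polynomial.eval_mul, Polynomial.eval_X, St]
  rw [← hw]
  nlinarith

/-! ### Closure properties of the polynomial-time computable reals -/

/-- Approximations with error `2 ^ J / 2 ^ n` for large `n` suffice. -/
theorem polyTimeReal_of_weak {r : ℝ≥0} {φ : ℕ → ℕ} (J : ℕ)
    (hc : Nonempty (TM2ComputableInPolyTime unaryEncodeNat encodeNat φ))
    (h : ∀ n, J ≤ n → |(φ n : ℝ) / 2 ^ n - r| ≤ 2 ^ J / 2 ^ n) : PolyTimeReal r := by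
  refine ⟨_, computable_round hc J, fun n => ?_⟩
  have h1 := h (n + (J + 1)) (by omega)
  set x := φ (n + (J + 1))
  set y := x / 2 ^ J with hy
  set z := (y + 1) / 2 with hz
  have e1 : (2 : ℝ) ^ J / 2 ^ (n + (J + 1)) = 1 / 2 ^ n / 2 := by
    rw [pow_add, pow_succ]; field_simp
  have e2 : |(z : ℝ) - x / 2 ^ (J + 1)| ≤ 1 / 2 := by
    have hx1 : y * 2 ^ J ≤ x := Nat.div_mul_le_self _ _
    have hx2 : x < (y + 1) * 2 ^ J := by
      have := Nat.lt_mul_div_succ x (show 0 < 2 ^ J by positivity)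
      rw [← hy] at this; linarith
    have hx1' : (y : ℝ) * 2 ^ J ≤ x := by exact_mod_cast hx1
    have hx2' : (x : ℝ) ≤ ((y : ℝ) + 1) * 2 ^ J := by exact_mod_cast hx2.le
    have hz1 : (y : ℝ) ≤ 2 * z := by
      have : y ≤ 2 * z := by omega
      exact_mod_cast this
    have hz2 : (2 * z : ℝ) ≤ y + 1 := by
      have : 2 * z ≤ y + 1 := by omega
      exact_mod_cast this
    have hu : (x : ℝ) / 2 ^ (J + 1) = x / 2 ^ J / 2 := by rw [pow_succ]; field_simp
    have hu1 : (y : ℝ) ≤ x / 2 ^ J := by rw [le_div_iff₀ (by positivity)]; exact hx1'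
    have hu2 : (x : ℝ) / 2 ^ J ≤ y + 1 := by rw [div_le_iff₀ (by positivity)]; exact hx2'
    rw [hu, abs_le]
    constructor <;> linarith
  have e3 : (z : ℝ) / 2 ^ n - r =
      (z - x / 2 ^ (J + 1)) / 2 ^ n + ((x : ℝ) / 2 ^ (n + (J + 1)) - r) := by
    rw [pow_add 2 n]; field_simp; ring
  rw [e3]
  refine (abs_add_le _ _).trans ?_
  rw [e1] at h1
  rw [abs_div, abs_of_pos (show (0 : ℝ) < 2 ^ n by positivity)]
  have : |(z : ℝ) - x / 2 ^ (J + 1)| / 2 ^ n ≤ 1 / 2 / 2 ^ n := by gcongr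
  have e4 : (1 : ℝ) / 2 / 2 ^ n = 1 / 2 ^ n / 2 := by ring
  linarith

theorem PolyTimeReal.add {r s : ℝ≥0} (hr : PolyTimeReal r) (hs : PolyTimeReal s) :
    PolyTimeReal (r + s) := by
  obtain ⟨φ, hφ, h1⟩ := hr
  obtain ⟨χ, hχ, h2⟩ := hs
  refine polyTimeReal_of_weak 1 (computable_add hφ hχ) fun n _ => ?_
  have e : ((φ n + χ n : ℕ) : ℝ) / 2 ^ n - (r + s : ℝ≥0) =
      ((φ n : ℝ) / 2 ^ n - r) + ((χ n : ℝ) / 2 ^ n - s) := by push_cast; ring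
  rw [e]
  refine (abs_add_le _ _).trans ?_
  have := h1 n
  have := h2 n
  have e2 : (2 : ℝ) ^ 1 / 2 ^ n = 1 / 2 ^ n + 1 / 2 ^ n := by ring
  linarith

theorem PolyTimeReal.inv {r : ℝ≥0} (hr : PolyTimeReal r) : PolyTimeReal r⁻¹ := by
  by_cases h0 : r = 0
  · simpa [h0] using hr
  obtain ⟨φ, hφ, h1⟩ := hr
  have hpos : (0 : ℝ) < r := by positivity
  obtain ⟨J, hJ⟩ := pow_unbounded_of_one_lt (3 / (r : ℝ) + 3 / (r : ℝ) ^ 2 + 1) one_lt_two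
  refine polyTimeReal_of_weak J (computable_div hφ) fun n hn => ?_
  set D : ℕ := 2 * φ n + 1 with hD
  set z := 2 ^ (2 * n + 1) / D with hz
  have hp : (0 : ℝ) < 2 ^ n := by positivity
  have hD1 : |(D : ℝ) - 2 * 2 ^ n * r| ≤ 3 := by
    have h := h1 n
    have e : (D : ℝ) - 2 * 2 ^ n * r = 2 * 2 ^ n * ((φ n : ℝ) / 2 ^ n - r) + 1 := by
      rw [hD]; push_cast; field_simp; ring
    rw [e]
    refine (abs_add_le _ _).trans ?_
    rw [abs_mul, abs_of_pos (show (0 : ℝ) < 2 * 2 ^ n by positivity), abs_one]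
    have : 2 * 2 ^ n * |(φ n : ℝ) / 2 ^ n - r| ≤ 2 * 2 ^ n * (1 / 2 ^ n) := by gcongr
    have e2 : (2 : ℝ) * 2 ^ n * (1 / 2 ^ n) = 2 := by field_simp
    linarith
  have hn2 : 3 ≤ 2 ^ n * (r : ℝ) := by
    have h3 : 3 / (r : ℝ) ≤ 2 ^ n := by
      have h4 : (0 : ℝ) ≤ 3 / (r : ℝ) ^ 2 := by positivity
      have h5 : (2 : ℝ) ^ J ≤ 2 ^ n := pow_le_pow_right₀ one_le_two hn
      linarith
    rwa [div_le_iff₀ hpos] at h3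
  have hDpos : (0 : ℝ) < D := by rw [hD]; positivity
  have hDge : 2 ^ n * (r : ℝ) ≤ D := by
    have := abs_le.1 hD1
    linarith [this.1]
  -- the quotient before rounding
  have hX : |(2 : ℝ) ^ (2 * n + 1) / D - 2 ^ n / r| ≤ 3 / (r : ℝ) ^ 2 := by
    have e : (2 : ℝ) ^ (2 * n + 1) / D - 2 ^ n / r =
        2 ^ n * (-(D - 2 * 2 ^ n * r)) / (r * D) := by
      rw [pow_succ, two_mul, pow_add]; field_simp; ring
    rw [e, abs_div, abs_mul, abs_neg, abs_of_pos hp, abs_of_pos (mul_pos hpos hDpos),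
      div_le_div_iff₀ (by positivity) (by positivity)]
    calc 2 ^ n * |(D : ℝ) - 2 * 2 ^ n * r| * (r : ℝ) ^ 2 ≤ 2 ^ n * 3 * (r : ℝ) ^ 2 := by gcongr
      _ = 3 * ((r : ℝ) * (2 ^ n * (r : ℝ))) := by ring
      _ ≤ 3 * ((r : ℝ) * (D : ℝ)) := by gcongr
  have hZ : |(z : ℝ) - 2 ^ (2 * n + 1) / D| ≤ 1 := by
    have h3 : (z : ℝ) ≤ ((2 ^ (2 * n + 1) : ℕ) : ℝ) / D := Nat.cast_div_le
    have h4 : ((2 ^ (2 * n + 1) : ℕ) : ℝ) / D < z + 1 := by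
      rw [div_lt_iff₀ hDpos]
      have := Nat.lt_mul_div_succ (2 ^ (2 * n + 1)) (show 0 < D by omega)
      rw [← hz] at this
      have h5 : ((2 ^ (2 * n + 1) : ℕ) : ℝ) < ((D * (z + 1) : ℕ) : ℝ) := by exact_mod_cast this
      push_cast at h5 ⊢
      linarith
    push_cast at h3 h4
    rw [abs_le]
    constructor <;> linarith
  have e : (z : ℝ) / 2 ^ n - (r⁻¹ : ℝ≥0) =
      ((z - 2 ^ (2 * n + 1) / D) + (2 ^ (2 * n + 1) / D - 2 ^ n / r)) / 2 ^ n := by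
    push_cast; field_simp; ring
  rw [e, abs_div, abs_of_pos hp]
  gcongr
  refine (abs_add_le _ _).trans ?_
  have : (0 : ℝ) ≤ 3 / r := by positivity
  linarith

theorem PolyTimeReal.zero : PolyTimeReal 0 := by
  refine ⟨fun _ => 0, ?_, by simp⟩
  refine computable_of_single (Γ := Bits) (loop (Γ := Bits) .inp fun _ => skip) .inp .out
    (Equiv.refl Bool) (Equiv.refl Bool) (Polynomial.C 2 * Polynomial.X + Polynomial.C 1)
    (S := fun n => St (List.replicate n true) [] [] [] [] [] [] [] [] [])
    (S' := fun n => St [] [] [] [] [] [] [] [] [] (encodeNat 0)) ?_ ?_ ?_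
  · intro n; rw [← single_inp]; exact congrArg _ (List.map_id _)
  · intro n; rw [← single_out]; exact congrArg _ (List.map_id _)
  · intro n
    have := loop_inp_runs skip n 1
      (fun i => St (List.replicate i true) [] [] [] [] [] [] [] [] []) (fun _ => rfl)
      (fun i _ => (skip_runs _).congr (by simp) le_rfl)
    refine this.congr rfl ?_
    simp; omega

theorem PolyTimeReal.one : PolyTimeReal 1 := by
  refine ⟨fun n => 2 ^ n, ?_, by simp⟩
  refine computable_of_single (Γ := Bits) ((pushF (Γ := Bits) .out true).seq
      (loop (Γ := Bits) .inp fun _ => pushF (Γ := Bits) .out false)) .inp .out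
    (Equiv.refl Bool) (Equiv.refl Bool) (Polynomial.C 2 * Polynomial.X + Polynomial.C 2)
    (S := fun n => St (List.replicate n true) [] [] [] [] [] [] [] [] [])
    (S' := fun n => St [] [] [] [] [] [] [] [] [] (encodeNat (2 ^ n))) ?_ ?_ ?_
  · intro n; rw [← single_inp]; exact congrArg _ (List.map_id _)
  · intro n; rw [← single_out]; exact congrArg _ (List.map_id _)
  · intro n
    have h0 := pushF_runs (Γ := Bits) .out true
      (St (List.replicate n true) [] [] [] [] [] [] [] [] [])
    rw [St_out] at h0
    have := loop_inp_runs (pushF (Γ := Bits) .out false) n 1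
      (fun i => St (List.replicate i true) [] [] [] [] [] [] [] []
        (List.replicate (n - i) false ++ [true])) (fun _ => rfl) (fun i hi => by
          refine (pushF_runs (Γ := Bits) .out false _).congr ?_ le_rfl
          rw [St_inp, St_out, show n - i = n - (i + 1) + 1 by omega, List.replicate_succ]
          rfl)
    rw [Nat.sub_self, Nat.sub_zero] at this
    have hcan : ∀ n, Canon (List.replicate n false ++ [true]) := by
      intro n
      induction n with
      | zero => simp [Canon]
      | succ n ih => exact ⟨ih, by simp⟩
    have e : List.replicate n false ++ [true] = encodeNat (2 ^ n) :=
      (hcan n).eq_encodeNat (by simp [bval_append, bval_replicate_false, bval])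
    rw [e] at this
    refine ((h0.congr rfl le_rfl).seq this).congr rfl ?_
    simp; omega

/-! ### Sums of products of atomic formulas -/

section Pps

variable {A : Set BFun} {V W : Type}

/-- Renames the variables of an atomic formula. -/
def Atom.map (r : V → W) (φ : Atom A V) : Atom A W := ⟨φ.fn, r ∘ φ.scope⟩

theorem Atom.eval_map (r : V → W) (φ : Atom A V) (z : W → Bool) :
    (φ.map r).eval z = φ.eval (z ∘ r) := rfl

/-- The product of a list of atomic formulas. -/
def evalProd (L : List (Atom A V)) (z : V → Bool) : ℝ≥0 := (L.map fun φ => φ.eval z).prod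

@[simp] theorem evalProd_nil (z : V → Bool) : evalProd ([] : List (Atom A V)) z = 1 := rfl

@[simp] theorem evalProd_cons (φ : Atom A V) (L : List (Atom A V)) (z : V → Bool) :
    evalProd (φ :: L) z = φ.eval z * evalProd L z := by simp [evalProd]

@[simp] theorem evalProd_append (L L' : List (Atom A V)) (z : V → Bool) :
    evalProd (L ++ L') z = evalProd L z * evalProd L' z := by simp [evalProd]

theorem evalProd_map (r : V → W) (L : List (Atom A V)) (z : W → Bool) :
    evalProd (L.map (Atom.map r)) z = evalProd L (z ∘ r) := by
  simp [evalProd, Function.comp_def, Atom.eval_map]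

/-- `g` is given by a pps-formula over `A` whose free variables are the elements of `V`. -/
def Pps (A : Set BFun) (V : Type) (g : (V → Bool) → ℝ≥0) : Prop :=
  ∃ (b : ℕ) (L : List (Atom A (V ⊕ Fin b))), ∀ x, g x = ∑ y, evalProd L (Sum.elim x y)

theorem pps_of_fintype {B : Type} [Fintype B] [DecidableEq B] (L : List (Atom A (V ⊕ B))) :
    Pps A V fun x => ∑ y, evalProd L (Sum.elim x y) := by
  let e := Fintype.equivFin B
  refine ⟨_, L.map (Atom.map (Sum.map id e)), fun x => ?_⟩
  refine Fintype.sum_equiv (e.arrowCongr (Equiv.refl Bool)) _ _ fun y => ?_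
  rw [evalProd_map]
  congr 1
  funext v
  rcases v with v | v <;> simp

theorem sum_sum_arrow {B C : Type} [Fintype B] [DecidableEq B] [Fintype C] [DecidableEq C]
    {M : Type} [AddCommMonoid M] (f : (B ⊕ C → Bool) → M) :
    ∑ y, f y = ∑ y, ∑ y', f (Sum.elim y y') := by
  rw [← Fintype.sum_prod_type' (f := fun y y' => f (Sum.elim y y'))]
  refine Fintype.sum_equiv (Equiv.sumArrowEquivProdArrow B C Bool) _ _ fun y => ?_
  exact congrArg f (Sum.elim_comp_inl_inr y).symm

theorem Pps.congr {g g' : (V → Bool) → ℝ≥0} (h : Pps A V g) (e : ∀ x, g x = g' x) :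
    Pps A V g' := (funext e : g = g') ▸ h

theorem Pps.rename {g : (V → Bool) → ℝ≥0} (h : Pps A V g) (r : V → W) :
    Pps A W fun x => g (x ∘ r) := by
  obtain ⟨b, L, h⟩ := h
  refine ⟨b, L.map (Atom.map (Sum.map r id)), fun x => ?_⟩
  simp [h, evalProd_map, Sum.elim_comp_map]

theorem Pps.mul {g g' : (V → Bool) → ℝ≥0} (h : Pps A V g) (h' : Pps A V g') :
    Pps A V fun x => g x * g' x := by
  obtain ⟨b, L, h⟩ := h
  obtain ⟨b', L', h'⟩ := h'
  refine (pps_of_fintype (B := Fin b ⊕ Fin b') (L.map (Atom.map (Sum.map id Sum.inl)) ++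
    L'.map (Atom.map (Sum.map id Sum.inr)))).congr fun x => ?_
  rw [h, h', Finset.sum_mul_sum, sum_sum_arrow]
  simp [evalProd_map, Sum.elim_comp_map]

theorem Pps.one : Pps A V fun _ => 1 := ⟨0, [], fun x => by simp⟩

theorem Pps.pow {g : (V → Bool) → ℝ≥0} (h : Pps A V g) (n : ℕ) : Pps A V fun x => g x ^ n := by
  induction n with
  | zero => simpa using Pps.one
  | succ n ih => exact (ih.mul h).congr fun x => (pow_succ _ _).symm

theorem Pps.prod {ι : Type} (s : Finset ι) {g : ι → (V → Bool) → ℝ≥0}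
    (h : ∀ i ∈ s, Pps A V (g i)) : Pps A V fun x => ∏ i ∈ s, g i x := by
  classical
  induction s using Finset.induction_on with
  | empty => simpa using Pps.one
  | insert i s hi ih =>
    simp only [Finset.prod_insert hi]
    exact (h i (by simp)).mul (ih fun j hj => h j (by simp [hj]))

theorem Pps.sum [Fintype W] [DecidableEq W] {g : (V ⊕ W → Bool) → ℝ≥0} (h : Pps A (V ⊕ W) g) :
    Pps A V fun x => ∑ w, g (Sum.elim x w) := by
  obtain ⟨b, L, h⟩ := h
  refine (pps_of_fintype (B := W ⊕ Fin b) (L.map (Atom.map (Equiv.sumAssoc _ _ _)))).congr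
    fun x => ?_
  rw [sum_sum_arrow]
  refine Finset.sum_congr rfl fun w _ => ?_
  rw [h]
  refine Finset.sum_congr rfl fun y _ => ?_
  rw [evalProd_map]
  congr 1
  funext v
  rcases v with (v | v) | v <;> rfl

theorem Pps.atom {G : BFun} (hG : G ∈ A) (s : Fin G.arity → V) :
    Pps A V fun x => G.val fun i => x (s i) :=
  ⟨0, [⟨⟨G, hG⟩, fun i => .inl (s i)⟩], fun x => by simp [Atom.eval]⟩

/-! ### Families of pps-formulas with a repeated part -/

/-- The families of functions that are given by pps-formulas in which a fixed part is
repeated `k` times: `f k x = ∑_y g₀(x,y) g₁(x,y)^k`. -/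
def Reg (A : Set BFun) (V : Type) (f : ℕ → (V → Bool) → ℝ≥0) : Prop :=
  ∃ (b : ℕ) (g₀ g₁ : (V ⊕ Fin b → Bool) → ℝ≥0), Pps A (V ⊕ Fin b) g₀ ∧ Pps A (V ⊕ Fin b) g₁ ∧
    ∀ k x, f k x = ∑ y, g₀ (Sum.elim x y) * g₁ (Sum.elim x y) ^ k

theorem reg_of_fintype {B : Type} [Fintype B] [DecidableEq B] {g₀ g₁ : (V ⊕ B → Bool) → ℝ≥0}
    (h₀ : Pps A (V ⊕ B) g₀) (h₁ : Pps A (V ⊕ B) g₁) :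
    Reg A V fun k x => ∑ y, g₀ (Sum.elim x y) * g₁ (Sum.elim x y) ^ k := by
  let e := Fintype.equivFin B
  refine ⟨_, _, _, h₀.rename (Sum.map id e), h₁.rename (Sum.map id e), fun k x => ?_⟩
  refine Fintype.sum_equiv (e.arrowCongr (Equiv.refl Bool)) _ _ fun y => ?_
  have : (Sum.elim x (e.arrowCongr (Equiv.refl Bool) y)) ∘ Sum.map id e = Sum.elim x y := by
    funext v
    rcases v with v | v <;> simp
  rw [this]

variable {f f' : ℕ → (V → Bool) → ℝ≥0}

theorem Reg.congr (h : Reg A V f) (e : ∀ k x, f k x = f' k x) : Reg A V f' :=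
  (funext fun k => funext (e k) : f = f') ▸ h

theorem Pps.reg {g : (V → Bool) → ℝ≥0} (h : Pps A V g) : Reg A V fun _ => g :=
  (reg_of_fintype (B := Empty) (h.rename Sum.inl) Pps.one).congr fun k x => by simp

theorem Pps.reg_pow {g : (V → Bool) → ℝ≥0} (h : Pps A V g) : Reg A V fun k x => g x ^ k :=
  (reg_of_fintype (B := Empty) Pps.one (h.rename Sum.inl)).congr fun k x => by simp

theorem Reg.rename (h : Reg A V f) (r : V → W) : Reg A W fun k x => f k (x ∘ r) := by
  obtain ⟨b, g₀, g₁, h₀, h₁, h⟩ := h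
  refine ⟨b, _, _, h₀.rename (Sum.map r id), h₁.rename (Sum.map r id), fun k x => ?_⟩
  simp [h, Sum.elim_comp_map]

theorem Reg.mul (h : Reg A V f) (h' : Reg A V f') : Reg A V fun k x => f k x * f' k x := by
  obtain ⟨b, g₀, g₁, h₀, h₁, h⟩ := h
  obtain ⟨b', g₀', g₁', h₀', h₁', h'⟩ := h'
  refine (reg_of_fintype (B := Fin b ⊕ Fin b')
    ((h₀.rename (Sum.map id Sum.inl)).mul (h₀'.rename (Sum.map id Sum.inr)))
    ((h₁.rename (Sum.map id Sum.inl)).mul (h₁'.rename (Sum.map id Sum.inr)))).congr fun k x => ?_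
  rw [h, h', Finset.sum_mul_sum, sum_sum_arrow]
  refine Finset.sum_congr rfl fun y _ => Finset.sum_congr rfl fun y' _ => ?_
  simp only [Sum.elim_comp_map, Function.comp_id, Sum.elim_comp_inl, Sum.elim_comp_inr]
  ring

theorem Reg.prod {ι : Type} (s : Finset ι) {f : ι → ℕ → (V → Bool) → ℝ≥0}
    (h : ∀ i ∈ s, Reg A V (f i)) : Reg A V fun k x => ∏ i ∈ s, f i k x := by
  classical
  induction s using Finset.induction_on with
  | empty => simpa using Pps.one.reg
  | insert i s hi ih =>
    simp only [Finset.prod_insert hi]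
    exact (h i (by simp)).mul (ih fun j hj => h j (by simp [hj]))

theorem Reg.sum [Fintype W] [DecidableEq W] {f : ℕ → (V ⊕ W → Bool) → ℝ≥0}
    (h : Reg A (V ⊕ W) f) : Reg A V fun k x => ∑ w, f k (Sum.elim x w) := by
  obtain ⟨b, g₀, g₁, h₀, h₁, h⟩ := h
  refine (reg_of_fintype (B := W ⊕ Fin b) (h₀.rename (Equiv.sumAssoc _ _ _))
    (h₁.rename (Equiv.sumAssoc _ _ _))).congr fun k x => ?_
  rw [sum_sum_arrow]
  refine Finset.sum_congr rfl fun w _ => ?_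
  rw [h]
  refine Finset.sum_congr rfl fun y _ => ?_
  have : Sum.elim x (Sum.elim w y) ∘ (Equiv.sumAssoc V W (Fin b)) =
      Sum.elim (Sum.elim x w) y := by
    funext v
    rcases v with (v | v) | v <;> rfl
  rw [this]

/-- Summation over a single variable. -/
theorem Reg.sum_bool {f : ℕ → (V ⊕ Unit → Bool) → ℝ≥0} (h : Reg A (V ⊕ Unit) f) :
    Reg A V fun k x => ∑ b : Bool, f k (Sum.elim x fun _ => b) :=
  h.sum.congr fun _ _ => Fintype.sum_equiv (Equiv.funUnique Unit Bool) _ _ fun _ => rfl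

theorem Reg.comp_mul (h : Reg A V f) (c : ℕ) : Reg A V fun k x => f (c * k) x := by
  obtain ⟨b, g₀, g₁, h₀, h₁, h⟩ := h
  refine ⟨b, g₀, _, h₀, h₁.pow c, fun k x => ?_⟩
  simp [h, pow_mul]

end Pps

/-! ### Exponentially fast convergence -/

/-- The sequence `u` (from index `1` on) converges to `l` exponentially fast. -/
def ExpLim (u : ℕ → ℝ) (l : ℝ) : Prop :=
  ∃ C ρ : ℝ, 0 ≤ C ∧ 0 < ρ ∧ ρ < 1 ∧ ∀ k ≥ 1, |u k - l| ≤ C * ρ ^ k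

namespace ExpLim

variable {u v : ℕ → ℝ} {l m : ℝ}

theorem congr (h : ExpLim u l) (e : ∀ k, u k = v k) : ExpLim v l := (funext e : u = v) ▸ h

theorem const (l : ℝ) : ExpLim (fun _ => l) l := ⟨0, 1 / 2, le_rfl, by norm_num, by norm_num,
  fun k _ => by simp⟩

theorem of_le {C ρ : ℝ} (hρ : 0 < ρ) (hρ1 : ρ < 1) (h : ∀ k ≥ 1, |u k - l| ≤ C * ρ ^ k) :
    ExpLim u l :=
  ⟨|C|, ρ, abs_nonneg C, hρ, hρ1, fun k hk =>
    (h k hk).trans (mul_le_mul_of_nonneg_right (le_abs_self C) (by positivity))⟩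

theorem pow_zero {ρ : ℝ} (hρ : 0 ≤ ρ) (hρ1 : ρ < 1) : ExpLim (fun k => ρ ^ k) 0 := by
  refine of_le (C := 1) (ρ := (ρ + 1) / 2) (by linarith) (by linarith) fun k _ => ?_
  rw [sub_zero, abs_of_nonneg (by positivity), one_mul]
  exact pow_le_pow_left₀ hρ (by linarith) k

theorem add (h : ExpLim u l) (h' : ExpLim v m) : ExpLim (fun k => u k + v k) (l + m) := by
  obtain ⟨C, ρ, hC, hρ, hρ1, h⟩ := h
  obtain ⟨C', ρ', hC', hρ', hρ1', h'⟩ := h'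
  refine ⟨C + C', max ρ ρ', by positivity, by positivity, max_lt hρ1 hρ1', fun k hk => ?_⟩
  have e : u k + v k - (l + m) = (u k - l) + (v k - m) := by ring
  rw [e, add_mul]
  refine (abs_add_le _ _).trans (add_le_add ((h k hk).trans ?_) ((h' k hk).trans ?_))
  · gcongr; exact le_max_left _ _
  · gcongr; exact le_max_right _ _

theorem mul (h : ExpLim u l) (h' : ExpLim v m) : ExpLim (fun k => u k * v k) (l * m) := by
  obtain ⟨C, ρ, hC, hρ, hρ1, h⟩ := h
  obtain ⟨C', ρ', hC', hρ', hρ1', h'⟩ := h'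
  refine ⟨C * (C' + |m|) + |l| * C', max ρ ρ', by positivity, by positivity, max_lt hρ1 hρ1',
    fun k hk => ?_⟩
  have h1 : |u k - l| ≤ C * max ρ ρ' ^ k := (h k hk).trans (by gcongr; exact le_max_left _ _)
  have h2 : |v k - m| ≤ C' * max ρ ρ' ^ k := (h' k hk).trans (by gcongr; exact le_max_right _ _)
  have h3 : max ρ ρ' ^ k ≤ 1 := pow_le_one₀ (by positivity) (max_lt hρ1 hρ1').le
  have h4 : |v k| ≤ C' + |m| := by
    have e : v k = (v k - m) + m := by ring
    rw [e]
    refine (abs_add_le _ _).trans ?_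
    have : C' * max ρ ρ' ^ k ≤ C' * 1 := by gcongr
    linarith
  have e : u k * v k - l * m = (u k - l) * v k + l * (v k - m) := by ring
  rw [e]
  refine (abs_add_le _ _).trans ?_
  rw [abs_mul, abs_mul]
  calc |u k - l| * |v k| + |l| * |v k - m|
      ≤ (C * max ρ ρ' ^ k) * (C' + |m|) + |l| * (C' * max ρ ρ' ^ k) := by gcongr
    _ = _ := by ring

theorem prod {ι : Type} (s : Finset ι) {u : ι → ℕ → ℝ} {l : ι → ℝ}
    (h : ∀ i ∈ s, ExpLim (u i) (l i)) : ExpLim (fun k => ∏ i ∈ s, u i k) (∏ i ∈ s, l i) := by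
  classical
  induction s using Finset.induction_on with
  | empty => simpa using const 1
  | insert i s hi ih =>
    simp only [Finset.prod_insert hi]
    exact (h i (by simp)).mul (ih fun j hj => h j (by simp [hj]))

end ExpLim

/-! ### Approximability -/

/-- `h` is approximated, at any exponential rate, by families of pps-formulas with a repeated
part. -/
def Approx (A : Set BFun) (V : Type) (h : (V → Bool) → ℝ≥0) : Prop :=
  ∀ q : ℝ, 0 < q → ∃ f, Reg A V f ∧ ∀ k ≥ 1, ∀ x, |(f k x : ℝ) - h x| ≤ q ^ k

section Approx

variable {A : Set BFun} {V W : Type} {h h' : (V → Bool) → ℝ≥0}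

theorem Approx.congr (H : Approx A V h) (e : ∀ x, h x = h' x) : Approx A V h' :=
  (funext e : h = h') ▸ H

/-- By passing to the repetition numbers `c * k`, any exponential rate can be improved. -/
theorem approx_of_expLim [Finite V] {f : ℕ → (V → Bool) → ℝ≥0} (hf : Reg A V f)
    (hh : ∀ x, ExpLim (fun k => (f k x : ℝ)) (h x)) : Approx A V h := by
  intro q hq
  have := Fintype.ofFinite (V → Bool)
  have key : ∀ x, ∃ c₀ : ℕ, ∀ c ≥ c₀, ∀ k ≥ 1, |(f (c * k) x : ℝ) - h x| ≤ q ^ k := by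
    intro x
    obtain ⟨C, ρ, hC, hρ, hρ1, hx⟩ := hh x
    obtain ⟨c₀, hc₀⟩ := exists_pow_lt_of_lt_one (show 0 < q / (C + 1) by positivity) hρ1
    refine ⟨max c₀ 1, fun c hc k hk => (hx _ (Nat.mul_pos (by omega) hk)).trans ?_⟩
    have h1 : ρ ^ c ≤ q / (C + 1) :=
      (pow_le_pow_of_le_one hρ.le hρ1.le (by omega)).trans hc₀.le
    have h2 : C ≤ (C + 1) ^ k := (by linarith : C ≤ C + 1).trans (le_self_pow₀ (by linarith)
      (by omega))
    calc C * ρ ^ (c * k) ≤ (C + 1) ^ k * (q / (C + 1)) ^ k := by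
          rw [pow_mul]; gcongr
      _ = q ^ k := by rw [← mul_pow]; congr 1; field_simp
  choose c₀ hc₀ using key
  refine ⟨_, hf.comp_mul (∑ x, c₀ x), fun k hk x => hc₀ x _ ?_ k hk⟩
  exact Finset.single_le_sum (f := c₀) (fun _ _ => Nat.zero_le _) (Finset.mem_univ x)

theorem Pps.approx (H : Pps A V h) : Approx A V h := fun q hq =>
  ⟨_, H.reg, fun k _ x => by simp; positivity⟩

theorem Approx.rename (H : Approx A V h) (r : V → W) : Approx A W fun x => h (x ∘ r) :=
  fun q hq =>
    let ⟨_, hf, hh⟩ := H q hq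
    ⟨_, hf.rename r, fun k hk x => hh k hk (x ∘ r)⟩

/-- The approximants at a fixed rate. -/
theorem Approx.exists_reg (H : Approx A V h) : ∃ f, Reg A V f ∧
    (∀ x, ExpLim (fun k => (f k x : ℝ)) (h x)) ∧
    ∀ x, h x = 0 → ExpLim (fun k => 2 ^ k * (f k x : ℝ)) 0 := by
  obtain ⟨f, hf, hh⟩ := H (1 / 4) (by norm_num)
  refine ⟨f, hf, fun x => ExpLim.of_le (C := 1) (ρ := 1 / 4) (by norm_num) (by norm_num)
    fun k hk => by simpa using hh k hk x, fun x hx => ExpLim.of_le (C := 1) (ρ := 1 / 2)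
    (by norm_num) (by norm_num) fun k hk => ?_⟩
  have h1 := hh k hk x
  rw [hx] at h1
  simp only [NNReal.coe_zero, sub_zero] at h1 ⊢
  rw [abs_mul, abs_of_pos (by positivity : (0 : ℝ) < 2 ^ k), one_mul]
  calc (2 : ℝ) ^ k * |(f k x : ℝ)| ≤ 2 ^ k * (1 / 4) ^ k := by gcongr
    _ = (1 / 2) ^ k := by rw [← mul_pow]; norm_num

end Approx

/-! ### Substituting approximants for function symbols -/

/-- A pps-formula with a part that can be repeated, to be substituted for the function symbol `G`:
`b₀` bound variables and the atomic formulas `L₀` are fixed, and `b₁` bound variables and the atomic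
formulas `L₁` are repeated. -/
structure Gadget (A : Set BFun) (G : BFun) : Type where
  b₀ : ℕ
  b₁ : ℕ
  L₀ : List (Atom A (Fin G.arity ⊕ Fin b₀))
  L₁ : List (Atom A ((Fin G.arity ⊕ Fin b₀) ⊕ Fin b₁))

/-- The function that a gadget specifies if its second part is used `k` times. -/
def Gadget.val {A : Set BFun} {G : BFun} (D : Gadget A G) (k : ℕ) (u : Fin G.arity → Bool) :
    ℝ≥0 :=
  ∑ y, evalProd D.L₀ (Sum.elim u y) * (∑ y', evalProd D.L₁ (Sum.elim (Sum.elim u y) y')) ^ k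

theorem Approx.exists_gadget {A : Set BFun} {G : BFun} (h : Approx A (Fin G.arity) G.val) {q : ℝ}
    (hq : 0 < q) : ∃ D : Gadget A G, ∀ k ≥ 1, ∀ x, |(D.val k x : ℝ) - G.val x| ≤ q ^ k := by
  obtain ⟨f, ⟨b, g₀, g₁, ⟨c₀, L₀, h₀⟩, ⟨c₁, L₁, h₁⟩, hf⟩, hh⟩ := h q hq
  refine ⟨⟨b + c₀, c₁, L₀.map (Atom.map ?_), L₁.map (Atom.map (Sum.map (Sum.map id
    (Fin.castAdd c₀)) id))⟩, fun k hk x => ?_⟩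
  · exact Sum.elim (Sum.map id (Fin.castAdd c₀)) fun j => .inr (Fin.natAdd b j)
  · convert hh k hk x using 4
    rw [hf, Gadget.val]
    rw [← (Fin.appendEquiv b c₀).sum_comp, Fintype.sum_prod_type]
    refine Finset.sum_congr rfl fun y _ => ?_
    rw [h₀, h₁, Finset.sum_mul]
    refine Finset.sum_congr rfl fun y' _ => ?_
    congr 1
    · rw [evalProd_map]
      congr 1
      funext v
      rcases v with (v | v) | v <;> simp [Fin.appendEquiv]
    · congr 1
      refine Finset.sum_congr rfl fun z _ => ?_
      rw [evalProd_map]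
      congr 1
      funext v
      rcases v with (v | v) | v <;> simp [Fin.appendEquiv]

/-- Restricts the set of functions of an atomic formula. -/
def Atom.restrict {A B : Set BFun} {V : Type} (φ : Atom A V) (h : φ.fn.1 ∈ B) : Atom B V :=
  ⟨⟨φ.fn.1, h⟩, φ.scope⟩

theorem exists_restrict {A B : Set BFun} {V : Type} (L : List (Atom A V))
    (h : ∀ φ ∈ L, φ.fn.1 ∈ B) : ∃ L' : List (Atom B V), ∀ z, evalProd L' z = evalProd L z := by
  induction L with
  | nil => exact ⟨[], fun z => rfl⟩
  | cons φ L ih =>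
    obtain ⟨L', hL'⟩ := ih fun φ hφ => h φ (by simp [hφ])
    refine ⟨φ.restrict (h φ (by simp)) :: L', fun z => ?_⟩
    simp only [evalProd_cons, hL']
    rfl

open Classical in
/-- Finitely many gadgets use finitely many functions. -/
theorem exists_finset_gadget {A : Set BFun} {S : Finset BFun} (hEQ : EQ ∈ A)
    (D : ∀ G : (S : Set BFun), Gadget A G.1) :
    ∃ S' : Finset BFun, (S' : Set BFun) ⊆ A ∧ EQ ∈ (S' : Set BFun) ∧
      ∃ D' : ∀ G : (S : Set BFun), Gadget (S' : Set BFun) G.1,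
        ∀ G k x, (D' G).val k x = (D G).val k x := by
  let T : Finset BFun := insert EQ (Finset.univ.biUnion fun G : (S : Set BFun) =>
    ((D G).L₀.map fun φ => φ.fn.1).toFinset ∪ ((D G).L₁.map fun φ => φ.fn.1).toFinset)
  refine ⟨T, ?_, by simp [T], ?_⟩
  · intro G hG
    simp only [T, Finset.coe_insert, Set.mem_insert_iff, Finset.mem_coe, Finset.mem_biUnion,
      Finset.mem_union, List.mem_toFinset, List.mem_map] at hG
    rcases hG with rfl | ⟨G', _, ⟨φ, _, rfl⟩ | ⟨φ, _, rfl⟩⟩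
    · exact hEQ
    · exact φ.fn.2
    · exact φ.fn.2
  · have key : ∀ G : (S : Set BFun), ∃ D' : Gadget (T : Set BFun) G.1,
        ∀ k x, D'.val k x = (D G).val k x := by
      intro G
      obtain ⟨L₀, h₀⟩ := exists_restrict (B := (T : Set BFun)) (D G).L₀ fun φ hφ => by
        refine Finset.mem_insert_of_mem (Finset.mem_biUnion.2 ⟨G, Finset.mem_univ _,
          Finset.mem_union_left _ ?_⟩)
        exact List.mem_toFinset.2 (List.mem_map.2 ⟨φ, hφ, rfl⟩)
      obtain ⟨L₁, h₁⟩ := exists_restrict (B := (T : Set BFun)) (D G).L₁ fun φ hφ => by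
        refine Finset.mem_insert_of_mem (Finset.mem_biUnion.2 ⟨G, Finset.mem_univ _,
          Finset.mem_union_right _ ?_⟩)
        exact List.mem_toFinset.2 (List.mem_map.2 ⟨φ, hφ, rfl⟩)
      exact ⟨⟨(D G).b₀, (D G).b₁, L₀, L₁⟩, fun k x => by simp [Gadget.val, h₀, h₁]⟩
    choose D' hD' using key
    exact ⟨D', hD'⟩

section Subst

variable {S S' : Set BFun} (D : ∀ G : S, Gadget S' G.1) (hEQ : EQ ∈ S') (k : ℕ)

/-- The number of new bound variables for an occurrence of `G`: copies of the arguments, the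
fixed bound variables, and `k` copies of the repeated ones. -/
abbrev Gadget.size {G : BFun} (D : Gadget S' G) (k : ℕ) : ℕ := (G.arity + D.b₀) + k * D.b₁

/-- The atomic formula `x = y`. -/
def eqAtom {V : Type} (x y : V) : Atom S' V := ⟨⟨EQ, hEQ⟩, ![x, y]⟩

theorem eval_eqAtom {V : Type} (x y : V) (z : V → Bool) :
    (eqAtom hEQ x y).eval z = if z x = z y then 1 else 0 := rfl

variable {n M : ℕ} {G : BFun}

/-- The position of the fixed variables of a gadget among the bound variables, of which the first
`M` are already in use. -/
def fixVar (D : Gadget S' G) (k n M : ℕ) (v : Fin G.arity ⊕ Fin D.b₀) :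
    Fin n ⊕ Fin (M + D.size k) :=
  .inr (Fin.natAdd M (Fin.castAdd _ (finSumFinEquiv v)))

/-- The position of the variables of the `t`-th copy of the repeated part. -/
def repVar (D : Gadget S' G) (k n M : ℕ) (t : Fin k) :
    (Fin G.arity ⊕ Fin D.b₀) ⊕ Fin D.b₁ → Fin n ⊕ Fin (M + D.size k) :=
  Sum.elim (fixVar D k n M) fun j => .inr (Fin.natAdd M (Fin.natAdd _ (finProdFinEquiv (t, j))))

/-- The variables that are already in use. -/
def oldVar (n M c : ℕ) : Fin n ⊕ Fin M → Fin n ⊕ Fin (M + c) := Sum.map id (Fin.castAdd c)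

/-- The atomic formulas that replace `G(s₁, …, s_a)`. -/
def chunk (D : Gadget S' G) (k : ℕ) (s : Fin G.arity → Fin n ⊕ Fin M) :
    List (Atom S' (Fin n ⊕ Fin (M + D.size k))) :=
  D.L₀.map (Atom.map (fixVar D k n M)) ++
    ((List.finRange k).flatMap fun t => D.L₁.map (Atom.map (repVar D k n M t))) ++
    List.ofFn fun i => eqAtom hEQ (fixVar D k n M (.inl i)) (oldVar n M _ (s i))

theorem evalProd_flatMap {ι V : Type} (l : List ι) (f : ι → List (Atom S' V)) (z : V → Bool) :
    evalProd (l.flatMap f) z = (l.map fun t => evalProd (f t) z).prod := by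
  induction l with
  | nil => simp
  | cons t l ih => simp [ih]

theorem sum_append {p q : ℕ} {R : Type} [AddCommMonoid R] (f : (Fin (p + q) → Bool) → R) :
    ∑ z, f z = ∑ z₁, ∑ z₂, f (Fin.append z₁ z₂) := by
  rw [← (Fin.appendEquiv p q).sum_comp, Fintype.sum_prod_type]
  rfl

theorem sum_chunk (D : Gadget S' G) (s : Fin G.arity → Fin n ⊕ Fin M) (x : Fin n → Bool)
    (z : Fin M → Bool) :
    ∑ z', evalProd (chunk hEQ D k s) (Sum.elim x (Fin.append z z')) =
      D.val k (Sum.elim x z ∘ s) := by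
  have e0 : ∀ (w : Fin (G.arity + D.b₀) → Bool) (p : Fin (k * D.b₁) → Bool),
      Sum.elim x (Fin.append z (Fin.append w p)) ∘ fixVar D k n M = w ∘ finSumFinEquiv := by
    intro w p
    funext v
    simp only [fixVar, Function.comp_apply, Sum.elim_inr]
    rw [Fin.append_right, Fin.append_left]
  have e1 : ∀ (w : Fin (G.arity + D.b₀) → Bool) (p : Fin (k * D.b₁) → Bool) (t : Fin k),
      Sum.elim x (Fin.append z (Fin.append w p)) ∘ repVar D k n M t =
        Sum.elim (w ∘ finSumFinEquiv) fun j => p (finProdFinEquiv (t, j)) := by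
    intro w p t
    funext v
    rcases v with v | v
    · exact congrFun (e0 w p) v
    · simp only [repVar, Function.comp_apply, Sum.elim_inr]
      rw [Fin.append_right, Fin.append_right]
  have e2 : ∀ (z' : Fin (D.size k) → Bool),
      Sum.elim x (Fin.append z z') ∘ oldVar n M _ = Sum.elim x z := by
    intro z'
    funext v
    rcases v with v | v
    · rfl
    · simp only [oldVar, Function.comp_apply, Sum.map_inr, Sum.elim_inr]
      rw [Fin.append_left]
  have e3 : ∀ (w : Fin (G.arity + D.b₀) → Bool) (p : Fin (k * D.b₁) → Bool),
      evalProd (chunk hEQ D k s) (Sum.elim x (Fin.append z (Fin.append w p))) =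
        evalProd D.L₀ (w ∘ finSumFinEquiv) * (∏ t, evalProd D.L₁
          (Sum.elim (w ∘ finSumFinEquiv) fun j => p (finProdFinEquiv (t, j)))) *
        if (fun i => w (finSumFinEquiv (.inl i))) = Sum.elim x z ∘ s then 1 else 0 := by
    intro w p
    rw [chunk, evalProd_append, evalProd_append, evalProd_map, evalProd_flatMap]
    congr 1
    · congr 1
      · exact congrArg _ (e0 w p)
      · rw [← List.ofFn_eq_map, List.prod_ofFn]
        refine Finset.prod_congr rfl fun t _ => ?_
        rw [evalProd_map]
        exact congrArg _ (e1 w p t)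
    · rw [evalProd, List.map_ofFn, List.prod_ofFn]
      have e4 : ∀ i, ((fun φ => φ.eval (Sum.elim x (Fin.append z (Fin.append w p)))) ∘
          fun i => eqAtom hEQ (fixVar D k n M (.inl i)) (oldVar n M _ (s i))) i =
          if w (finSumFinEquiv (.inl i)) = Sum.elim x z (s i) then (1 : ℝ≥0) else 0 := by
        intro i
        have h1 := congrFun (e0 w p) (.inl i)
        have h2 := congrFun (e2 (Fin.append w p)) (s i)
        simp only [Function.comp_apply] at h1 h2
        simp only [Function.comp_apply, eval_eqAtom]
        rw [← h2, ← h1]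
      simp only [e4]
      rw [Finset.prod_ite_zero]
      simp [funext_iff]
  refine (sum_append (p := G.arity + D.b₀) (q := k * D.b₁) _).trans ?_
  simp only [e3]
  rw [← ((finSumFinEquiv (m := G.arity) (n := D.b₀)).arrowCongr (Equiv.refl Bool)).sum_comp,
    sum_sum_arrow]
  have e5 : ∀ (u : Fin G.arity → Bool) (y : Fin D.b₀ → Bool),
      (finSumFinEquiv.arrowCongr (Equiv.refl Bool)) (Sum.elim u y) ∘ finSumFinEquiv =
        Sum.elim u y := by
    intro u y; funext v; simp
  have e6 : ∀ (u : Fin G.arity → Bool) (y : Fin D.b₀ → Bool) (i : Fin G.arity),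
      (finSumFinEquiv.arrowCongr (Equiv.refl Bool)) (Sum.elim u y) (finSumFinEquiv (.inl i)) =
        u i := by
    intro u y i; simp
  simp only [e5, e6]
  simp only [mul_ite, mul_one, mul_zero]
  rw [Finset.sum_eq_single (Sum.elim x z ∘ s)]
  · rw [Gadget.val]
    refine Finset.sum_congr rfl fun y _ => ?_
    simp only [if_true]
    rw [← Finset.mul_sum]
    congr 1
    rw [Fintype.sum_pow]
    refine Fintype.sum_equiv ((finProdFinEquiv.symm.arrowCongr (Equiv.refl Bool)).trans
      (Equiv.curry _ _ _)) _ _ fun p => ?_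
    rfl
  · intro u _ hu
    refine Finset.sum_eq_zero fun y _ => Finset.sum_eq_zero fun p _ => ?_
    rw [if_neg hu]
  · simp

/-! ### The substitution on words -/

/-- A letter of a template: a symbol, or the index of a variable as a number of ticks that is only
known when the template is used. -/
inductive Tok (S' : Set BFun) : Type
  /-- a symbol that is copied -/
  | sym (s : Sym S') : Tok S'
  /-- ticks for the number of bound variables before the current gadget -/
  | base : Tok S'
  /-- ticks for the current number of bound variables -/
  | top : Tok S'

/-- The word that a letter of a template stands for. -/
def Tok.expand (p M : ℕ) : Tok S' → List (Sym S')
  | .sym s => [s]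
  | .base => List.replicate p Sym.tick
  | .top => List.replicate M Sym.tick

/-- The template of a fixed variable of a gadget. -/
def fixTok (D : Gadget S' G) (v : Fin G.arity ⊕ Fin D.b₀) : List (Tok S') :=
  .sym .bound :: .base :: List.replicate (finSumFinEquiv v) (.sym .tick)

/-- The template of a variable in the repeated part of a gadget. -/
def repTok (D : Gadget S' G) : (Fin G.arity ⊕ Fin D.b₀) ⊕ Fin D.b₁ → List (Tok S')
  | .inl v => fixTok D v
  | .inr j => .sym .bound :: .top :: List.replicate j (.sym .tick)

/-- The template of a list of atomic formulas. -/
def template {V : Type} (f : V → List (Tok S')) (L : List (Atom S' V)) : List (Tok S') :=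
  L.flatMap fun φ => .sym (.fn φ.fn) :: (List.ofFn φ.scope).flatMap f

theorem flatMap_encodeAtom {V : Type} {N p t : ℕ} (f : V → List (Tok S'))
    (r : V → Fin n ⊕ Fin N) (h : ∀ v, (f v).flatMap (Tok.expand p t) = encodeVar (r v))
    (L : List (Atom S' V)) :
    (L.map (Atom.map r)).flatMap encodeAtom = (template f L).flatMap (Tok.expand p t) := by
  rw [template, List.flatMap_map, List.flatMap_assoc]
  congr 1
  funext φ
  rw [List.flatMap_cons]
  change Sym.fn φ.fn :: (List.ofFn (r ∘ φ.scope)).flatMap encodeVar = Sym.fn φ.fn :: _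
  rw [List.flatMap_assoc, ← List.map_ofFn, List.flatMap_map]
  simp only [h]
  rfl

/-- The part of a chunk that is written when the function symbol is read. -/
def headWord (D : Gadget S' G) (k M : ℕ) : List (Sym S') :=
  (template (fixTok D) D.L₀).flatMap (Tok.expand M M) ++
    (List.range k).flatMap fun t => (template (repTok D) D.L₁).flatMap
      (Tok.expand M (M + (G.arity + D.b₀) + t * D.b₁))

/-- The word for an equality with a copied argument, up to its second argument. -/
def eqWord (p : ℕ) : List (Sym S') := .fn ⟨EQ, hEQ⟩ :: .bound :: List.replicate p Sym.tick

theorem chunk_word (D : Gadget S' G) (s : Fin G.arity → Fin n ⊕ Fin M) :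
    (chunk hEQ D k s).flatMap encodeAtom = headWord D k M ++
      (List.finRange G.arity).flatMap fun i : Fin G.arity => eqWord hEQ (M + i) ++ encodeVar (s i) := by
  rw [chunk, List.flatMap_append, List.flatMap_append, headWord]
  have h0 : ∀ t v, (fixTok D v).flatMap (Tok.expand M t) = encodeVar (fixVar D k n M v) := by
    intro t v
    simp only [fixTok, fixVar, encodeVar, List.flatMap_cons, Tok.expand, Fin.val_natAdd,
      Fin.val_castAdd, List.replicate_add]
    generalize ((finSumFinEquiv v : Fin _) : ℕ) = j
    simp only [List.cons_append, List.nil_append]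
    congr 2
    induction j with
    | zero => rfl
    | succ j ih => simp [List.replicate_succ, ih, Tok.expand]
  have h1 : ∀ t v, (repTok D v).flatMap (Tok.expand M (M + (G.arity + D.b₀) + (t : Fin k) * D.b₁))
      = encodeVar (repVar D k n M t v) := by
    rintro t (v | j)
    · exact h0 _ v
    · have e : (Fin.natAdd M (Fin.natAdd (G.arity + D.b₀) (finProdFinEquiv (t, j))) : ℕ) =
          (M + (G.arity + D.b₀) + t * D.b₁) + j := by
        simp [finProdFinEquiv]; ring
      change _ = Sym.bound :: List.replicate
        (Fin.natAdd M (Fin.natAdd (G.arity + D.b₀) (finProdFinEquiv (t, j))) : ℕ) Sym.tick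
      rw [e, List.replicate_add]
      simp only [repTok, List.flatMap_cons, Tok.expand, List.cons_append, List.nil_append]
      generalize (j : ℕ) = j
      congr 2
      induction j with
      | zero => rfl
      | succ j ih => simp [List.replicate_succ, ih, Tok.expand]
  congr 1
  · congr 1
    · exact flatMap_encodeAtom _ _ (h0 M) _
    · rw [List.flatMap_assoc, ← List.map_coe_finRange_eq_range, List.flatMap_map]
      congr 1
      funext t
      exact flatMap_encodeAtom _ _ (h1 t) _
  · rw [List.ofFn_eq_map, List.flatMap_map]
    congr 1
    funext (i : Fin G.arity)
    have h2 : encodeVar (oldVar n M (D.size k) (s i)) = encodeVar (A := S') (s i) := by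
      rcases s i with v | v <;> rfl
    have h3 : encodeVar (A := S') (fixVar D k n M (.inl i)) =
        .bound :: List.replicate (M + i) Sym.tick := by
      simp [fixVar, encodeVar]
    change Sym.fn _ :: (List.ofFn ![_, _]).flatMap encodeVar = _
    simp [List.ofFn_succ, h2, h3, eqWord]
    rfl

/-! ### Substitution as a transduction of words -/

/-- How the position of the next copied argument and the number of bound variables change when a
symbol is read. -/
def advance (st : ℕ × ℕ) : Sym S → ℕ × ℕ
  | .sum => (st.1, st.2 + 1)
  | .fn G => (st.2, st.2 + (D G).size k)
  | .free => (st.1 + 1, st.2)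
  | .bound => (st.1 + 1, st.2)
  | .tick => st

/-- The word that is written when a symbol is read. -/
def emit (st : ℕ × ℕ) : Sym S → List (Sym S')
  | .sum => []
  | .fn G => headWord (D G) k st.2
  | .free => eqWord hEQ st.1 ++ [.free]
  | .bound => eqWord hEQ st.1 ++ [.bound]
  | .tick => [.tick]

/-- The word that is written when a word is read. -/
def transduce : ℕ × ℕ → List (Sym S) → List (Sym S')
  | _, [] => []
  | st, s :: w => emit D hEQ k st s ++ transduce (advance D k st s) w

theorem transduce_append (st : ℕ × ℕ) (w w' : List (Sym S)) :
    transduce D hEQ k st (w ++ w') =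
      transduce D hEQ k st w ++ transduce D hEQ k (w.foldl (advance D k) st) w' := by
  induction w generalizing st with
  | nil => rfl
  | cons s w ih => simp [transduce, ih]

theorem transduce_sum (m : ℕ) (p M : ℕ) :
    transduce D hEQ k (p, M) (List.replicate m .sum) = [] ∧
      (List.replicate m (.sum : Sym S)).foldl (advance D k) (p, M) = (p, M + m) := by
  induction m generalizing M with
  | zero => exact ⟨rfl, rfl⟩
  | succ m ih =>
    rw [List.replicate_succ]
    refine ⟨(ih _).1, (ih _).2.trans ?_⟩
    simp; ring

theorem transduce_tick (m : ℕ) (st : ℕ × ℕ) :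
    transduce D hEQ k st (List.replicate m .tick) = List.replicate m .tick ∧
      (List.replicate m (.tick : Sym S)).foldl (advance D k) st = st := by
  induction m with
  | zero => exact ⟨rfl, rfl⟩
  | succ m ih =>
    rw [List.replicate_succ, List.replicate_succ]
    exact ⟨congrArg _ ih.1, ih.2⟩

theorem transduce_var {m : ℕ} (p N : ℕ) (v : Fin n ⊕ Fin m) :
    transduce D hEQ k (p, N) (encodeVar v) = eqWord hEQ p ++ encodeVar v ∧
      (encodeVar v).foldl (advance D k) (p, N) = (p + 1, N) := by
  rcases v with v | v
  · have h := transduce_tick D hEQ k v (p + 1, N)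
    refine ⟨?_, h.2⟩
    simp only [encodeVar, transduce, emit, advance, h.1]
    simp
  · have h := transduce_tick D hEQ k v (p + 1, N)
    refine ⟨?_, h.2⟩
    simp only [encodeVar, transduce, emit, advance, h.1]
    simp

theorem transduce_vars {m : ℕ} (a p N : ℕ) (s : Fin a → Fin n ⊕ Fin m) :
    transduce D hEQ k (p, N) ((List.ofFn s).flatMap encodeVar) =
        ((List.finRange a).flatMap fun i : Fin a => eqWord hEQ (p + i) ++ encodeVar (s i)) ∧
      ((List.ofFn s).flatMap encodeVar).foldl (advance D k) (p, N) = (p + a, N) := by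
  induction a generalizing p with
  | zero => simp [transduce]
  | succ a ih =>
    have h := ih (p + 1) fun i => s i.succ
    have h' := transduce_var D hEQ k p N (s 0)
    rw [List.ofFn_succ, List.flatMap_cons, transduce_append, List.foldl_append, h'.1, h'.2, h.1,
      h.2, List.finRange_succ, List.flatMap_cons, List.flatMap_map]
    refine ⟨?_, by ring_nf⟩
    congr 1
    simp only [Fin.val_succ]
    congr 1
    funext i
    rw [show p + 1 + (i : ℕ) = p + (i + 1) by ring]

theorem transduce_atom {m : ℕ} (p N : ℕ) (φ : Atom S (Fin n ⊕ Fin m)) :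
    transduce D hEQ k (p, N) (encodeAtom φ) = headWord (D φ.fn) k N ++
      ((List.finRange φ.fn.1.arity).flatMap fun i : Fin φ.fn.1.arity =>
        eqWord hEQ (N + i) ++ encodeVar (φ.scope i)) ∧
      (encodeAtom φ).foldl (advance D k) (p, N) =
        (N + φ.fn.1.arity, N + (D φ.fn).size k) := by
  have h := transduce_vars D hEQ k _ N (N + (D φ.fn).size k) φ.scope
  exact ⟨congrArg _ h.1, h.2⟩

theorem exists_subst_atoms {m : ℕ} (l : List (Atom S (Fin n ⊕ Fin m))) :
    ∃ (p M : ℕ) (L : List (Atom S' (Fin n ⊕ Fin M))) (hM : m ≤ M),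
      (l.flatMap encodeAtom).foldl (advance D k) (0, m) = (p, M) ∧
      L.flatMap encodeAtom = transduce D hEQ k (0, m) (l.flatMap encodeAtom) ∧
      ∀ (Φ : (Fin m → Bool) → ℝ≥0) (x : Fin n → Bool),
        ∑ z, Φ (z ∘ Fin.castLE hM) * evalProd L (Sum.elim x z) =
          ∑ y, Φ y * (l.map fun φ => (D φ.fn).val k (Sum.elim x y ∘ φ.scope)).prod := by
  induction l using List.reverseRecOn with
  | nil => exact ⟨0, m, [], le_rfl, rfl, rfl, fun Φ x => by simp⟩
  | append_singleton l φ ih =>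
    obtain ⟨p, M, L, hM, h1, h2, h3⟩ := ih
    have h4 := transduce_atom D hEQ k p M φ
    let r : Fin n ⊕ Fin m → Fin n ⊕ Fin M := Sum.map id (Fin.castLE hM)
    refine ⟨M + φ.fn.1.arity, M + (D φ.fn).size k,
      L.map (Atom.map (oldVar n M _)) ++ chunk hEQ (D φ.fn) k (r ∘ φ.scope), by omega, ?_, ?_, ?_⟩
    · rw [List.flatMap_append, List.foldl_append, h1, List.flatMap_singleton, h4.2]
    · rw [List.flatMap_append, List.flatMap_append, transduce_append, h1, List.flatMap_singleton,
        h4.1, ← h2, chunk_word]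
      congr 1
      · rw [List.flatMap_map]
        congr 1
        funext χ
        change Sym.fn χ.fn :: (List.ofFn (oldVar n M _ ∘ χ.scope)).flatMap encodeVar =
          Sym.fn χ.fn :: _
        rw [← List.map_ofFn, List.flatMap_map]
        congr 2
        funext v
        rcases v with v | v <;> rfl
      · congr 2
        funext i
        congr 1
        rcases h : φ.scope i with v | v <;> simp [r, h, encodeVar]
    · intro Φ x
      rw [sum_append]
      have h5 := h3 (fun y => Φ y * (D φ.fn).val k (Sum.elim x y ∘ φ.scope)) x
      have e1 : ∀ (z : Fin M → Bool) (z' : Fin ((D φ.fn).size k) → Bool)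
          (h : m ≤ M + (D φ.fn).size k),
          Fin.append z z' ∘ Fin.castLE h = z ∘ Fin.castLE hM := by
        intro z z' h
        funext i
        have : Fin.castLE h i = Fin.castAdd _ (Fin.castLE hM i) := rfl
        rw [Function.comp_apply, this, Fin.append_left]
        rfl
      have e2 : ∀ (z : Fin M → Bool) (z' : Fin ((D φ.fn).size k) → Bool),
          Sum.elim x (Fin.append z z') ∘ oldVar n M _ = Sum.elim x z := by
        intro z z'
        funext v
        rcases v with v | v
        · rfl
        · exact Fin.append_left z z' v
      have e3 : ∀ z : Fin M → Bool, Sum.elim x z ∘ r ∘ φ.scope =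
          Sum.elim x (z ∘ Fin.castLE hM) ∘ φ.scope := by
        intro z
        funext i
        simp only [Function.comp_apply, r]
        rcases φ.scope i with v | v <;> rfl
      simp only [e1, evalProd_append, evalProd_map, e2, ← mul_assoc, ← Finset.mul_sum, sum_chunk,
        e3]
      simp only [List.map_append, List.prod_append, List.map_cons, List.map_nil, List.prod_singleton]
      refine Eq.trans (Finset.sum_congr rfl fun z _ => ?_) (h5.trans
        (Finset.sum_congr rfl fun y _ => ?_)) <;> ring

/-- Substitution, as an operation on words and on functions. -/
theorem exists_subst (ψ : PPSFormula S n) : ∃ ψ' : PPSFormula S' n,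
    encodeFormula ψ' =
      List.replicate ((encodeFormula ψ).foldl (advance D k) (0, 0)).2 .sum ++
        transduce D hEQ k (0, 0) (encodeFormula ψ) ∧
    ∀ x, ψ'.eval x =
      ∑ y, (ψ.atoms.map fun φ => (D φ.fn).val k (Sum.elim x y ∘ φ.scope)).prod := by
  obtain ⟨p, M, L, hM, h1, h2, h3⟩ := exists_subst_atoms D hEQ k ψ.atoms
  have h4 := transduce_sum D hEQ k ψ.bound 0 0
  rw [zero_add] at h4
  refine ⟨⟨M, L⟩, ?_, fun x => ?_⟩
  · simp only [encodeFormula]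
    rw [transduce_append, List.foldl_append, h4.1, h4.2, h1, ← h2, List.nil_append]
  · simpa [PPSFormula.eval, evalProd] using h3 (fun _ => 1) x

end Subst

/-! ### The error of a substitution -/

theorem abs_prod_sub_prod_le {ι : Type} (l : List ι) (a b : ι → ℝ) {C δ : ℝ} (hC : 1 ≤ C)
    (ha : ∀ i, |a i| ≤ C) (hb : ∀ i, |b i| ≤ C) (hab : ∀ i, |a i - b i| ≤ δ) :
    |(l.map a).prod - (l.map b).prod| ≤ l.length * C ^ l.length * δ := by
  have hprod : ∀ l : List ι, |(l.map b).prod| ≤ C ^ l.length := by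
    intro l
    induction l with
    | nil => simp
    | cons i l ih =>
      rw [List.map_cons, List.prod_cons, abs_mul, List.length_cons, pow_succ']
      exact mul_le_mul (hb i) ih (abs_nonneg _) (by linarith)
  induction l with
  | nil => simp
  | cons i l ih =>
    have hδ : 0 ≤ δ := (abs_nonneg _).trans (hab i)
    rw [List.map_cons, List.prod_cons, List.map_cons, List.prod_cons, List.length_cons]
    set P := (l.map a).prod
    set Q := (l.map b).prod
    have e : a i * P - b i * Q = a i * (P - Q) + (a i - b i) * Q := by ring
    rw [e]
    refine (abs_add_le _ _).trans ?_
    rw [abs_mul, abs_mul]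
    have h1 : |a i| * |P - Q| ≤ C * (l.length * C ^ l.length * δ) :=
      mul_le_mul (ha i) ih (abs_nonneg _) (by linarith)
    have h2 : |a i - b i| * |Q| ≤ δ * C ^ (l.length + 1) :=
      mul_le_mul (hab i) ((hprod l).trans (pow_le_pow_right₀ hC (Nat.le_succ _)))
        (abs_nonneg _) hδ
    push_cast
    calc |a i| * |P - Q| + |a i - b i| * |Q|
        ≤ C * (l.length * C ^ l.length * δ) + δ * C ^ (l.length + 1) := add_le_add h1 h2
      _ = _ := by ring

theorem length_le_encodeFormula {S : Set BFun} {n : ℕ} (ψ : PPSFormula S n) :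
    ψ.bound + ψ.atoms.length ≤ (encodeFormula ψ).length := by
  rw [encodeFormula, List.length_append, List.length_replicate]
  gcongr
  induction ψ.atoms with
  | nil => simp
  | cons φ l ih =>
    rw [List.flatMap_cons, List.length_append, List.length_cons]
    have : 1 ≤ (encodeAtom φ).length := by simp [encodeAtom]
    omega

theorem subst_error {S S' : Set BFun} {D : ∀ G : S, Gadget S' G.1} {k n : ℕ} {C δ : ℝ}
    (hC : 1 ≤ C) (hδ0 : 0 ≤ δ) (hS : ∀ G : S, ∀ x, (G.1.val x : ℝ) + 1 ≤ C)
    (hδ1 : δ ≤ 1)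
    (hD : ∀ G : S, ∀ x, |((D G).val k x : ℝ) - G.1.val x| ≤ δ) (ψ : PPSFormula S n)
    (x : Fin n → Bool) :
    |((∑ y, (ψ.atoms.map fun φ => (D φ.fn).val k (Sum.elim x y ∘ φ.scope)).prod : ℝ≥0) : ℝ) -
      ψ.eval x| ≤ (2 * C) ^ (encodeFormula ψ).length * δ := by
  have h1 : ∀ y : Fin ψ.bound → Bool,
      |(((ψ.atoms.map fun φ => (D φ.fn).val k (Sum.elim x y ∘ φ.scope)).prod : ℝ≥0) : ℝ) -
        ((ψ.atoms.map fun φ => φ.eval (Sum.elim x y)).prod : ℝ≥0)| ≤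
        ψ.atoms.length * C ^ ψ.atoms.length * δ := by
    intro y
    have := abs_prod_sub_prod_le ψ.atoms
      (fun φ => ((D φ.fn).val k (Sum.elim x y ∘ φ.scope) : ℝ))
      (fun φ => (φ.eval (Sum.elim x y) : ℝ)) (C := C) (δ := δ) hC ?_ ?_ ?_
    · simpa [NNReal.coe_list_prod, Function.comp_def] using this
    · intro φ
      have h2 := hS φ.fn (Sum.elim x y ∘ φ.scope)
      have h3 := abs_le.1 (hD φ.fn (Sum.elim x y ∘ φ.scope))
      rw [abs_of_nonneg (NNReal.coe_nonneg _)]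
      linarith [h3.2]
    · intro φ
      have h2 := hS φ.fn (Sum.elim x y ∘ φ.scope)
      rw [abs_of_nonneg (NNReal.coe_nonneg _)]
      change (φ.fn.1.val _ : ℝ) ≤ C
      exact (le_add_of_nonneg_right zero_le_one).trans h2
    · intro φ
      exact hD φ.fn _
  rw [PPSFormula.eval, NNReal.coe_sum, NNReal.coe_sum, ← Finset.sum_sub_distrib]
  refine (Finset.abs_sum_le_sum_abs _ _).trans ((Finset.sum_le_sum fun y _ => h1 y).trans ?_)
  rw [Finset.sum_const, Finset.card_univ, Fintype.card_fun, Fintype.card_bool, Fintype.card_fin,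
    nsmul_eq_mul]
  have h4 : (ψ.atoms.length : ℝ) ≤ 2 ^ ψ.atoms.length := by
    exact_mod_cast Nat.lt_two_pow_self.le
  push_cast
  calc (2 : ℝ) ^ ψ.bound * (ψ.atoms.length * C ^ ψ.atoms.length * δ)
      ≤ (2 * C) ^ ψ.bound * (2 ^ ψ.atoms.length * C ^ ψ.atoms.length * δ) := by
        gcongr; linarith
    _ = (2 * C) ^ (ψ.bound + ψ.atoms.length) * δ := by rw [pow_add, mul_pow 2 C (List.length _)]; ring
    _ ≤ (2 * C) ^ (encodeFormula ψ).length * δ := by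
        gcongr
        · linarith
        · exact length_le_encodeFormula ψ

/-- If all functions in `A'` are approximable over `A`, then finitely many of them can be replaced
in formulas by gadgets over a finite subset of `A`. The number of repetitions is chosen so that the
error is at most `1 / 2 ^ (n + 1)`. -/
theorem exists_substitution {A A' : Set BFun} (hEQ : EQ ∈ A)
    (h : ∀ G ∈ A', Approx A (Fin G.arity) G.val) (S : Finset BFun) (hS : (S : Set BFun) ⊆ A') :
    ∃ S' : Finset BFun, (S' : Set BFun) ⊆ A ∧ ∃ (hEQ : EQ ∈ (S' : Set BFun))
      (D : ∀ G : (S : Set BFun), Gadget (S' : Set BFun) G.1),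
      ∀ (a : ℕ) (ψ : PPSFormula (S : Set BFun) a) (n : ℕ), ∃ ψ' : PPSFormula (S' : Set BFun) a,
        encodeFormula ψ' = List.replicate ((encodeFormula ψ).foldl
            (advance D ((encodeFormula ψ).length + n + 1)) (0, 0)).2 .sum ++
          transduce D hEQ ((encodeFormula ψ).length + n + 1) (0, 0) (encodeFormula ψ) ∧
        ∀ x, |(ψ'.eval x : ℝ) - ψ.eval x| ≤ 1 / 2 ^ (n + 1) := by
  obtain ⟨C, hC1, hC⟩ : ∃ C : ℝ, 1 ≤ C ∧ ∀ G : (S : Set BFun), ∀ x, (G.1.val x : ℝ) + 1 ≤ C := by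
    refine ⟨∑ G : (S : Set BFun), ∑ x, (G.1.val x : ℝ) + 1, ?_, fun G x => ?_⟩
    · have : (0 : ℝ) ≤ ∑ G : (S : Set BFun), ∑ x, (G.1.val x : ℝ) := by positivity
      linarith
    · have h1 : (G.1.val x : ℝ) ≤ ∑ x, (G.1.val x : ℝ) :=
        Finset.single_le_sum (f := fun x => (G.1.val x : ℝ)) (fun _ _ => by positivity)
          (Finset.mem_univ x)
      have h2 : ∑ x, (G.1.val x : ℝ) ≤ ∑ G : (S : Set BFun), ∑ x, (G.1.val x : ℝ) :=
        Finset.single_le_sum (f := fun G : (S : Set BFun) => ∑ x, (G.1.val x : ℝ))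
          (fun _ _ => by positivity) (Finset.mem_univ G)
      linarith
  have hq : 0 < (2 * C)⁻¹ := by positivity
  choose D₀ hD₀ using fun G : (S : Set BFun) => (h G.1 (hS G.2)).exists_gadget hq
  obtain ⟨S', hS', hEQ', D, hD⟩ := exists_finset_gadget hEQ D₀
  refine ⟨S', hS', hEQ', D, fun a ψ n => ?_⟩
  set w := (encodeFormula ψ).length with hw
  obtain ⟨ψ', h1, h2⟩ := exists_subst D hEQ' (w + n + 1) ψ
  refine ⟨ψ', h1, fun x => ?_⟩
  rw [h2]
  refine (subst_error hC1 (δ := (2 * C)⁻¹ ^ (w + n + 1)) (by positivity) hC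
    (pow_le_one₀ hq.le (inv_le_one_of_one_le₀ (by linarith)))
    (fun G y => by rw [hD]; exact hD₀ G _ (by omega) y) ψ x).trans ?_
  rw [← hw, add_assoc, pow_add, ← mul_assoc, ← mul_pow, mul_inv_cancel₀ (by positivity), one_pow,
    one_mul, one_div, inv_pow]
  gcongr
  linarith

/-- Limits of formulas over `A'` are limits of formulas over `A`, if the functions in `A'` are
approximable over `A`. -/
theorem PPSLimDefinable.subst {A A' : Set BFun} (hEQ : EQ ∈ A)
    (h : ∀ G ∈ A', Approx A (Fin G.arity) G.val) {F : BFun} (hF : PPSLimDefinable A' F) :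
    PPSLimDefinable A F := by
  obtain ⟨S, hS, hF⟩ := hF
  obtain ⟨S', hS', _, _, H⟩ := exists_substitution hEQ h S hS
  refine ⟨S', hS', fun ε hε => ?_⟩
  obtain ⟨ψ, hψ⟩ := hF (ε / 2) (by positivity)
  obtain ⟨n, hn⟩ := exists_pow_lt_of_lt_one (show 0 < ε / 2 by positivity)
    (show (1 / 2 : ℝ) < 1 by norm_num)
  obtain ⟨ψ', -, h'⟩ := H _ ψ n
  refine ⟨ψ', fun x => ?_⟩
  have h1 := h' x
  have h2 : (1 : ℝ) / 2 ^ (n + 1) ≤ (1 / 2) ^ n := by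
    rw [div_pow, one_pow]
    gcongr
    · norm_num
    · omega
  calc _ ≤ |(ψ'.eval x : ℝ) - ψ.eval x| + |(ψ.eval x : ℝ) - F.val x| := abs_sub_le _ _ _
    _ < ε / 2 + ε / 2 := by linarith [hψ x]
    _ = ε := by ring

/-! ### A machine for substitution -/

theorem loop_replicate_runs {K : Type} [DecidableEq K] {Γ : K → Type} {k : K} [Fintype (Γ k)]
    (a : Γ k) (f : Γ k → Frag Γ) (n T : ℕ) (S : ℕ → ∀ k, List (Γ k))
    (hS : ∀ i, S i k = List.replicate i a)
    (hF : ∀ i < n, (f a).Runs (Function.update (S (i + 1)) k (List.replicate i a)) (S i) T) :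
    (loop k f).Runs (S n) (S 0) (n * (T + 1) + 1) := by
  induction n with
  | zero => exact (loop_runs_nil _ _ (hS 0)).mono (by simp)
  | succ n ih =>
    refine (loop_runs_cons k f (by rw [hS]; rfl) (hF n n.lt_succ_self)
      (ih fun i hi => hF i (hi.trans n.lt_succ_self))).mono ?_
    ring_nf; omega

/-- The names of the stacks of the substitution machine. -/
inductive Sk
  | inp | arg | cnt | cnt' | wd | wd' | base | top | tmp | rev | out
  deriving DecidableEq

instance : Fintype Sk :=
  ⟨{.inp, .arg, .cnt, .cnt', .wd, .wd', .base, .top, .tmp, .rev, .out},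
    fun x => by cases x <;> decide⟩

section Machine

variable (S S' : Set BFun)

/-- The alphabets of the stacks: two unary numbers as lists of bits, counters, two stacks for the
given word, and two stacks for the output. -/
abbrev Syms : Sk → Type
  | .inp => Bool | .arg => Bool | .wd => Sym S | .wd' => Sym S | .rev => Sym S' | .out => Sym S'
  | .cnt => Unit | .cnt' => Unit | .base => Unit | .top => Unit | .tmp => Unit

instance [Finite S] : Finite (Sym S) := by
  refine Finite.of_surjective (α := S ⊕ Fin 4) (Sum.elim Sym.fn ![.sum, .free, .bound, .tick]) ?_
  rintro (_ | G | _ | _ | _)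
  · exact ⟨.inr 0, rfl⟩
  · exact ⟨.inl G, rfl⟩
  · exact ⟨.inr 1, rfl⟩
  · exact ⟨.inr 2, rfl⟩
  · exact ⟨.inr 3, rfl⟩

instance [Finite S] : Fintype (Sym S) := Fintype.ofFinite _

variable {S S'}

/-- The stacks with the given contents; counters are given by their values. -/
def Cs (inp arg : List Bool) (cnt cnt' : ℕ) (wd wd' : List (Sym S)) (base top tmp : ℕ)
    (rev out : List (Sym S')) : ∀ k, List (Syms S S' k)
  | .inp => inp | .arg => arg | .wd => wd | .wd' => wd' | .rev => rev | .out => out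
  | .cnt => List.replicate cnt () | .cnt' => List.replicate cnt' ()
  | .base => List.replicate base () | .top => List.replicate top ()
  | .tmp => List.replicate tmp ()

section Updates

variable (inp arg : List Bool) (cnt cnt' : ℕ) (wd wd' : List (Sym S)) (base top tmp : ℕ)
    (rev out : List (Sym S'))

@[simp] theorem Cs_inp (x : List Bool) :
    Function.update (Cs inp arg cnt cnt' wd wd' base top tmp rev out) .inp x =
      Cs x arg cnt cnt' wd wd' base top tmp rev out := by
  funext k; cases k <;> simp [Cs]

@[simp] theorem Cs_arg (x : List Bool) :
    Function.update (Cs inp arg cnt cnt' wd wd' base top tmp rev out) .arg x =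
      Cs inp x cnt cnt' wd wd' base top tmp rev out := by
  funext k; cases k <;> simp [Cs]

@[simp] theorem Cs_cnt (x : List Unit) :
    Function.update (Cs inp arg cnt cnt' wd wd' base top tmp rev out) .cnt x =
      Cs inp arg x.length cnt' wd wd' base top tmp rev out := by
  funext k; cases k <;> simp [Cs, List.eq_replicate_iff]

@[simp] theorem Cs_cnt' (x : List Unit) :
    Function.update (Cs inp arg cnt cnt' wd wd' base top tmp rev out) .cnt' x =
      Cs inp arg cnt x.length wd wd' base top tmp rev out := by
  funext k; cases k <;> simp [Cs, List.eq_replicate_iff]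

@[simp] theorem Cs_wd (x : List (Sym S)) :
    Function.update (Cs inp arg cnt cnt' wd wd' base top tmp rev out) .wd x =
      Cs inp arg cnt cnt' x wd' base top tmp rev out := by
  funext k; cases k <;> simp [Cs]

@[simp] theorem Cs_wd' (x : List (Sym S)) :
    Function.update (Cs inp arg cnt cnt' wd wd' base top tmp rev out) .wd' x =
      Cs inp arg cnt cnt' wd x base top tmp rev out := by
  funext k; cases k <;> simp [Cs]

@[simp] theorem Cs_base (x : List Unit) :
    Function.update (Cs inp arg cnt cnt' wd wd' base top tmp rev out) .base x =
      Cs inp arg cnt cnt' wd wd' x.length top tmp rev out := by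
  funext k; cases k <;> simp [Cs, List.eq_replicate_iff]

@[simp] theorem Cs_top (x : List Unit) :
    Function.update (Cs inp arg cnt cnt' wd wd' base top tmp rev out) .top x =
      Cs inp arg cnt cnt' wd wd' base x.length tmp rev out := by
  funext k; cases k <;> simp [Cs, List.eq_replicate_iff]

@[simp] theorem Cs_tmp (x : List Unit) :
    Function.update (Cs inp arg cnt cnt' wd wd' base top tmp rev out) .tmp x =
      Cs inp arg cnt cnt' wd wd' base top x.length rev out := by
  funext k; cases k <;> simp [Cs, List.eq_replicate_iff]

@[simp] theorem Cs_rev (x : List (Sym S')) :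
    Function.update (Cs inp arg cnt cnt' wd wd' base top tmp rev out) .rev x =
      Cs inp arg cnt cnt' wd wd' base top tmp x out := by
  funext k; cases k <;> simp [Cs]

@[simp] theorem Cs_out (x : List (Sym S')) :
    Function.update (Cs inp arg cnt cnt' wd wd' base top tmp rev out) .out x =
      Cs inp arg cnt cnt' wd wd' base top tmp rev x := by
  funext k; cases k <;> simp [Cs]

end Updates

/-- The program that writes as many ticks as the counter `base` says. -/
def baseF : Frag (Syms S S') :=
  (loop (Γ := Syms S S') .base fun _ => pushF (Γ := Syms S S') .tmp ()).seq <|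
    loop (Γ := Syms S S') .tmp fun _ =>
      (pushF (Γ := Syms S S') .base ()).seq (pushF (Γ := Syms S S') .rev .tick)

/-- The program that writes as many ticks as the counter `top` says. -/
def topF : Frag (Syms S S') :=
  (loop (Γ := Syms S S') .top fun _ => pushF (Γ := Syms S S') .tmp ()).seq <|
    loop (Γ := Syms S S') .tmp fun _ =>
      (pushF (Γ := Syms S S') .top ()).seq (pushF (Γ := Syms S S') .rev .tick)

variable (inp arg : List Bool) (cnt cnt' : ℕ) (wd wd' : List (Sym S)) (base top : ℕ)
    (rev out : List (Sym S'))

theorem baseF_runs :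
    baseF.Runs (Cs inp arg cnt cnt' wd wd' base top 0 rev out)
      (Cs inp arg cnt cnt' wd wd' base top 0 (List.replicate base .tick ++ rev) out)
      (5 * base + 2) := by
  have h1 := loop_replicate_runs (Γ := Syms S S') (k := .base) ()
    (fun _ => pushF (Γ := Syms S S') .tmp ()) base 1
    (fun i => Cs inp arg cnt cnt' wd wd' i top (base - i) rev out) (fun i => rfl) (fun i hi => by
      refine (pushF_runs (Γ := Syms S S') .tmp () _).congr ?_ le_rfl
      rw [Cs_base, Cs_tmp]
      congr 1
      · simp
      · simp [Cs]; omega)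
  have h2 := loop_replicate_runs (Γ := Syms S S') (k := .tmp) ()
    (fun _ => (pushF (Γ := Syms S S') .base ()).seq (pushF (Γ := Syms S S') .rev .tick)) base 2
    (fun i => Cs inp arg cnt cnt' wd wd' (base - i) top i
      (List.replicate (base - i) .tick ++ rev) out) (fun i => rfl) (fun i hi => by
      refine ((pushF_runs (Γ := Syms S S') .base () _).seq
        (pushF_runs (Γ := Syms S S') .rev .tick _)).congr ?_ le_rfl
      rw [Cs_tmp, Cs_base, Cs_rev]
      congr 1
      · simp [Cs]; omega
      · simp
      · rw [show base - i = base - (i + 1) + 1 by omega, List.replicate_succ]; rfl)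
  simp only [Nat.sub_self, Nat.sub_zero, List.replicate_zero, List.nil_append] at h1 h2
  exact (h1.seq h2).mono (by omega)

theorem topF_runs :
    topF.Runs (Cs inp arg cnt cnt' wd wd' base top 0 rev out)
      (Cs inp arg cnt cnt' wd wd' base top 0 (List.replicate top .tick ++ rev) out)
      (5 * top + 2) := by
  have h1 := loop_replicate_runs (Γ := Syms S S') (k := .top) ()
    (fun _ => pushF (Γ := Syms S S') .tmp ()) top 1
    (fun i => Cs inp arg cnt cnt' wd wd' base i (top - i) rev out) (fun i => rfl) (fun i hi => by
      refine (pushF_runs (Γ := Syms S S') .tmp () _).congr ?_ le_rfl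
      rw [Cs_top, Cs_tmp]
      congr 1
      · simp
      · simp [Cs]; omega)
  have h2 := loop_replicate_runs (Γ := Syms S S') (k := .tmp) ()
    (fun _ => (pushF (Γ := Syms S S') .top ()).seq (pushF (Γ := Syms S S') .rev .tick)) top 2
    (fun i => Cs inp arg cnt cnt' wd wd' base (top - i) i
      (List.replicate (top - i) .tick ++ rev) out) (fun i => rfl) (fun i hi => by
      refine ((pushF_runs (Γ := Syms S S') .top () _).seq
        (pushF_runs (Γ := Syms S S') .rev .tick _)).congr ?_ le_rfl
      rw [Cs_tmp, Cs_top, Cs_rev]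
      congr 1
      · simp [Cs]; omega
      · simp
      · rw [show top - i = top - (i + 1) + 1 by omega, List.replicate_succ]; rfl)
  simp only [Nat.sub_self, Nat.sub_zero, List.replicate_zero, List.nil_append] at h1 h2
  exact (h1.seq h2).mono (by omega)

/-- The program that writes a template. -/
def writeF : List (Tok S') → Frag (Syms S S')
  | [] => skip
  | .sym s :: l => (pushF (Γ := Syms S S') .rev s).seq (writeF l)
  | .base :: l => baseF.seq (writeF l)
  | .top :: l => topF.seq (writeF l)

theorem writeF_runs {β : ℕ} (hb : base ≤ β) (ht : top ≤ β) (l : List (Tok S')) :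
    (writeF l).Runs (Cs inp arg cnt cnt' wd wd' base top 0 rev out)
      (Cs inp arg cnt cnt' wd wd' base top 0 ((l.flatMap (Tok.expand base top)).reverse ++ rev) out)
      (l.length * (5 * β + 2) + 1) := by
  induction l generalizing rev with
  | nil => exact (skip_runs _).congr rfl (by simp)
  | cons x l ih =>
    have key : ∀ (f : Frag (Syms S S')) r t, f.Runs
        (Cs inp arg cnt cnt' wd wd' base top 0 rev out)
        (Cs inp arg cnt cnt' wd wd' base top 0 r out) t → t ≤ 5 * β + 2 →
        r = (x.expand base top).reverse ++ rev →
        (f.seq (writeF l)).Runs (Cs inp arg cnt cnt' wd wd' base top 0 rev out)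
          (Cs inp arg cnt cnt' wd wd' base top 0
            (((x :: l).flatMap (Tok.expand base top)).reverse ++ rev) out)
          ((x :: l).length * (5 * β + 2) + 1) := by
      rintro f r t hf htt rfl
      refine (hf.seq (ih _)).congr ?_ ?_
      · simp
      · rw [List.length_cons, Nat.add_one_mul l.length]; omega
    cases x with
    | sym s =>
      refine key _ _ _ ((pushF_runs (Γ := Syms S S') .rev s _).congr (Cs_rev ..) le_rfl)
        (by omega) ?_
      simp [Tok.expand, Cs]
    | base =>
      refine key _ _ _ (baseF_runs ..) (by omega) ?_
      simp [Tok.expand]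
    | top =>
      refine key _ _ _ (topF_runs ..) (by omega) ?_
      simp [Tok.expand]

/-! ### Processing one symbol -/

/-- The program for a function symbol. -/
def headF {G : BFun} (D : Gadget S' G) : Frag (Syms S S') :=
  (loop (Γ := Syms S S') .base fun _ => skip).seq <|
  (loop (Γ := Syms S S') .top fun _ => pushF (Γ := Syms S S') .tmp ()).seq <|
  (loop (Γ := Syms S S') .tmp fun _ =>
    (pushF (Γ := Syms S S') .top ()).seq (pushF (Γ := Syms S S') .base ())).seq <|
  (writeF (template (fixTok D) D.L₀)).seq <|
  (pushL (Γ := Syms S S') .top (List.replicate (G.arity + D.b₀) ())).seq <|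
  (loop (Γ := Syms S S') .cnt fun _ => (pushF (Γ := Syms S S') .cnt' ()).seq <|
    (writeF (template (repTok D) D.L₁)).seq <|
      pushL (Γ := Syms S S') .top (List.replicate D.b₁ ())).seq <|
  loop (Γ := Syms S S') .cnt' fun _ => pushF (Γ := Syms S S') .cnt ()

/-- The time for a function symbol, with `k` repetitions and at most `β` bound variables. -/
def headTime {G : BFun} (D : Gadget S' G) (k β : ℕ) : ℕ :=
  (β * 2 + 1) + ((β * 2 + 1) + ((β * 3 + 1) +
    (((template (fixTok D) D.L₀).length * (5 * β + 2) + 1) + ((G.arity + D.b₀ + 1) +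
      ((k * ((1 + (((template (repTok D) D.L₁).length * (5 * β + 2) + 1) + (D.b₁ + 1))) + 1) + 1) +
        (k * 2 + 1))))))

theorem headF_runs {G : BFun} (D : Gadget S' G) {β : ℕ} (hb : base ≤ β)
    (ht : top + D.size cnt ≤ β) :
    (headF D).Runs (Cs inp arg cnt 0 wd wd' base top 0 rev out)
      (Cs inp arg cnt 0 wd wd' top (top + D.size cnt) 0
        ((headWord D cnt top).reverse ++ rev) out) (headTime D cnt β) := by
  have h1 := loop_replicate_runs (Γ := Syms S S') (k := .base) () (fun _ => skip) base 1
    (fun i => Cs inp arg cnt 0 wd wd' i top 0 rev out) (fun i => rfl) (fun i hi => by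
      refine (skip_runs _).congr ?_ le_rfl
      rw [Cs_base, List.length_replicate])
  have h2 := loop_replicate_runs (Γ := Syms S S') (k := .top) ()
    (fun _ => pushF (Γ := Syms S S') .tmp ()) top 1
    (fun i => Cs inp arg cnt 0 wd wd' 0 i (top - i) rev out) (fun i => rfl) (fun i hi => by
      refine (pushF_runs (Γ := Syms S S') .tmp () _).congr ?_ le_rfl
      rw [Cs_top, Cs_tmp]
      congr 1
      · simp
      · simp [Cs]; omega)
  have h3 := loop_replicate_runs (Γ := Syms S S') (k := .tmp) ()
    (fun _ => (pushF (Γ := Syms S S') .top ()).seq (pushF (Γ := Syms S S') .base ())) top 2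
    (fun i => Cs inp arg cnt 0 wd wd' (top - i) (top - i) i rev out) (fun i => rfl)
    (fun i hi => by
      refine ((pushF_runs (Γ := Syms S S') .top () _).seq
        (pushF_runs (Γ := Syms S S') .base () _)).congr ?_ le_rfl
      rw [Cs_tmp, Cs_top, Cs_base]
      congr 1
      · simp [Cs]; omega
      · simp [Cs]; omega
      · simp)
  have h4 := writeF_runs inp arg cnt 0 wd wd' top top rev out (β := β) (by omega) (by omega)
    (template (fixTok D) D.L₀)
  set r₀ := ((template (fixTok D) D.L₀).flatMap (Tok.expand top top)).reverse ++ rev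
  have h5 := pushL_runs (Γ := Syms S S') .top (List.replicate (G.arity + D.b₀) ())
    (Cs inp arg cnt 0 wd wd' top top 0 r₀ out)
  set top' := top + (G.arity + D.b₀) with htop'
  let wordAt : ℕ → List (Sym S') := fun t => (template (repTok D) D.L₁).flatMap
    (Tok.expand top (top' + t * D.b₁))
  have h6 := loop_replicate_runs (Γ := Syms S S') (k := .cnt) ()
    (fun _ => (pushF (Γ := Syms S S') .cnt' ()).seq <|
    (writeF (template (repTok D) D.L₁)).seq <|
      pushL (Γ := Syms S S') .top (List.replicate D.b₁ ())) cnt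
    (1 + (((template (repTok D) D.L₁).length * (5 * β + 2) + 1) + (D.b₁ + 1)))
    (fun i => Cs inp arg i (cnt - i) wd wd' top (top' + (cnt - i) * D.b₁) 0
      (((List.range (cnt - i)).flatMap wordAt).reverse ++ r₀) out) (fun i => rfl)
    (fun i hi => by
      have hi2 : cnt - (i + 1) ≤ cnt := Nat.sub_le _ _
      have h8 := Nat.mul_le_mul_right D.b₁ hi2
      have e : cnt - i = cnt - (i + 1) + 1 := by omega
      refine ((pushF_runs (Γ := Syms S S') .cnt' () _).congr (S'' := Cs inp arg i (cnt - i) wd wd'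
        top (top' + (cnt - (i + 1)) * D.b₁) 0
        (((List.range (cnt - (i + 1))).flatMap wordAt).reverse ++ r₀) out) ?_ le_rfl).seq
        ((writeF_runs (β := β) _ _ _ _ _ _ _ _ _ _ ?_ ?_ _).seq
        ((pushL_runs (Γ := Syms S S') .top (List.replicate D.b₁ ()) _).congr ?_ ?_))
      · rw [Cs_cnt, Cs_cnt']
        congr 1
        · simp
        · simp [Cs]; omega
      · simp only [Gadget.size] at ht; omega
      · simp only [Gadget.size] at ht; omega
      · rw [Cs_top]
        congr 1
        · simp only [Cs, List.length_append, List.length_reverse, List.length_replicate]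
          rw [e, Nat.succ_mul]
          omega
        · rw [e, List.range_succ]
          simp [wordAt]
      · simp)
  have h7 := loop_replicate_runs (Γ := Syms S S') (k := .cnt') ()
    (fun _ => pushF (Γ := Syms S S') .cnt ()) cnt 1
    (fun i => Cs inp arg (cnt - i) i wd wd' top (top + D.size cnt) 0
      (((List.range cnt).flatMap wordAt).reverse ++ r₀) out)
    (fun i => rfl) (fun i hi => by
      refine (pushF_runs (Γ := Syms S S') .cnt () _).congr ?_ le_rfl
      rw [Cs_cnt', Cs_cnt]
      congr 1
      · simp [Cs]; omega
      · simp)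
  simp only [Nat.sub_self, Nat.sub_zero, List.range_zero, List.flatMap_nil, List.reverse_nil,
    List.nil_append, Nat.zero_mul, Nat.add_zero] at h2 h3 h6 h7
  have h5' := h5.congr (S'' := Cs inp arg cnt 0 wd wd' top top' 0 r₀ out) (by
    rw [Cs_top]; congr 1; simp [Cs, htop']; omega) le_rfl
  have h6' := h6.congr (S'' := Cs inp arg 0 cnt wd wd' top (top + D.size cnt) 0
      (((List.range cnt).flatMap wordAt).reverse ++ r₀) out) (by
    congr 1; simp only [Gadget.size, htop']; omega) le_rfl
  refine (h1.seq (h2.seq (h3.seq (h4.seq (h5'.seq (h6'.seq h7)))))).congr ?_ ?_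
  · simp [headWord, r₀, wordAt, htop']
  · have : top ≤ β := by omega
    simp only [headTime, List.length_replicate]
    gcongr
 
variable (D : ∀ G : S, Gadget S' G.1) (hEQ : EQ ∈ S')

/-- The program for one symbol. -/
def stepF : Sym S → Frag (Syms S S')
  | .sum => pushF (Γ := Syms S S') .top ()
  | .fn G => headF (D G)
  | .free => (writeF [.sym (.fn ⟨EQ, hEQ⟩), .sym .bound, .base, .sym .free]).seq
      (pushF (Γ := Syms S S') .base ())
  | .bound => (writeF [.sym (.fn ⟨EQ, hEQ⟩), .sym .bound, .base, .sym .bound]).seq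
      (pushF (Γ := Syms S S') .base ())
  | .tick => pushF (Γ := Syms S S') .rev .tick

/-- A bound for the number of new bound variables of an atomic formula with `k` repetitions. -/
def maxSize [Fintype S] (k : ℕ) : ℕ := ∑ G, (D G).size k

/-- A bound for the time for a symbol. -/
def stepTime [Fintype S] (k β : ℕ) : ℕ := ∑ G, headTime (D G) k β + (4 * (5 * β + 2) + 2)

theorem stepF_runs [Fintype S] {β : ℕ} (s : Sym S) (hb : base ≤ β)
    (ht : top + maxSize D cnt ≤ β) :
    (stepF D hEQ s).Runs (Cs inp arg cnt 0 wd wd' base top 0 rev out)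
      (Cs inp arg cnt 0 wd wd' (advance D cnt (base, top) s).1 (advance D cnt (base, top) s).2 0
        ((emit D hEQ cnt (base, top) s).reverse ++ rev) out) (stepTime D cnt β) := by
  have hkind : ∀ s' : Sym S', ((writeF (S := S) [.sym (.fn ⟨EQ, hEQ⟩), .sym .bound, .base,
      .sym s']).seq (pushF (Γ := Syms S S') .base ())).Runs
      (Cs inp arg cnt 0 wd wd' base top 0 rev out)
      (Cs inp arg cnt 0 wd wd' (base + 1) top 0
        ((eqWord hEQ base ++ [s']).reverse ++ rev) out) (stepTime D cnt β) := by
    intro s'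
    refine ((writeF_runs (β := β) inp arg cnt 0 wd wd' base top rev out hb (by omega) _).seq
      (pushF_runs (Γ := Syms S S') .base () _)).congr ?_ ?_
    · rw [Cs_base]
      congr 1
      · simp [Cs]
    · simp only [stepTime, List.length_cons, List.length_nil]; omega
  cases s with
  | sum =>
    refine (pushF_runs (Γ := Syms S S') .top () _).congr ?_ ?_
    · rw [Cs_top]
      congr 1
      · simp [Cs, advance]
    · simp only [stepTime]; omega
  | fn G =>
    have h1 : (D G).size cnt ≤ maxSize D cnt :=
      Finset.single_le_sum (f := fun G => (D G).size cnt) (fun _ _ => Nat.zero_le _)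
        (Finset.mem_univ G)
    have h2 : headTime (D G) cnt β ≤ ∑ G, headTime (D G) cnt β :=
      Finset.single_le_sum (f := fun G => headTime (D G) cnt β) (fun _ _ => Nat.zero_le _)
        (Finset.mem_univ G)
    exact (headF_runs inp arg cnt wd wd' base top rev out (D G) hb (by omega)).mono
      (h2.trans (Nat.le_add_right _ _))
  | free => exact hkind .free
  | bound => exact hkind .bound
  | tick =>
    refine (pushF_runs (Γ := Syms S S') .rev .tick _).congr ?_ ?_
    · rw [Cs_rev]; rfl
    · simp only [stepTime]; omega

theorem advance_le [Fintype S] {β k : ℕ} (st : ℕ × ℕ) (s : Sym S) (h1 : st.1 ≤ β)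
    (h2 : st.2 ≤ β) : (advance D k st s).1 ≤ β + (maxSize D k + 1) ∧
      (advance D k st s).2 ≤ β + (maxSize D k + 1) := by
  cases s with
  | fn G =>
    have h1 : (D G).size k ≤ maxSize D k :=
      Finset.single_le_sum (f := fun G => (D G).size k) (fun _ _ => Nat.zero_le _)
        (Finset.mem_univ G)
    simp only [advance]; omega
  | _ => simp only [advance]; omega

theorem loop_stepF_runs [Fintype S] (w : List (Sym S)) {β : ℕ}
    (hb : base + w.length * (maxSize D cnt + 1) ≤ β)
    (ht : top + w.length * (maxSize D cnt + 1) ≤ β) :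
    (loop (Γ := Syms S S') .wd' (stepF D hEQ)).Runs (Cs inp arg cnt 0 wd w base top 0 rev out)
      (Cs inp arg cnt 0 wd [] (w.foldl (advance D cnt) (base, top)).1
        (w.foldl (advance D cnt) (base, top)).2 0
        ((transduce D hEQ cnt (base, top) w).reverse ++ rev) out)
      (w.length * (stepTime D cnt β + 1) + 1) := by
  induction w generalizing base top rev with
  | nil => exact (loop_runs_nil (Γ := Syms S S') .wd' _ rfl).congr rfl (by simp)
  | cons s w ih =>
    rw [List.length_cons, Nat.add_one_mul] at hb ht
    obtain ⟨h1, h2⟩ := advance_le D (k := cnt) (β := max base top) (base, top) s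
      (le_max_left _ _) (le_max_right _ _)
    have h3 : max base top + (maxSize D cnt + 1) + w.length * (maxSize D cnt + 1) ≤ β := by omega
    have h4 := stepF_runs inp arg cnt wd w base top rev out D hEQ (β := β) s (by omega) (by omega)
    refine (loop_runs_cons (Γ := Syms S S') .wd' (stepF D hEQ) rfl
      (by rw [Cs_wd']; exact h4) (ih (base := (advance D cnt (base, top) s).1)
        (top := (advance D cnt (base, top) s).2) _ (by omega) (by omega))).congr ?_ ?_
    · simp [transduce]
    · rw [List.length_cons, Nat.add_one_mul]; omega

/-- The program after the given word has been read: it counts the symbols, substitutes, writes the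
word in the right order and clears the stacks. -/
def substF [Finite S] [Finite S'] : Frag (Syms S S') :=
  (loop (Γ := Syms S S') .wd fun s => (pushF (Γ := Syms S S') .wd' s).seq
    (pushF (Γ := Syms S S') .cnt ())).seq <|
  (loop (Γ := Syms S S') .wd' (stepF D hEQ)).seq <|
  (moveF (Γ := Syms S S') .rev .out (id : Sym S' → Sym S')).seq <|
  (loop (Γ := Syms S S') .top fun _ => pushF (Γ := Syms S S') .out .sum).seq <|
  (loop (Γ := Syms S S') .cnt fun _ => skip).seq <|
  loop (Γ := Syms S S') .base fun _ => skip

theorem foldl_advance_le [Fintype S] (k : ℕ) (w : List (Sym S)) (st : ℕ × ℕ) {β : ℕ}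
    (h1 : st.1 ≤ β) (h2 : st.2 ≤ β) :
    (w.foldl (advance D k) st).1 ≤ β + w.length * (maxSize D k + 1) ∧
      (w.foldl (advance D k) st).2 ≤ β + w.length * (maxSize D k + 1) := by
  induction w generalizing st β with
  | nil => simpa using ⟨h1, h2⟩
  | cons s w ih =>
    obtain ⟨h3, h4⟩ := advance_le D (k := k) st s h1 h2
    have := ih _ h3 h4
    rw [List.foldl_cons, List.length_cons, Nat.add_one_mul]
    omega

theorem loop_wd_runs [Finite S] (n : ℕ) (u v : List (Sym S)) :
    (loop (Γ := Syms S S') .wd fun s => (pushF (Γ := Syms S S') .wd' s).seq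
      (pushF (Γ := Syms S S') .cnt ())).Runs (Cs [] [] n 0 u v 0 0 0 [] [])
      (Cs [] [] (u.length + n) 0 [] (u.reverse ++ v) 0 0 0 [] []) (u.length * 3 + 1) := by
  induction u generalizing n v with
  | nil => exact (loop_runs_nil (Γ := Syms S S') .wd _ rfl).congr (by simp) (by simp)
  | cons s u ih =>
    refine (loop_runs_cons (Γ := Syms S S') .wd _ rfl ((pushF_runs (Γ := Syms S S') .wd' s _).seq
      (pushF_runs (Γ := Syms S S') .cnt () _)) ((congrArg (fun z => Frag.Runs _ z _ _) ?_).mpr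
        (ih (n + 1) (s :: v)))).congr ?_ ?_
    · rw [Cs_wd, Cs_wd', Cs_cnt]
      congr 1
      simp [Cs]
    · congr 1
      · simp; omega
      · simp
    · simp; omega

theorem substF_runs [Fintype S] [Finite S'] (w : List (Sym S)) {k β L : ℕ} (hk : w.length + cnt = k)
    (hβ : w.length * (maxSize D k + 1) ≤ β) (hL : (transduce D hEQ k (0, 0) w).length ≤ L) :
    (substF D hEQ).Runs (Cs [] [] cnt 0 w.reverse [] 0 0 0 [] [])
      (Cs [] [] 0 0 [] [] 0 0 0 [] (List.replicate (w.foldl (advance D k) (0, 0)).2 .sum ++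
        transduce D hEQ k (0, 0) w))
      ((w.length * 3 + 1) + ((w.length * (stepTime D k β + 1) + 1) + ((L * 2 + 1) + ((β * 2 + 1) +
        ((k * 2 + 1) + (β * 2 + 1)))))) := by
  have h1 := loop_wd_runs (S' := S') cnt w.reverse []
  rw [List.length_reverse, List.reverse_reverse, List.append_nil, hk] at h1
  have h2 := loop_stepF_runs [] [] k [] 0 0 [] [] D hEQ w (β := β) (by omega) (by omega)
  obtain ⟨h3, h4⟩ := foldl_advance_le D k w (0, 0) (β := 0) le_rfl le_rfl
  set p := (w.foldl (advance D k) (0, 0)).1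
  set m := (w.foldl (advance D k) (0, 0)).2
  set o := transduce D hEQ k (0, 0) w
  have h5 := moveF_runs (Γ := Syms S S') (k := .rev) (k' := .out) (id : Sym S' → Sym S') (by simp)
    (Cs [] [] k 0 [] [] p m 0 (o.reverse ++ []) [])
  rw [Cs_rev, Cs_out] at h5
  have h5' := h5.congr (S'' := Cs [] [] k 0 [] [] p m 0 [] o) (t' := L * 2 + 1)
    (by congr 1; simp [Cs]) (by simpa [Cs] using hL)
  have h6 := loop_replicate_runs (Γ := Syms S S') (k := .top) ()
    (fun _ => pushF (Γ := Syms S S') .out .sum) m 1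
    (fun i => Cs [] [] k 0 [] [] p i 0 [] (List.replicate (m - i) .sum ++ o)) (fun i => rfl)
    (fun i hi => by
      refine (pushF_runs (Γ := Syms S S') .out .sum _).congr ?_ le_rfl
      rw [Cs_top, Cs_out]
      congr 1
      · simp
      · rw [show m - i = m - (i + 1) + 1 by omega, List.replicate_succ]; rfl)
  have h7 := loop_replicate_runs (Γ := Syms S S') (k := .cnt) () (fun _ => skip) k 1
    (fun i => Cs [] [] i 0 [] [] p 0 0 [] (List.replicate m .sum ++ o)) (fun i => rfl)
    (fun i hi => by
      refine (skip_runs _).congr ?_ le_rfl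
      rw [Cs_cnt, List.length_replicate])
  have h8 := loop_replicate_runs (Γ := Syms S S') (k := .base) () (fun _ => skip) p 1
    (fun i => Cs [] [] 0 0 [] [] i 0 0 [] (List.replicate m .sum ++ o)) (fun i => rfl)
    (fun i hi => by
      refine (skip_runs _).congr ?_ le_rfl
      rw [Cs_base, List.length_replicate])
  simp only [Nat.sub_self, Nat.sub_zero, List.replicate_zero, List.nil_append] at h6
  refine (h1.seq (h2.seq (h5'.seq (h6.seq (h7.seq h8))))).mono ?_
  gcongr <;> omega

/-! ### Polynomial bounds -/

/-- The sequences that are bounded by a polynomial. -/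
def PolyBdd (f : ℕ → ℕ) : Prop := ∃ p : Polynomial ℕ, ∀ n, f n ≤ p.eval n

namespace PolyBdd

variable {f g : ℕ → ℕ}

theorem const (c : ℕ) : PolyBdd fun _ => c := ⟨Polynomial.C c, fun n => by simp⟩

theorem id : PolyBdd fun n => n := ⟨Polynomial.X, fun n => by simp⟩

theorem add (hf : PolyBdd f) (hg : PolyBdd g) : PolyBdd fun n => f n + g n := by
  obtain ⟨p, hp⟩ := hf
  obtain ⟨q, hq⟩ := hg
  exact ⟨p + q, fun n => by simpa using add_le_add (hp n) (hq n)⟩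

theorem mul (hf : PolyBdd f) (hg : PolyBdd g) : PolyBdd fun n => f n * g n := by
  obtain ⟨p, hp⟩ := hf
  obtain ⟨q, hq⟩ := hg
  exact ⟨p * q, fun n => by simpa using Nat.mul_le_mul (hp n) (hq n)⟩

theorem mono (hg : PolyBdd g) (h : ∀ n, f n ≤ g n) : PolyBdd f :=
  let ⟨p, hp⟩ := hg
  ⟨p, fun n => (h n).trans (hp n)⟩

theorem sum {ι : Type} (s : Finset ι) {f : ι → ℕ → ℕ} (h : ∀ i ∈ s, PolyBdd (f i)) :
    PolyBdd fun n => ∑ i ∈ s, f i n := by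
  classical
  induction s using Finset.induction_on with
  | empty => simpa using const 0
  | insert i s hi ih =>
    simp only [Finset.sum_insert hi]
    exact (h i (by simp)).add (ih fun j hj => h j (by simp [hj]))

theorem eval_succ (p : Polynomial ℕ) : PolyBdd fun n => p.eval (n + 1) :=
  ⟨p.comp (Polynomial.X + 1), fun n => by simp⟩

end PolyBdd

theorem polyBdd_headTime {G : BFun} (D : Gadget S' G) {k β : ℕ → ℕ} (hk : PolyBdd k)
    (hβ : PolyBdd β) : PolyBdd fun n => headTime D (k n) (β n) := by
  have c := PolyBdd.const
  have h5 : PolyBdd fun n => 5 * β n + 2 := ((c 5).mul hβ).add (c 2)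
  exact ((hβ.mul (c 2)).add (c 1)).add <| ((hβ.mul (c 2)).add (c 1)).add <|
    ((hβ.mul (c 3)).add (c 1)).add <| (((c _).mul h5).add (c 1)).add <| (c _).add <|
    ((hk.mul (((c 1).add ((((c _).mul h5).add (c 1)).add (c _))).add (c 1))).add (c 1)).add <|
    (hk.mul (c 2)).add (c 1)

theorem polyBdd_stepTime [Fintype S] {k β : ℕ → ℕ} (hk : PolyBdd k) (hβ : PolyBdd β) :
    PolyBdd fun n => stepTime D (k n) (β n) :=
  (PolyBdd.sum _ fun G _ => polyBdd_headTime (D G) hk hβ).add <|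
    ((PolyBdd.const 4).mul (((PolyBdd.const 5).mul hβ).add (PolyBdd.const 2))).add
      (PolyBdd.const 2)

theorem polyBdd_maxSize [Fintype S] {k : ℕ → ℕ} (hk : PolyBdd k) :
    PolyBdd fun n => maxSize D (k n) :=
  PolyBdd.sum _ fun _ _ => (PolyBdd.const _).add (hk.mul (PolyBdd.const _))

/-- The length of the output of the transduction is bounded by the running time of the loop that
writes it. -/
theorem exists_transduce_length_le [Fintype S] : ∃ C : ℕ, ∀ (k β : ℕ) (w : List (Sym S)),
    w.length * (maxSize D k + 1) ≤ β →
      (transduce D hEQ k (0, 0) w).length ≤ C * (w.length * (stepTime D k β + 1) + 1) := by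
  obtain ⟨C, hC⟩ := (loop (Γ := Syms S S') .wd' (stepF D hEQ)).exists_length_le
  refine ⟨C, fun k β w h => ?_⟩
  have := hC _ _ _ (loop_stepF_runs [] [] k [] 0 0 [] [] D hEQ w (β := β) (by omega) (by omega))
    .rev
  simpa [Cs] using this

end Machine

/-! ### Efficient substitution -/

/-- If the function `EQ` is available, substitution of gadgets in the formulas that a
polynomial-time machine computes can be done in polynomial time. -/
theorem computable_subst {S S' : Set BFun} [Fintype S] [Finite S']
    (D : ∀ G : S, Gadget S' G.1) (hEQ : EQ ∈ S') {a : ℕ} {ψ : ℕ → PPSFormula S a}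
    {ψ' : ℕ → PPSFormula S' a}
    (hψ : Nonempty (TM2ComputableInPolyTime unaryEncodeNat encodeFormula ψ))
    (h : ∀ n, encodeFormula (ψ' n) = List.replicate ((encodeFormula (ψ (n + 1))).foldl
        (advance D ((encodeFormula (ψ (n + 1))).length + (n + 1))) (0, 0)).2 .sum ++
      transduce D hEQ ((encodeFormula (ψ (n + 1))).length + (n + 1)) (0, 0)
        (encodeFormula (ψ (n + 1)))) :
    Nonempty (TM2ComputableInPolyTime unaryEncodeNat encodeFormula ψ') := by
  obtain ⟨c⟩ := hψ
  obtain ⟨P, hP⟩ := output_length_le c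
  have := c.tm.kFin
  let F : Frag (Sum.elim c.tm.Γ (Syms S S')) :=
    (Frag.inr ((pushF (Γ := Syms S S') .arg true).seq <| (pushF (Γ := Syms S S') .cnt ()).seq <|
      (loop (Γ := Syms S S') .inp fun _ => (pushF (Γ := Syms S S') .arg true).seq
        (pushF (Γ := Syms S S') .cnt ())))).seq <|
    (callF c (Γ := Syms S S') .arg .wd (id : Bool → Bool) (id : Sym S → Sym S)).seq <|
    (substF D hEQ).inr
  -- the quantities that enter the running time
  let w : ℕ → List (Sym S) := fun n => encodeFormula (ψ (n + 1))
  let k : ℕ → ℕ := fun n => (w n).length + (n + 1)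
  let β : ℕ → ℕ := fun n => (w n).length * (maxSize D (k n) + 1)
  have hc := PolyBdd.const
  have hw : PolyBdd fun n => (w n).length := (PolyBdd.eval_succ P).mono fun n => by
    simpa [unaryEncodeNat_eq] using hP (n + 1)
  have hk : PolyBdd k := hw.add (PolyBdd.id.add (hc 1))
  have hβ : PolyBdd β := hw.mul ((polyBdd_maxSize D hk).add (hc 1))
  obtain ⟨C, hC⟩ := exists_transduce_length_le D hEQ
  have hst : PolyBdd fun n => (w n).length * (stepTime D (k n) (β n) + 1) + 1 :=
    (hw.mul ((polyBdd_stepTime D hk hβ).add (hc 1))).add (hc 1)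
  let L : ℕ → ℕ := fun n => C * ((w n).length * (stepTime D (k n) (β n) + 1) + 1)
  have hL : PolyBdd L := (hc C).mul hst
  have htime : PolyBdd fun n => (1 + (1 + (n * 3 + 1))) +
      (((n + 1) * 2 + 1 + (c.time.eval (n + 1) + ((w n).length * 2 + 1))) +
      (((w n).length * 3 + 1) + (((w n).length * (stepTime D (k n) (β n) + 1) + 1) +
        ((L n * 2 + 1) + ((β n * 2 + 1) + ((k n * 2 + 1) + (β n * 2 + 1))))))) :=
    ((hc 1).add ((hc 1).add ((PolyBdd.id.mul (hc 3)).add (hc 1)))).add <|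
    ((((PolyBdd.id.add (hc 1)).mul (hc 2)).add (hc 1)).add
      ((PolyBdd.eval_succ _).add ((hw.mul (hc 2)).add (hc 1)))).add <|
    ((hw.mul (hc 3)).add (hc 1)).add <| hst.add <| ((hL.mul (hc 2)).add (hc 1)).add <|
    ((hβ.mul (hc 2)).add (hc 1)).add <| ((hk.mul (hc 2)).add (hc 1)).add
      ((hβ.mul (hc 2)).add (hc 1))
  obtain ⟨p, hp⟩ := htime
  have : Fintype (Sum.elim c.tm.Γ (Syms S S') (.inr .inp)) := inferInstanceAs (Fintype Bool)
  refine computable_of_runs F (.inr .inp) (.inr .out) (Equiv.refl Bool) (Equiv.refl (Sym S')) p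
    fun n => ?_
  have e1 : single (Γ := Sum.elim c.tm.Γ (Syms S S')) (.inr .inp)
      ((unaryEncodeNat n).map (Equiv.refl Bool).symm) = joinS (fun _ => [])
        (Cs (List.replicate n true) [] 0 0 [] [] 0 0 0 [] []) := by
    refine (single_inr (Γ₁ := c.tm.Γ) (Γ₂ := Syms S S') .inp _).trans (congrArg _ ?_)
    funext j
    cases j <;> simp [single, Cs, unaryEncodeNat_eq]
  have e2 : single (Γ := Sum.elim c.tm.Γ (Syms S S')) (.inr .out)
      ((encodeFormula (ψ' n)).map (Equiv.refl (Sym S')).symm) = joinS (fun _ => [])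
        (Cs [] [] 0 0 [] [] 0 0 0 [] (encodeFormula (ψ' n))) := by
    refine (single_inr (Γ₁ := c.tm.Γ) (Γ₂ := Syms S S') .out _).trans (congrArg _ ?_)
    funext j
    cases j <;> simp [single, Cs]
  refine (congrArg₂ (fun a b => F.Runs a b _) e1 e2).mpr ?_
  rw [h n, unaryEncodeNat_eq, List.length_replicate]
  have h1 := pushF_runs (Γ := Syms S S') .arg true
    (Cs (List.replicate n true) [] 0 0 [] [] 0 0 0 [] [])
  rw [Cs_arg] at h1
  have h2 := pushF_runs (Γ := Syms S S') .cnt ()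
    (Cs (List.replicate n true) [true] 0 0 [] [] 0 0 0 [] [])
  rw [Cs_cnt] at h2
  have h3 := loop_replicate_runs (Γ := Syms S S') (k := .inp) true
    (fun _ => (pushF (Γ := Syms S S') .arg true).seq (pushF (Γ := Syms S S') .cnt ())) n 2
    (fun i => Cs (List.replicate i true) (List.replicate (n - i + 1) true) (n - i + 1) 0 [] []
      0 0 0 [] []) (fun i => rfl) (fun i hi => by
      refine ((pushF_runs (Γ := Syms S S') .arg true _).seq
        (pushF_runs (Γ := Syms S S') .cnt () _)).congr ?_ le_rfl
      rw [Cs_inp, Cs_arg, Cs_cnt]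
      congr 1
      · rw [show n - i = n - (i + 1) + 1 by omega]; rfl
      · simp [Cs]; omega)
  rw [Nat.sub_self, Nat.sub_zero, List.replicate_zero] at h3
  have h4 := callF_runs' c (Γ := Syms S S') (X := .arg) (Y := .wd) (id : Bool → Bool)
    (id : Sym S → Sym S) (R := Cs [] (List.replicate (n + 1) true) (n + 1) 0 [] [] 0 0 0 [] [])
    (R₁ := Cs [] [] (n + 1) 0 [] [] 0 0 0 [] [])
    (R₂ := Cs [] [] (n + 1) 0 (w n).reverse [] 0 0 0 [] []) (n + 1)
    (by simp [Cs, unaryEncodeNat_eq]) (Cs_arg ..)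
    ((Cs_wd ..).trans (by congr 1; simp [Cs, w]))
  have h5 := substF_runs (n + 1) D hEQ (w n) (k := k n) (β := β n) (L := L n) rfl le_rfl
    (hC _ _ _ le_rfl)
  rw [unaryEncodeNat_eq, List.length_replicate] at h4
  exact ((((h1.seq (h2.seq h3)).inr _).seq (h4.seq (h5.inr _)))).mono (hp n)

/-- The efficient version of `PPSLimDefinable.subst`. -/
theorem PPSLimEffDefinable.subst {A A' : Set BFun} (hEQ : EQ ∈ A)
    (h : ∀ G ∈ A', Approx A (Fin G.arity) G.val) {F : BFun} (hF : PPSLimEffDefinable A' F) :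
    PPSLimEffDefinable A F := by
  obtain ⟨S, hS, ψ, hc, hF⟩ := hF
  obtain ⟨S', hS', hEQ', D, H⟩ := exists_substitution hEQ h S hS
  choose ψ' h1 h2 using fun n => H _ (ψ (n + 1)) n
  refine ⟨S', hS', ψ', computable_subst D hEQ' hc h1, fun n x => ?_⟩
  have h3 := h2 n x
  have h4 := hF (n + 1) x
  have e : (1 : ℝ) / 2 ^ n = 1 / 2 ^ (n + 1) + 1 / 2 ^ (n + 1) := by rw [pow_succ]; ring
  rw [e]
  exact (abs_sub_le _ _ _).trans_lt (add_lt_add_of_le_of_lt h3 h4)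

/-- A constant sequence of formulas is computable. -/
theorem computable_const {S : Set BFun} {a : ℕ} (ψ : PPSFormula S a) :
    Nonempty (TM2ComputableInPolyTime unaryEncodeNat encodeFormula fun _ : ℕ => ψ) := by
  refine computable_of_runs (Γ := Syms S S) ((loop (Γ := Syms S S) .inp fun _ => skip).seq
    (pushL (Γ := Syms S S) .out (encodeFormula ψ).reverse)) .inp .out (Equiv.refl Bool)
    (Equiv.refl (Sym S)) (Polynomial.C 2 * Polynomial.X +
      Polynomial.C ((encodeFormula ψ).length + 2)) fun n => ?_
  have e1 : single (Γ := Syms S S) .inp ((unaryEncodeNat n).map (Equiv.refl Bool).symm) =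
      Cs (List.replicate n true) [] 0 0 [] [] 0 0 0 [] [] := by
    funext j
    cases j <;> simp [single, Cs, unaryEncodeNat_eq]
  have e2 : single (Γ := Syms S S) .out ((encodeFormula ψ).map (Equiv.refl (Sym S)).symm) =
      Cs [] [] 0 0 [] [] 0 0 0 [] (encodeFormula ψ) := by
    funext j
    cases j <;> simp [single, Cs]
  have h1 := loop_replicate_runs (Γ := Syms S S) (k := .inp) true (fun _ => skip) n 1
    (fun i => Cs (List.replicate i true) [] 0 0 [] [] 0 0 0 [] []) (fun i => rfl)
    (fun i hi => by
      refine (skip_runs _).congr ?_ le_rfl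
      rw [Cs_inp])
  have h2 := pushL_runs (Γ := Syms S S) .out (encodeFormula ψ).reverse
    (Cs [] [] 0 0 [] [] 0 0 0 [] [])
  rw [Cs_out] at h2
  refine (congrArg₂ (fun a b => Frag.Runs _ a b _) e1 e2).mpr
    ((h1.seq h2).congr (by congr 1; simp [Cs]) ?_)
  simp [unaryEncodeNat_eq]
  omega

/-- The formula `F(x₁, …, x_a)`. -/
def atomFormula {A : Set BFun} (G : A) : PPSFormula A G.1.arity :=
  ⟨0, [⟨G, fun i => .inl i⟩]⟩

theorem eval_atomFormula {A : Set BFun} (G : A) (x : Fin G.1.arity → Bool) :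
    (atomFormula G).eval x = G.1.val x := by
  change ∑ y : Fin 0 → Bool, _ = _
  simp [atomFormula, Atom.eval]

theorem Approx.limEffDefinable {A : Set BFun} (hEQ : EQ ∈ A) {F : BFun}
    (h : Approx A (Fin F.arity) F.val) : PPSLimEffDefinable A F := by
  refine PPSLimEffDefinable.subst (A' := {F}) hEQ (by rintro _ rfl; exact h) ⟨{F}, by simp, ?_⟩
  refine ⟨fun _ => atomFormula (A := (({F} : Finset BFun) : Set BFun)) ⟨F, by simp⟩,
    computable_const _, fun n x => ?_⟩
  rw [eval_atomFormula]
  simp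

theorem PPSLimEffDefinable.limDefinable {A : Set BFun} {F : BFun} (h : PPSLimEffDefinable A F) :
    PPSLimDefinable A F := by
  obtain ⟨S, hS, ψ, -, h⟩ := h
  refine ⟨S, hS, fun ε hε => ?_⟩
  obtain ⟨n, hn⟩ := exists_pow_lt_of_lt_one hε (show (1 / 2 : ℝ) < 1 by norm_num)
  refine ⟨ψ n, fun x => (h n x).trans ?_⟩
  rwa [div_pow, one_pow] at hn

/-! ### Classes of values -/

/-- The properties of a set of values that the argument uses. -/
structure IsValueClass (V : ℝ≥0 → Prop) : Prop where
  zero : V 0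
  one : V 1
  add : ∀ {r s}, V r → V s → V (r + s)
  inv : ∀ {r}, V r → V r⁻¹

theorem isValueClass_polyTimeReal : IsValueClass PolyTimeReal :=
  ⟨PolyTimeReal.zero, PolyTimeReal.one, PolyTimeReal.add, PolyTimeReal.inv⟩

theorem isValueClass_true : IsValueClass fun _ => True :=
  ⟨trivial, trivial, fun _ _ => trivial, fun _ => trivial⟩

/-- The functions with values in a class. -/
def funsOf (V : ℝ≥0 → Prop) : Set BFun := {F | ∀ x, V (F.val x)}

namespace IsValueClass

variable {V : ℝ≥0 → Prop}

theorem natCast_mul (hV : IsValueClass V) (n : ℕ) {r : ℝ≥0} (hr : V r) : V (n * r) := by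
  induction n with
  | zero => simpa using hV.zero
  | succ n ih => rw [Nat.cast_succ, add_mul, one_mul]; exact hV.add ih hr

theorem natCast (hV : IsValueClass V) (n : ℕ) : V n := by simpa using hV.natCast_mul n hV.one

theorem sum (hV : IsValueClass V) {ι : Type} (s : Finset ι) {f : ι → ℝ≥0} (h : ∀ i, V (f i)) :
    V (∑ i ∈ s, f i) := by
  classical
  induction s using Finset.induction_on with
  | empty => simpa using hV.zero
  | insert i s hi ih => rw [Finset.sum_insert hi]; exact hV.add (h i) ih

end IsValueClass

/-- The unary function with the given values. -/
def un (u : Bool → ℝ≥0) : BFun := ⟨1, fun x => u (x 0)⟩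

theorem IsValueClass.un_mem {V : ℝ≥0 → Prop} {u : Bool → ℝ≥0} (h : ∀ b, V (u b)) :
    un u ∈ unary (funsOf V) := ⟨fun x => h (x (0 : Fin 1)), rfl⟩

/-! ### Formulas with unary functions and equalities -/

section Basic

variable {V : ℝ≥0 → Prop} {A : Set BFun} {W : Type}

/-- The assumption that a set of functions contains equality and the unary functions with values
in a class. -/
structure IsBase (V : ℝ≥0 → Prop) (A : Set BFun) : Prop where
  vals : IsValueClass V
  eq_mem : EQ ∈ A
  unary_subset : unary (funsOf V) ⊆ A

theorem IsBase.unary (hA : IsBase V A) {u : Bool → ℝ≥0} (h : ∀ b, V (u b)) (i : W) :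
    Pps A W fun x => u (x i) :=
  Pps.atom (hA.unary_subset (IsValueClass.un_mem h)) fun _ => i

theorem IsBase.eq (hA : IsBase V A) (i j : W) : Pps A W fun x => if x i = x j then 1 else 0 :=
  (Pps.atom hA.eq_mem ![i, j]).congr fun x => by simp [EQ]

theorem neq_pps (hA : NEQ ∈ A) (i j : W) : Pps A W fun x => if x i = x j then 0 else 1 :=
  (Pps.atom hA ![i, j]).congr fun x => by simp [NEQ]

/-- A constant, as the sum of the values of a unary function. -/
theorem IsBase.const (hA : IsBase V A) {c : ℝ≥0} (h : V c) : Pps A W fun _ => c := by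
  have h1 := hA.unary (u := fun b => if b then c else 0) (by
    rintro (_ | _) <;> simp [h, hA.vals.zero]) (Sum.inr () : W ⊕ Unit)
  refine h1.sum.congr fun x => ?_
  rw [← (Equiv.funUnique Unit Bool).symm.sum_comp]
  simp

end Basic

/-! ### Functions that are not products of unary functions, equalities and disequalities -/

/-- A binary function that is neither of rank one nor an equality or disequality with weights: its
determinant is not zero, and at most one of its values is zero. -/
def NonSimple (G : Bool → Bool → ℝ≥0) : Prop :=
  G false false * G true true ≠ G false true * G true false ∧
    (0 < G false false ∧ 0 < G true true ∧ (0 < G false true ∨ 0 < G true false) ∨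
      0 < G false true ∧ 0 < G true false ∧ (0 < G false false ∨ 0 < G true true))

section Marginal

variable {n : ℕ}

/-- The binary function that arises from `F` by summing, with weights, over all variables but
`i` and `j`. -/
def marginal (F : (Fin n → Bool) → ℝ≥0) (w : Fin n → Bool → ℕ) (i j : Fin n) (a b : Bool) :
    ℝ≥0 :=
  ∑ x, if x i = a ∧ x j = b then (∏ k, (w k (x k) : ℝ≥0)) * F x else 0

/-- `F` has a marginal that is not simple. -/
def HasNonSimple (F : (Fin n → Bool) → ℝ≥0) : Prop :=
  ∃ i j, i ≠ j ∧ ∃ w, NonSimple (marginal F w i j)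

theorem sum_cons {R : Type} [AddCommMonoid R] (f : (Fin (n + 1) → Bool) → R) :
    ∑ x, f x = ∑ b, ∑ x, f (Fin.cons b x) := by
  rw [← (Fin.consEquiv fun _ => Bool).sum_comp, Fintype.sum_prod_type]
  rfl

theorem HasNonSimple.of_cons {F : (Fin (n + 1) → Bool) → ℝ≥0} (c : Bool → ℕ)
    (h : HasNonSimple fun x => ∑ b, (c b : ℝ≥0) * F (Fin.cons b x)) : HasNonSimple F := by
  obtain ⟨i, j, hij, w, h⟩ := h
  refine ⟨i.succ, j.succ, fun h => hij (Fin.succ_injective _ h), Fin.cons c w, ?_⟩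
  convert h using 1
  funext a b
  rw [marginal, marginal, sum_cons, Finset.sum_comm]
  refine Finset.sum_congr rfl fun x _ => ?_
  simp only [Fin.cons_succ, Fin.prod_univ_succ, Fin.cons_zero]
  split_ifs
  · rw [Finset.mul_sum]
    refine Finset.sum_congr rfl fun d _ => ?_
    ring
  · simp

/-- The sum over the assignments with `x j = b`, with weights for the other variables. -/
def half (F : (Fin n → Bool) → ℝ≥0) (w : Fin n → Bool → ℕ) (j : Fin n) (b : Bool) : ℝ≥0 :=
  ∑ x, if x j = b then (∏ k, (Function.update w j 1 k (x k) : ℝ≥0)) * F x else 0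

theorem marginal_cons (F : (Fin (n + 1) → Bool) → ℝ≥0) (w : Fin n → Bool → ℕ) (j : Fin n)
    (a b : Bool) : marginal F (Fin.cons 1 (Function.update w j 1)) 0 j.succ a b =
      half (fun x => F (Fin.cons a x)) w j b := by
  rw [marginal, sum_cons, half, Finset.sum_comm]
  refine Finset.sum_congr rfl fun x _ => ?_
  rw [Finset.sum_eq_single a]
  · simp only [Fin.cons_succ, Fin.prod_univ_succ, Fin.cons_zero, true_and, Pi.one_apply,
      Nat.cast_one, one_mul]
  · intro d _ hd
    simp [hd]
  · simp

/-- The total weight. -/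
def total (F : (Fin n → Bool) → ℝ≥0) (w : Fin n → Bool → ℕ) : ℝ≥0 :=
  ∑ x, (∏ k, (w k (x k) : ℝ≥0)) * F x

theorem total_update (F : (Fin n → Bool) → ℝ≥0) (w : Fin n → Bool → ℕ) (j : Fin n)
    (u : Bool → ℕ) : total F (Function.update w j u) =
      u false * half F w j false + u true * half F w j true := by
  rw [total, half, half, Finset.mul_sum, Finset.mul_sum, ← Finset.sum_add_distrib]
  refine Finset.sum_congr rfl fun x _ => ?_
  have key : ∀ v : Bool → ℕ, (∏ k, (Function.update w j v k (x k) : ℝ≥0)) =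
      v (x j) * ∏ k ∈ Finset.univ.erase j, (w k (x k) : ℝ≥0) := by
    intro v
    rw [← Finset.mul_prod_erase _ _ (Finset.mem_univ j), Function.update_self]
    congr 1
    refine Finset.prod_congr rfl fun k hk => ?_
    rw [Function.update_of_ne (Finset.ne_of_mem_erase hk)]
  rw [key, key]
  cases x j <;> simp [mul_assoc]

theorem total_pos {F : (Fin n → Bool) → ℝ≥0} {w : Fin n → Bool → ℕ} (hw : ∀ k b, 0 < w k b)
    {x : Fin n → Bool} (hx : F x ≠ 0) : 0 < total F w := by
  refine lt_of_lt_of_le ?_ (Finset.single_le_sum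
    (f := fun x => (∏ k, (w k (x k) : ℝ≥0)) * F x) (fun _ _ => zero_le) (Finset.mem_univ x))
  exact mul_pos (Finset.prod_pos fun k _ => by exact_mod_cast hw k _) (pos_iff_ne_zero.2 hx)

theorem half_eq_zero {F : (Fin n → Bool) → ℝ≥0} {w : Fin n → Bool → ℕ} (hw : ∀ k b, 0 < w k b)
    {j : Fin n} {b : Bool} (h : half F w j b = 0) {x : Fin n → Bool} (hx : x j = b) : F x = 0 := by
  have h1 := (Finset.sum_eq_zero_iff.1 h) x (Finset.mem_univ x)
  rw [if_pos hx] at h1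
  refine (mul_eq_zero.1 h1).resolve_left (Finset.prod_pos fun k _ => ?_).ne'
  by_cases hk : k = j
  · subst hk; simp
  · rw [Function.update_of_ne hk]; exact_mod_cast hw k _

/-- A function with vanishing weighted sums for all weights in `{1, 2}` vanishes, since the tensor
power of the matrix with rows `(2, 1)` and `(1, 2)` is invertible. -/
theorem eq_zero_of_weighted_sums {D : (Fin n → Bool) → ℝ}
    (h : ∀ w : Fin n → Bool → ℕ, (∀ k b, w k b = 1 ∨ w k b = 2) →
      ∑ x, (∏ k, (w k (x k) : ℝ)) * D x = 0) (y : Fin n → Bool) : D y = 0 := by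
  let m : Bool → Bool → ℕ := fun a b => if a = b then 2 else 1
  let m' : Bool → Bool → ℝ := fun a b => if a = b then 2 / 3 else -1 / 3
  have e1 : ∀ x : Fin n → Bool,
      ∑ z : Fin n → Bool, (∏ k, m' (y k) (z k)) * ∏ k, (m (z k) (x k) : ℝ) =
        if y = x then 1 else 0 := by
    intro x
    have e2 : ∀ a b : Bool, ∑ c : Bool, m' a c * (m c b : ℝ) = if a = b then 1 else 0 := by
      intro a b
      rcases a with _ | _ <;> rcases b with _ | _ <;> simp [m, m'] <;> norm_num
    simp only [← Finset.prod_mul_distrib]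
    have e3 := Finset.prod_univ_sum (fun _ : Fin n => (Finset.univ : Finset Bool))
      (fun k c => m' (y k) c * (m c (x k) : ℝ))
    rw [Fintype.piFinset_univ] at e3
    rw [← e3]
    simp only [e2, Finset.prod_ite_zero]
    simp [funext_iff]
  have e4 : D y = ∑ x, (if y = x then 1 else 0) * D x := by simp
  rw [e4]
  simp only [← e1, Finset.sum_mul]
  rw [Finset.sum_comm]
  refine Finset.sum_eq_zero fun z _ => ?_
  simp only [mul_assoc, ← Finset.mul_sum]
  have := h (fun k => m (z k)) fun k b => by
    by_cases hb : z k = b <;> simp [m, hb]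
  rw [this, mul_zero]

/-- Two functions that are not proportional have weighted sums, over the halves of the cube in some
direction, with nonvanishing determinant. -/
theorem exists_half_ne {F₀ F₁ : (Fin n → Bool) → ℝ≥0} {x y : Fin n → Bool}
    (hxy : F₀ x * F₁ y ≠ F₀ y * F₁ x) : ∃ (j : Fin n) (w : Fin n → Bool → ℕ),
      (∀ k b, 0 < w k b) ∧
      half F₀ w j false * half F₁ w j true ≠ half F₀ w j true * half F₁ w j false := by
  by_contra! hcon
  have hF₁ : ∃ z, F₁ z ≠ 0 := by
    by_contra! h0
    exact hxy (by simp [h0])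
  obtain ⟨z, hz⟩ := hF₁
  -- the ratio of the total weights does not depend on the weights
  have key : ∀ w : Fin n → Bool → ℕ, (∀ k b, 0 < w k b) → ∀ T : Finset (Fin n),
      total F₀ (fun k => if k ∈ T then w k else 1) * total F₁ (fun _ => 1) =
        total F₀ (fun _ => 1) * total F₁ (fun k => if k ∈ T then w k else 1) := by
    intro w hw T
    induction T using Finset.induction_on with
    | empty => simp
    | insert j T hj ih =>
      set v : Fin n → Bool → ℕ := fun k => if k ∈ T then w k else 1 with hv
      have hvpos : ∀ k b, 0 < v k b := by
        intro k b
        by_cases hk : k ∈ T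
        · simp [hv, hk, hw]
        · simp [hv, hk]
      have e1 : (fun k => if k ∈ insert j T then w k else 1) = Function.update v j (w j) := by
        funext k
        by_cases hk : k = j
        · subst hk; simp
        · simp [hv, hk]
      have e2 : v = Function.update v j 1 := by
        rw [Function.eq_update_iff]
        simp [hv, hj]
      have h1 := hcon j v hvpos
      rw [e1, total_update, total_update]
      have hpos : 0 < total F₁ v := total_pos hvpos hz
      rw [e2, total_update, total_update] at ih
      rw [e2, total_update] at hpos
      simp only [Pi.one_apply, Nat.cast_one, one_mul] at ih hpos
      rw [← NNReal.coe_inj] at h1 ih ⊢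
      rw [← NNReal.coe_pos] at hpos
      push_cast at h1 ih hpos ⊢
      refine mul_right_cancel₀ hpos.ne' ?_
      linear_combination (total F₁ fun _ => 1 : ℝ) * ((w j false : ℝ) - w j true) * h1 +
        (w j false * (half F₁ v j false : ℝ) + w j true * (half F₁ v j true : ℝ)) * ih
  have hT : (0 : ℝ) < total F₁ fun _ => 1 := by
    exact_mod_cast total_pos (w := fun _ => 1) (fun _ _ => one_pos) hz
  have hprop : ∀ u, (F₀ u : ℝ) * (total F₁ fun _ => 1) - (total F₀ fun _ => 1) * F₁ u = 0 := by
    refine eq_zero_of_weighted_sums (D := fun u =>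
      (F₀ u : ℝ) * (total F₁ fun _ => 1) - (total F₀ fun _ => 1) * F₁ u) fun w hw => ?_
    have h1 := key w (fun k b => by rcases hw k b with h | h <;> omega) Finset.univ
    simp only [Finset.mem_univ, if_true] at h1
    rw [← NNReal.coe_inj] at h1
    have e : ∀ F : (Fin n → Bool) → ℝ≥0, (total F w : ℝ) =
        ∑ x, (∏ k, (w k (x k) : ℝ)) * F x := by
      intro F; rw [total]; push_cast; rfl
    push_cast at h1
    rw [e, e, Finset.sum_mul, Finset.mul_sum] at h1
    rw [← sub_eq_zero, ← Finset.sum_sub_distrib] at h1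
    rw [← h1]
    refine Finset.sum_congr rfl fun u _ => ?_
    ring
  apply hxy
  rw [← NNReal.coe_inj]
  push_cast
  refine mul_right_cancel₀ hT.ne' ?_
  linear_combination (F₁ y : ℝ) * hprop x - F₁ x * hprop y

end Marginal

section Structure

variable {V : ℝ≥0 → Prop} {A : Set BFun} {n : ℕ}

theorem apply_cons (F : (Fin (n + 1) → Bool) → ℝ≥0) (x : Fin (n + 1) → Bool) :
    F x = F (Fin.cons (x 0) (x ∘ Fin.succ)) :=
  congrArg F (Fin.cons_self_tail x).symm

theorem NonSimple.of_ne {G : Bool → Bool → ℝ≥0} (h : ¬ NonSimple G)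
    (hd : G false false * G true true ≠ G false true * G true false) :
    (G false false = 0 ∧ G true true = 0) ∨ (G false true = 0 ∧ G true false = 0) := by
  by_contra! hcon
  refine h ⟨hd, ?_⟩
  simp only [pos_iff_ne_zero]
  by_cases h1 : G false false = 0 <;> by_cases h2 : G true true = 0 <;>
    by_cases h3 : G false true = 0 <;> by_cases h4 : G true false = 0 <;> simp_all

/-- A function all of whose weighted binary marginals are simple is a product of unary functions,
equalities and disequalities. The first variable is split off: the restrictions `F₀` and `F₁` for
its two values are proportional, or some other variable is determined by it. -/
theorem pps_of_not_hasNonSimple (hA : IsBase V A) (hneq : NEQ ∈ A) {F : (Fin n → Bool) → ℝ≥0}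
    (hF : ∀ x, V (F x)) (h : ¬ HasNonSimple F) : Pps A (Fin n) F := by
  induction n with
  | zero => exact (hA.const (hF default)).congr fun x => congrArg F (Subsingleton.elim _ _)
  | succ n ih =>
    have h0 : Pps A (Fin n) fun y => F (Fin.cons false y) := by
      refine ih (fun y => hF _) fun h' => h (HasNonSimple.of_cons (fun b => if b then 0 else 1) ?_)
      simpa using h'
    have h1 : Pps A (Fin n) fun y => F (Fin.cons true y) := by
      refine ih (fun y => hF _) fun h' => h (HasNonSimple.of_cons (fun b => if b then 1 else 0) ?_)
      simpa using h'
    have h01 : Pps A (Fin n) fun y => F (Fin.cons true y) + F (Fin.cons false y) := by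
      refine ih (fun y => hA.vals.add (hF _) (hF _)) fun h' =>
        h (HasNonSimple.of_cons (fun _ => 1) ?_)
      simpa using h'
    by_cases hz : ∀ y, F (Fin.cons true y) = 0
    · refine ((hA.unary (u := fun b => if b then 0 else 1) (by
        rintro (_ | _) <;> simp [hA.vals.zero, hA.vals.one]) 0).mul (h0.rename Fin.succ)).congr
        fun x => ?_
      rw [apply_cons F x]
      cases x 0 <;> simp [hz]
    push Not at hz
    obtain ⟨z, hz⟩ := hz
    by_cases hp : ∀ y, F (Fin.cons false y) * F (Fin.cons true z) =
        F (Fin.cons false z) * F (Fin.cons true y)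
    · refine ((hA.unary (u := fun b => F (Fin.cons b z)) (fun b => hF _) 0).mul
        ((hA.const (hA.vals.inv (hF (Fin.cons true z)))).mul (h1.rename Fin.succ))).congr
        fun x => ?_
      rw [apply_cons F x]
      cases x 0
      · rw [← mul_assoc, mul_right_comm, ← hp, mul_assoc, mul_inv_cancel₀ hz, mul_one]
      · rw [← mul_assoc, mul_inv_cancel₀ hz, one_mul]
    push Not at hp
    obtain ⟨y, hy⟩ := hp
    obtain ⟨j, w, hw, hjw⟩ := exists_half_ne
      (F₀ := fun u => F (Fin.cons false u)) (F₁ := fun u => F (Fin.cons true u)) hy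
    have hns : ¬ NonSimple (marginal F (Fin.cons 1 (Function.update w j 1)) 0 j.succ) :=
      fun h' => h ⟨0, j.succ, (Fin.succ_ne_zero j).symm, _, h'⟩
    have h2 := NonSimple.of_ne hns (by simpa only [marginal_cons] using hjw)
    simp only [marginal_cons] at h2
    rcases h2 with ⟨h3, h4⟩ | ⟨h3, h4⟩
    · refine ((neq_pps hneq 0 j.succ).mul (h01.rename Fin.succ)).congr fun x => ?_
      rw [apply_cons F x]
      rcases hx0 : x 0 with _ | _ <;> rcases hxj : x j.succ with _ | _
      · simp [half_eq_zero hw h3 (x := x ∘ Fin.succ) hxj]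
      · simp [half_eq_zero hw h4 (x := x ∘ Fin.succ) hxj]
      · simp [half_eq_zero hw h3 (x := x ∘ Fin.succ) hxj]
      · simp [half_eq_zero hw h4 (x := x ∘ Fin.succ) hxj]
    · refine ((hA.eq 0 j.succ).mul (h01.rename Fin.succ)).congr fun x => ?_
      rw [apply_cons F x]
      rcases hx0 : x 0 with _ | _ <;> rcases hxj : x j.succ with _ | _
      · simp [half_eq_zero hw h4 (x := x ∘ Fin.succ) hxj]
      · simp [half_eq_zero hw h3 (x := x ∘ Fin.succ) hxj]
      · simp [half_eq_zero hw h4 (x := x ∘ Fin.succ) hxj]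
      · simp [half_eq_zero hw h3 (x := x ∘ Fin.succ) hxj]

theorem IsValueClass.marginal_mem (hV : IsValueClass V) {F : (Fin n → Bool) → ℝ≥0}
    (hF : ∀ x, V (F x)) (w : Fin n → Bool → ℕ) (i j : Fin n) (a b : Bool) :
    V (marginal F w i j a b) := by
  refine hV.sum _ fun x => ?_
  split_ifs
  · rw [← Nat.cast_prod]
    exact hV.natCast_mul _ (hF x)
  · exact hV.zero

theorem IsBase.pps_marginal (hA : IsBase V A) {F : (Fin n → Bool) → ℝ≥0} (hF : Pps A (Fin n) F)
    (w : Fin n → Bool → ℕ) (i j : Fin n) :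
    Pps A (Fin 2) fun x => marginal F w i j (x 0) (x 1) := by
  have h1 : Pps A (Fin 2 ⊕ Fin n) fun x => ∏ k, (w k (x (.inr k)) : ℝ≥0) :=
    Pps.prod _ fun k _ => hA.unary (u := fun b => (w k b : ℝ≥0))
      (fun b => hA.vals.natCast _) (Sum.inr k)
  refine (((hA.eq (Sum.inr i) (Sum.inl 0)).mul (hA.eq (Sum.inr j) (Sum.inl 1))).mul
    (h1.mul (hF.rename Sum.inr))).sum.congr fun x => ?_
  rw [marginal]
  refine Finset.sum_congr rfl fun y _ => ?_
  simp only [Sum.elim_inr, Sum.elim_inl, Sum.elim_comp_inr]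
  by_cases h1 : y i = x 0 <;> by_cases h2 : y j = x 1 <;> simp [h1, h2]

theorem Pps.ppsDefinable {F : BFun} (h : Pps A (Fin F.arity) F.val) : PPSDefinable A F := by
  obtain ⟨b, L, h⟩ := h
  exact ⟨⟨b, L⟩, fun x => (h x).symm⟩

end Structure

/-! ### Binary functions with a single zero -/

/-- The binary function that is `0` at `(s, t)` and `1` elsewhere. -/
def forb (s t x y : Bool) : ℝ≥0 := if x = s ∧ y = t then 0 else 1

/-- The function `forb s t` is approximable over `A`. -/
def Gate (A : Set BFun) (s t : Bool) : Prop := Approx A (Fin 2) fun x => forb s t (x 0) (x 1)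

section Binary

variable {V : ℝ≥0 → Prop} {A : Set BFun} {W : Type}

theorem Gate.swap {s t : Bool} (h : Gate A s t) : Gate A t s :=
  (h.rename ![1, 0]).congr fun x => by simp [forb, and_comm]

/-- The approximants of `forb s t` at a rate that beats the factor `2 ^ k`. -/
theorem Gate.exists_family {s t : Bool} (h : Gate A s t) : ∃ g : ℕ → Bool → Bool → ℝ≥0,
    (∀ (W : Type) (u v : W), Reg A W fun k x => g k (x u) (x v)) ∧
    (∀ x y, ExpLim (fun k => (g k x y : ℝ)) (forb s t x y)) ∧
    ExpLim (fun k => 2 ^ k * (g k s t : ℝ)) 0 := by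
  obtain ⟨f, hf, h1, h2⟩ := h.exists_reg
  refine ⟨fun k a b => f k ![a, b], fun W u v => ?_, fun x y => ?_, ?_⟩
  · refine (hf.rename ![u, v]).congr fun k x => congrArg (f k) ?_
    funext i
    fin_cases i <;> rfl
  · simpa using h1 ![x, y]
  · exact h2 ![s, t] (by simp [forb])

/-- The powers of a function with values in `[0, 1]` converge to an indicator function. -/
theorem Pps.approx_indicator [Finite W] {g : (W → Bool) → ℝ≥0} (hg : Pps A W g)
    (h : ∀ x, g x ≤ 1) : Approx A W fun x => if g x = 1 then 1 else 0 := by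
  refine approx_of_expLim hg.reg_pow fun x => ?_
  by_cases hx : g x = 1
  · simpa [hx] using ExpLim.const 1
  · have h1 : (g x : ℝ) < 1 := by exact_mod_cast lt_of_le_of_ne (h x) hx
    simpa [hx] using ExpLim.pow_zero (g x).coe_nonneg h1

/-- If three values of a binary function are positive, then multiplication with unary functions
makes them equal to `1`, and the fourth value becomes less than `1` if the diagonal with this value
has the smaller product. -/
theorem IsBase.gate (hA : IsBase V A) {G : Bool → Bool → ℝ≥0} (hG : ∀ a b, V (G a b))
    (hpps : Pps A (Fin 2) fun x => G (x 0) (x 1)) {s t : Bool} (h1 : 0 < G (!s) (!t))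
    (h2 : 0 < G (!s) t) (h3 : 0 < G s (!t)) (h : G s t * G (!s) (!t) < G s (!t) * G (!s) t) :
    Gate A s t := by
  have hq := hA.unary (u := fun b => (G (!s) b)⁻¹) (fun b => hA.vals.inv (hG _ _)) (1 : Fin 2)
  have hp := hA.unary (u := fun b => if b = s then G (!s) (!t) else 1) (fun b => by
    split_ifs
    · exact hG _ _
    · exact hA.vals.one) (0 : Fin 2)
  have hp' := hA.unary (u := fun b => if b = s then (G s (!t))⁻¹ else 1) (fun b => by
    split_ifs
    · exact hA.vals.inv (hG _ _)
    · exact hA.vals.one) (0 : Fin 2)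
  set g : Bool → Bool → ℝ≥0 := fun x y => (G x y * (G (!s) y)⁻¹) *
    ((if x = s then G (!s) (!t) else 1) * if x = s then (G s (!t))⁻¹ else 1) with hg
  have e1 : g (!s) (!t) = 1 := by simp [hg, mul_inv_cancel₀ h1.ne']
  have e2 : g (!s) t = 1 := by simp [hg, mul_inv_cancel₀ h2.ne']
  have e3 : g s (!t) = 1 := by
    simp only [hg, if_true]
    field_simp
  have e4 : g s t < 1 := by
    have e : g s t = (G s t * G (!s) (!t)) / (G s (!t) * G (!s) t) := by
      simp only [hg, if_true]
      field_simp
    rw [e, div_lt_one (mul_pos h3 h2)]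
    exact h
  have key : ∀ x y, g x y ≤ 1 ∧ (if g x y = 1 then 1 else 0) = forb s t x y := by
    intro x y
    by_cases hx : x = s
    · subst hx
      by_cases hy : y = t
      · subst hy
        exact ⟨e4.le, by simp [forb, e4.ne]⟩
      · obtain rfl : y = !t := by cases y <;> cases t <;> simp_all
        exact ⟨e3.le, by simp [forb, e3]⟩
    · obtain rfl : x = !s := by cases x <;> cases s <;> simp_all
      by_cases hy : y = t
      · subst hy
        exact ⟨e2.le, by simp [forb, e2]⟩
      · obtain rfl : y = !t := by cases y <;> cases t <;> simp_all
        exact ⟨e1.le, by simp [forb, e1]⟩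
  have hfin : Pps A (Fin 2) fun x => g (x 0) (x 1) := (hpps.mul hq).mul (hp.mul hp')
  exact (hfin.approx_indicator fun x => (key _ _).1).congr fun x => (key _ _).2

theorem IsBase.two (hA : IsBase V A) : V 2 := by exact_mod_cast hA.vals.natCast 2

/-- The weight that is doubled at `c`. -/
def dbl (c b : Bool) : ℝ≥0 := if b = c then 2 else 1

theorem IsBase.dbl_mem (hA : IsBase V A) (c b : Bool) : V (dbl c b) := by
  unfold dbl
  split_ifs
  · exact hA.two
  · exact hA.vals.one

/-- The weight that is halved unless the argument is `c`. -/
def halve (c b : Bool) : ℝ≥0 := if b = c then 1 else 2⁻¹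

theorem IsBase.halve_mem (hA : IsBase V A) (c b : Bool) : V (halve c b) := by
  unfold halve
  split_ifs
  · exact hA.vals.one
  · exact hA.vals.inv hA.two

theorem expLim_half : ExpLim (fun k => (2⁻¹ : ℝ) ^ k) 0 :=
  ExpLim.pow_zero (by norm_num) (by norm_num)

/-- An implication from a gate `forb c c`: a new variable `z` is preferred to have the value `c`,
and prevented from it if `x` or `y` has the value `c`. The common factor of the case `x ≠ c` is
removed, and then the case `x ≠ c`, `y = c` vanishes in the limit. -/
theorem IsBase.gate_not (hA : IsBase V A) {c : Bool} (h : Gate A c c) : Gate A (!c) c := by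
  obtain ⟨g, hg, hl, h2⟩ := h.exists_family
  have hreg := ((((hA.unary (hA.dbl_mem c) (Sum.inr () : Fin 2 ⊕ Unit)).reg_pow).mul
    ((hg _ (Sum.inl 0 : Fin 2 ⊕ Unit) (Sum.inr ())).mul (hg _ (Sum.inl 1) (Sum.inr ())))).mul
    ((hA.unary (hA.halve_mem c) (Sum.inl 0 : Fin 2 ⊕ Unit)).reg_pow)).sum_bool
  refine approx_of_expLim hreg fun x => ?_
  have hne : (!c) ≠ c := by cases c <;> simp
  have e : ∀ f : Bool → ℝ≥0, ∑ b, f b = f c + f (!c) := by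
    intro f; cases c <;> simp [add_comm]
  simp only [e, Sum.elim_inr, Sum.elim_inl]
  have hnc : ∀ y, (forb c c y (!c) : ℝ) = 1 := by simp [forb, hne]
  have hcn : ∀ y, (forb c c (!c) y : ℝ) = 1 := by simp [forb, hne]
  push_cast
  by_cases hx : x 0 = c
  · rw [hx]
    have h3 := (h2.mul (hl (x 1) c)).add ((hl c (!c)).mul (hl (x 1) (!c)))
    rw [hnc, hnc] at h3
    convert h3 using 1
    · funext k
      simp [dbl, halve, hne, mul_assoc]
    · simp [forb, hne.symm]
  · replace hx : x 0 = !c := by revert hx; cases x 0 <;> cases c <;> simp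
    rw [hx]
    have h3 := ((hl (!c) c).mul (hl (x 1) c)).add
      (((hl (!c) (!c)).mul (hl (x 1) (!c))).mul expLim_half)
    rw [hnc, hnc, hcn] at h3
    convert h3 using 1
    · funext k
      have : (2 : ℝ) ^ k * (2 ^ k)⁻¹ = 1 := mul_inv_cancel₀ (by positivity)
      simp only [dbl, halve, hne, if_true, if_false, NNReal.coe_ofNat, NNReal.coe_one,
        one_pow, one_mul, NNReal.coe_inv, inv_pow]
      linear_combination (g k (!c) c : ℝ) * g k (x 1) c * this
    · simp [forb]

/-- The value that becomes the zero of the gate is chosen on the diagonal with the smaller product;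
the other three values are positive for one of the two choices. -/
theorem NonSimple.gate {G : Bool → Bool → ℝ≥0} (h : NonSimple G) (hA : IsBase V A)
    (hG : ∀ a b, V (G a b)) (hpps : Pps A (Fin 2) fun x => G (x 0) (x 1)) :
    Gate A true false := by
  obtain ⟨hd, h⟩ := h
  rcases lt_or_gt_of_ne hd with hlt | hlt
  · have hpos : 0 < G false true * G true false := lt_of_le_of_lt zero_le hlt
    have hb : 0 < G false true := (CanonicallyOrderedAdd.mul_pos.1 hpos).1
    have hc : 0 < G true false := (CanonicallyOrderedAdd.mul_pos.1 hpos).2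
    have had : 0 < G false false ∨ 0 < G true true := by tauto
    rcases had with ha | hd
    · have h1 : Gate A true true := hA.gate hG hpps ha hb hc (by
        rw [mul_comm]; simpa [mul_comm] using hlt)
      exact (hA.gate_not h1).swap
    · have h1 : Gate A false false := hA.gate hG hpps hd hc hb (by simpa using hlt)
      exact hA.gate_not h1
  · have hpos : 0 < G false false * G true true := lt_of_le_of_lt zero_le hlt
    have ha : 0 < G false false := (CanonicallyOrderedAdd.mul_pos.1 hpos).1
    have hd : 0 < G true true := (CanonicallyOrderedAdd.mul_pos.1 hpos).2
    have hbc : 0 < G false true ∨ 0 < G true false := by tauto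
    rcases hbc with hb | hc
    · exact hA.gate hG hpps hb ha hd (by simpa [mul_comm] using hlt)
    · have h1 : Gate A false true := hA.gate hG hpps hc hd ha (by simpa [mul_comm] using hlt)
      exact h1.swap

/-! ### Functions that are not log-supermodular -/

/-- A failure of log-supermodularity is visible on two variables, as a binary function that is zero
on the diagonal or has three positive values. -/
theorem IsBase.gate_of_not_lsm (hA : IsBase V A) {F : BFun} (hF : F ∈ funsOf V) (hFA : F ∈ A)
    (h : F ∉ LSM) (himp : Gate A true false) : ∃ c, Gate A c c := by
  simp only [LSM, Set.mem_ofPred_eq, not_forall, not_le] at h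
  obtain ⟨x, y, h⟩ := h
  -- pin the variables on which `x` and `y` agree, and identify the others according to `x`
  let r : Fin F.arity → Fin 2 ⊕ Bool := fun i =>
    if x i = y i then .inr (x i) else if x i then .inl 0 else .inl 1
  let G : Bool → Bool → ℝ≥0 := fun a b => F.val fun i => Sum.elim ![a, b] id (r i)
  have hG : ∀ a b, V (G a b) := fun a b => hF _
  have hpps : Pps A (Fin 2) fun x => G (x 0) (x 1) := by
    have h0 := hA.unary (u := fun b => if b then 0 else 1) (by
      rintro (_ | _) <;> simp [hA.vals.zero, hA.vals.one]) (Sum.inr false : Fin 2 ⊕ Bool)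
    have h1 := hA.unary (u := fun b => if b then 1 else 0) (by
      rintro (_ | _) <;> simp [hA.vals.zero, hA.vals.one]) (Sum.inr true : Fin 2 ⊕ Bool)
    refine ((h0.mul h1).mul (Pps.atom hFA r)).sum.congr fun u => ?_
    rw [Finset.sum_eq_single id]
    · have : (u : Fin 2 → Bool) = ![u 0, u 1] := by funext i; fin_cases i <;> rfl
      simp only [Sum.elim_inr, id, G]
      rw [← this]
      simp
    · intro b _ hb
      have : ¬ (b false = false ∧ b true = true) := fun h' => hb (by
        funext c; cases c
        · exact h'.1
        · exact h'.2)
      simp only [Sum.elim_inr]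
      by_cases hbf : b false = true <;> by_cases hbt : b true = true <;> simp_all
    · simp
  have e10 : G true false = F.val x := congrArg F.val (by
    funext i
    by_cases h1 : x i = y i <;> cases h2 : x i <;> simp_all [r])
  have e01 : G false true = F.val y := congrArg F.val (by
    funext i
    by_cases h1 : x i = y i <;> cases h2 : x i <;> simp_all [r])
  have e11 : G true true = F.val (x ⊔ y) := congrArg F.val (by
    funext i
    by_cases h1 : x i = y i <;> cases h2 : x i <;> cases h3 : y i <;> simp_all [r])
  have e00 : G false false = F.val (x ⊓ y) := congrArg F.val (by
    funext i
    by_cases h1 : x i = y i <;> cases h2 : x i <;> cases h3 : y i <;> simp_all [r])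
  rw [← e10, ← e01, ← e11, ← e00] at h
  have hpos : 0 < G true false * G false true := lt_of_le_of_lt zero_le h
  have hc : 0 < G true false := (CanonicallyOrderedAdd.mul_pos.1 hpos).1
  have hb : 0 < G false true := (CanonicallyOrderedAdd.mul_pos.1 hpos).2
  by_cases ha : 0 < G false false
  · exact ⟨true, hA.gate hG hpps ha hb hc h⟩
  by_cases hd : 0 < G true true
  · exact ⟨false, hA.gate hG hpps hd hc hb (by simpa [mul_comm] using h)⟩
  -- `G` is a weighted disequality
  rw [not_lt, nonpos_iff_eq_zero] at ha hd
  have hneq : Pps A (Fin 2) fun x => if x 0 = x 1 then 0 else 1 := by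
    refine (hpps.mul (hA.unary (u := fun b => (G b (!b))⁻¹) (fun b => hA.vals.inv (hG _ _))
      0)).congr fun u => ?_
    cases u 0 <;> cases u 1 <;> simp [ha, hd, mul_inv_cancel₀ hb.ne', mul_inv_cancel₀ hc.ne']
  obtain ⟨g, hg, hl, -⟩ := himp.exists_family
  refine ⟨true, approx_of_expLim (((hg (Fin 2 ⊕ Unit) (.inl 0) (.inr ())).mul
    (hneq.rename ![Sum.inl 1, Sum.inr ()]).reg).sum_bool) fun u => ?_⟩
  convert hl (u 0) (!(u 1)) using 1
  · funext k
    rcases Bool.eq_false_or_eq_true (u 1) with h1 | h1 <;> simp [h1]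
  · cases u 0 <;> cases u 1 <;> simp [forb]

/-- With an implication and a gate `forb c c`, all functions are approximable. For each point `a`
there is a variable `z` that is preferred to have the value `c`, with the weight `2 ^ k`, and
prevented from it unless `x = a`; in the latter case it contributes the factor `2 ^ k * G a`. -/
theorem IsBase.approx_of_gates (hA : IsBase V A) (himp : Gate A true false) {c : Bool}
    (hc : Gate A c c) {n : ℕ} {G : (Fin n → Bool) → ℝ≥0} (hG : ∀ x, V (G x)) :
    Approx A (Fin n) G := by
  have hne : (!c) ≠ c := by cases c <;> simp
  have hgate : ∀ t, Gate A c t := by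
    intro t
    by_cases ht : t = c
    · exact ht ▸ hc
    · cases c <;> cases t <;> simp_all [himp.swap]
  choose g hg hl h2 using fun t => (hgate t).exists_family
  have hfac : ∀ a : Fin n → Bool, Reg A (Fin n) fun k x => ∑ z : Bool,
      (if z = c then G a else 1) * dbl c z ^ k * ∏ i, g (!(a i)) k z (x i) := by
    intro a
    refine (((hA.unary (u := fun z => if z = c then G a else 1) (fun z => ?_)
      (Sum.inr () : Fin n ⊕ Unit)).reg.mul (hA.unary (hA.dbl_mem c) (Sum.inr ())).reg_pow).mul
        (Reg.prod Finset.univ fun i _ => hg (!(a i)) _ (Sum.inr ()) (Sum.inl i))).sum_bool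
    split_ifs
    · exact hG a
    · exact hA.vals.one
  have hreg := ((hA.const (W := Fin n) (hA.vals.inv hA.two)).reg_pow).mul
    (Reg.prod Finset.univ fun a _ => hfac a)
  refine approx_of_expLim hreg fun x => ?_
  have e : ∀ f : Bool → ℝ≥0, ∑ b, f b = f c + f (!c) := by
    intro f; cases c <;> simp [add_comm]
  simp only [e]
  push_cast
  -- the two terms of a factor
  let T : (Fin n → Bool) → ℕ → ℝ := fun a k => ∏ i, (g (!(a i)) k c (x i) : ℝ)
  let T' : (Fin n → Bool) → ℕ → ℝ := fun a k => ∏ i, (g (!(a i)) k (!c) (x i) : ℝ)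
  have hT' : ∀ a, ExpLim (T' a) 1 := by
    intro a
    have := ExpLim.prod Finset.univ fun i _ => hl (!(a i)) (!c) (x i)
    simpa [forb, hne] using this
  have hT : ExpLim (T x) 1 := by
    have := ExpLim.prod Finset.univ fun i _ => hl (!(x i)) c (x i)
    simpa [forb] using this
  have hT0 : ∀ a, a ≠ x → ExpLim (fun k => 2 ^ k * T a k) 0 := by
    intro a ha
    obtain ⟨i, hi⟩ := Function.ne_iff.1 ha
    have hi' : x i = !(a i) := by cases h1 : x i <;> cases h2 : a i <;> simp_all
    have h3 := (h2 (!(a i))).mul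
      (ExpLim.prod (Finset.univ.erase i) fun j _ => hl (!(a j)) c (x j))
    rw [zero_mul] at h3
    refine h3.congr fun k => ?_
    simp only [T]
    rw [← Finset.mul_prod_erase Finset.univ _ (Finset.mem_univ i), hi', mul_assoc]
  let P : (Fin n → Bool) → ℕ → ℝ := fun a k => G a * (2 ^ k * T a k) + T' a k
  have hP : ∀ a, a ≠ x → ExpLim (P a) 1 := by
    intro a ha
    simpa using ((ExpLim.const (G a : ℝ)).mul (hT0 a ha)).add (hT' a)
  have hPx : ExpLim (fun k => (G x : ℝ) * T x k + 2⁻¹ ^ k * T' x k) (G x) := by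
    simpa using ((ExpLim.const (G x : ℝ)).mul hT).add (expLim_half.mul (hT' x))
  have hfin := hPx.mul (ExpLim.prod (Finset.univ.erase x) fun a ha =>
    hP a (Finset.ne_of_mem_erase ha))
  rw [Finset.prod_const_one, mul_one] at hfin
  refine hfin.congr fun k => ?_
  rw [← Finset.mul_prod_erase Finset.univ _ (Finset.mem_univ x), ← mul_assoc]
  congr 1
  · have : (2⁻¹ : ℝ) ^ k * 2 ^ k = 1 := by rw [← mul_pow]; norm_num
    simp only [if_true, hne, if_false, dbl, T, T', NNReal.coe_ofNat, NNReal.coe_one, one_pow]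
    linear_combination -(G x : ℝ) * (∏ i, (g (!(x i)) k c (x i) : ℝ)) * this
  · refine Finset.prod_congr rfl fun a _ => ?_
    simp only [P, if_true, hne, if_false, dbl, T, T', NNReal.coe_ofNat, NNReal.coe_one, one_pow]
    ring

end Binary

/-! ### The dichotomy -/

theorem isBase_of_mem {V : ℝ≥0 → Prop} (hV : IsValueClass V) (X : Set BFun) :
    IsBase V ((X ∪ unary (funsOf V)) ∪ {EQ}) :=
  ⟨hV, .inr rfl, fun _ h => .inl (.inr h)⟩

theorem imp_mem_funsOf {V : ℝ≥0 → Prop} (hV : IsValueClass V) : IMP ∈ funsOf V := by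
  intro x
  simp only [IMP]
  split_ifs
  · exact hV.zero
  · exact hV.one

/-- A function outside the clone generated by disequality and the unary functions approximates the
implication. -/
theorem gate_of_notMem_clone {V : ℝ≥0 → Prop} (hV : IsValueClass V) {F : BFun}
    (hF : F ∈ funsOf V) (h : F ∉ clone (funsOf V) ({NEQ} ∪ unary (funsOf V))) :
    Gate (({F} ∪ unary (funsOf V)) ∪ {EQ}) true false := by
  have hns : HasNonSimple F.val := by
    by_contra hns
    exact h ⟨hF, (pps_of_not_hasNonSimple (isBase_of_mem hV {NEQ}) (.inl (.inl rfl)) hF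
      hns).ppsDefinable⟩
  obtain ⟨i, j, -, w, hw⟩ := hns
  have hA := isBase_of_mem hV {F}
  exact hw.gate hA (fun a b => hV.marginal_mem hF w i j a b)
    (hA.pps_marginal ((Pps.atom (.inl (.inl rfl)) id).congr fun x => rfl) w i j)

theorem approx_of_mem {A : Set BFun} {G : BFun} (h : G ∈ A) : Approx A (Fin G.arity) G.val :=
  (Pps.atom h id).approx

theorem Gate.approx_imp {A : Set BFun} (h : Gate A true false) :
    Approx A (Fin IMP.arity) IMP.val :=
  Approx.congr (V := Fin 2) h fun _ => rfl

/-- If the implication is approximable, then so are all generators of its clone. -/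
theorem approx_imp_unary {V : ℝ≥0 → Prop} {X : Set BFun}
    (h : Gate ((X ∪ unary (funsOf V)) ∪ {EQ}) true false) :
    ∀ G ∈ ({IMP} ∪ unary (funsOf V)) ∪ {EQ},
      Approx ((X ∪ unary (funsOf V)) ∪ {EQ}) (Fin G.arity) G.val := by
  rintro G ((rfl | hG) | rfl)
  · exact h.approx_imp
  · exact approx_of_mem (.inl (.inr hG))
  · exact approx_of_mem (.inr rfl)

theorem approx_of_not_lsm {V : ℝ≥0 → Prop} (hV : IsValueClass V) {F : BFun}
    (hF : F ∈ funsOf V) (hlsm : F ∉ LSM)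
    (h : Gate (({F} ∪ unary (funsOf V)) ∪ {EQ}) true false) {G : BFun} (hG : G ∈ funsOf V) :
    Approx (({F} ∪ unary (funsOf V)) ∪ {EQ}) (Fin G.arity) G.val := by
  have hA := isBase_of_mem hV {F}
  obtain ⟨c, hc⟩ := hA.gate_of_not_lsm hF (.inl (.inl rfl)) hlsm h
  exact hA.approx_of_gates h hc hG

/-- The efficient version, for any class of values. -/
theorem dichotomy_eff {V : ℝ≥0 → Prop} (hV : IsValueClass V) {F : BFun} (hF : F ∈ funsOf V)
    (h : F ∉ clone (funsOf V) ({NEQ} ∪ unary (funsOf V))) :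
    IMP ∈ cloneLimEff (funsOf V) ({F} ∪ unary (funsOf V)) ∧
      cloneLimEff (funsOf V) ({IMP} ∪ unary (funsOf V)) ⊆
        cloneLimEff (funsOf V) ({F} ∪ unary (funsOf V)) ∧
      (F ∉ LSM → cloneLimEff (funsOf V) ({F} ∪ unary (funsOf V)) = funsOf V) := by
  have hg := gate_of_notMem_clone hV hF h
  refine ⟨⟨imp_mem_funsOf hV, hg.approx_imp.limEffDefinable (.inr rfl)⟩,
    fun G hG => ⟨hG.1, hG.2.subst (.inr rfl) (approx_imp_unary hg)⟩,
    fun hlsm => Set.Subset.antisymm (fun G hG => hG.1) fun G hG => ⟨hG,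
      (approx_of_not_lsm hV hF hlsm hg hG).limEffDefinable (.inr rfl)⟩⟩

/-- The non-efficient version, for any class of values. -/
theorem dichotomy {V : ℝ≥0 → Prop} (hV : IsValueClass V) {F : BFun} (hF : F ∈ funsOf V)
    (h : F ∉ clone (funsOf V) ({NEQ} ∪ unary (funsOf V))) :
    IMP ∈ cloneLim (funsOf V) ({F} ∪ unary (funsOf V)) ∧
      cloneLim (funsOf V) ({IMP} ∪ unary (funsOf V)) ⊆
        cloneLim (funsOf V) ({F} ∪ unary (funsOf V)) ∧
      (F ∉ LSM → cloneLim (funsOf V) ({F} ∪ unary (funsOf V)) = funsOf V) := by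
  have hg := gate_of_notMem_clone hV hF h
  refine ⟨⟨imp_mem_funsOf hV, (hg.approx_imp.limEffDefinable (.inr rfl)).limDefinable⟩,
    fun G hG => ⟨hG.1, hG.2.subst (.inr rfl) (approx_imp_unary hg)⟩,
    fun hlsm => Set.Subset.antisymm (fun G hG => hG.1) fun G hG => ⟨hG,
      ((approx_of_not_lsm hV hF hlsm hg hG).limEffDefinable (.inr rfl)).limDefinable⟩⟩

theorem funsOf_true : funsOf (fun _ => True) = allFuns :=
  Set.eq_univ_of_forall fun _ _ => trivial

end FunctionalClone

end

theorem theorem1 :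
    (∀ F ∈ polyFuns, F ∉ clone polyFuns ({NEQ} ∪ unary polyFuns) →
      IMP ∈ cloneLimEff polyFuns ({F} ∪ unary polyFuns) ∧
      cloneLimEff polyFuns ({IMP} ∪ unary polyFuns) ⊆
        cloneLimEff polyFuns ({F} ∪ unary polyFuns) ∧
      (F ∉ LSM → cloneLimEff polyFuns ({F} ∪ unary polyFuns) = polyFuns)) ∧
    (∀ F ∈ allFuns, F ∉ clone allFuns ({NEQ} ∪ unary allFuns) →
      IMP ∈ cloneLim allFuns ({F} ∪ unary allFuns) ∧
      cloneLim allFuns ({IMP} ∪ unary allFuns) ⊆ cloneLim allFuns ({F} ∪ unary allFuns) ∧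
      (F ∉ LSM → cloneLim allFuns ({F} ∪ unary allFuns) = allFuns)) := by
  refine ⟨fun F hF h => dichotomy_eff (V := PolyTimeReal) isValueClass_polyTimeReal hF h,
    fun F hF h => ?_⟩
  rw [← funsOf_true] at hF h ⊢
  exact dichotomy isValueClass_true hF h
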